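/- Let $f:\mathbb R^{d_1}\times\mathbb R^{d_2}\to\mathbb R$ be differentiable, with partial gradients satisfying $\|\nabla_x f(x_1,y_1)-\nabla_x f(x_2,y_2)\|\le l(\|x_1-x_2\|+\|y_1-y_2\|)$ and likewise for $\nabla_y f$. Suppose that for every $x$ the maximum of $f(x,\cdot)$ is attained and, with $\Phi(x)=\max_y f(x,y)$, the PL inequality $\|\nabla_y f(x,y)\|^2\ge 2\mu[\Phi(x)-f(x,y)]$ holds, where $0<\mu\le l$. Put $\kappa=l/\mu\ge 1$. Let $\Phi^*$ be a finite lower bound of $\Phi$, let $\Delta=\Phi(z_0)-\Phi^*>0$, and let $b_0=2[\max_y \hat f(x_0,y)-\min_x \hat f(x,y_0)]$ with $\hat f(x,y)=f(x,y)+l\|x-z_0\|^2$; let $B\ge0$ be such that $b_0\le B\Delta$. Let $\epsilon>0$. In the stochastic setting, only unbiased estimators $G_x(x,y,\xi)$, $G_y(x,y,\xi)$ of $\nabla_x f$, $\nabla_y f$ with variances at most $\sigma^2$, $\sigma>0$, are available, each query using a fresh i.i.d. sample $\xi$; in the deterministic setting $G_x=\nabla_x f$ and $G_y=\nabla_y f$.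 Stage 1 (Smoothed-AGDA). From $(x_0,y_0,z_0)$ iterate, for $t=0,\dots,T-1$, $$x_{t+1}=x_t-\tau_1[G_x(x_t,y_t,\xi_1^t)+2l(x_t-z_t)],\quad y_{t+1}=y_t+\tau_2G_y(x_{t+1},y_t,\xi_2^t),\quad z_{t+1}=z_t+\beta(x_{t+1}-z_t),$$ with $\beta=\tau_2\mu/1600$ and $\tau_1=\frac1{3l}$, $\tau_2=\frac1{144l}$ (deterministic), respectively $\tau_1=\min\{\frac{\sqrt\Delta}{2\sigma\sqrt{Tl}},\frac1{3l}\}$, $\tau_2=\min\{\frac{\sqrt\Delta}{96\sigma\sqrt{Tl}},\frac1{144l}\}$ (stochastic). The output $(\hat x,\hat y)$ is chosen uniformly from $\{(x_t,y_t)\}_{t=0}^{T-1}$, independently of the samples. Stage 2 (AGDA). From $(x^0,y^0)=(\hat x,\hat y)$ run $K$ iterations of AGDA on $\min_x\max_y f(x,y)+l\|x-\hat x\|^2$ with step sizes $\eta_1,\eta_2>0$: $$y^{k+1}=y^k+\eta_2G_y(x^k,y^k,\cdot),\qquad x^{k+1}=x^k-\eta_1[G_x(x^k,y^{k+1},\cdot)+2l(x^k-\hat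 x)],$$ and return $x^K$. There is a universal constant $C>0$ such that $\Phi$ is differentiable and the following holds, where the parameters $T\ge 1,K,\eta_1,\eta_2$ depend only on $l,\mu,\Delta,B,\epsilon$ (and on $\sigma$ in the stochastic setting), and $N$ is the total number of (stochastic) gradients evaluated in both stages. Deterministic setting: $\mathbb E\|\nabla\Phi(x^K)\|^2\le (C\epsilon)^2$, the expectation being over the uniform choice of $(\hat x,\hat y)$. Moreover some iterate $(x_t,y_t)$, $t<T$, is an $(\epsilon,\epsilon/\sqrt\kappa)$-stationary point of $f$ (that is, $\|\nabla_xf(x_t,y_t)\|\le\epsilon$ and $\|\nabla_yf(x_t,y_t)\|\le\epsilon/\sqrt\kappa$), and whenever $(\hat x,\hat y)$ is such an iterate, $\|\nabla\Phi(x^K)\|\le C\epsilon$. The complexity satisfies $N\le C\left[(1+B)\frac{l\kappa\Delta}{\epsilon^2}+\kappa(1+\log\kappa)\right]$ and, if $\epsilon^2(1+\log\kappa)\le l\Delta$, $$N\le C(1+B)\,\frac{l\kappa\Delta}{\epsilon^2}.$$ Stochastic setting: $\mathbb E\|\nabla\Phi(x^K)\|^2\le (C\epsilon)^2$. The complexity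 satisfies $N\le C\left[(1+B)^2\left(\frac{l\kappa\Delta}{\epsilon^2}+\frac{l\kappa^2\Delta\sigma^2}{\epsilon^4}\right)+(1+\log\kappa)\left(\kappa+\frac{\kappa^5\sigma^2}{\epsilon^2}\right)\right]$ and, if $\epsilon^2\le l\Delta$, $$N\le C(1+B)^2(1+\log\kappa)\left(\frac{l\kappa\Delta}{\epsilon^2}+\frac{l\kappa^2\Delta\sigma^2}{\epsilon^4}+\frac{\kappa^5\sigma^2}{\epsilon^2}\right).$$ -/

import Mathlib

open MeasureTheory ProbabilityTheory
open scoped ENNReal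

noncomputable section

namespace NCPL

/-- The Euclidean space of dimension `d`. -/
abbrev Euc (d : ℕ) : Type := EuclideanSpace ℝ (Fin d)

/-! Objective functions `f : ℝ^m → ℝ^n → ℝ`, to be minimized in the first variable and maximized
in the second one. -/

section Objective

variable {m n : ℕ}

/-- The partial gradient in `x`. -/
def gradX (f : Euc m → Euc n → ℝ) (x : Euc m) (y : Euc n) : Euc m :=
  gradient (fun x' => f x' y) x

/-- The partial gradient in `y`. -/
def gradY (f : Euc m → Euc n → ℝ) (x : Euc m) (y : Euc n) : Euc n :=
  gradient (fun y' => f x y') y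

/-- The primal function `Φ x = max_y f x y`. -/
def primal (f : Euc m → Euc n → ℝ) (x : Euc m) : ℝ := ⨆ y, f x y

/-- The primal-dual gap `max_y f x₀ y - min_x f x y₀`. -/
def gap (f : Euc m → Euc n → ℝ) (x₀ : Euc m) (y₀ : Euc n) : ℝ :=
  (⨆ y, f x₀ y) - ⨅ x, f x y₀

/-- The auxiliary objective `f x y + l ‖x - z‖²`. -/
def aux (f : Euc m → Euc n → ℝ) (l : ℝ) (z : Euc m) (x : Euc m) (y : Euc n) : ℝ :=
  f x y + l * ‖x - z‖ ^ 2

/-- `f` is differentiable and both partial gradients are Lipschitz with constant `l`. -/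
structure LipschitzSmooth (f : Euc m → Euc n → ℝ) (l : ℝ) : Prop where
  differentiable : Differentiable ℝ (fun q : Euc m × Euc n => f q.1 q.2)
  lipschitz_x : ∀ x₁ y₁ x₂ y₂,
    ‖gradX f x₁ y₁ - gradX f x₂ y₂‖ ≤ l * (‖x₁ - x₂‖ + ‖y₁ - y₂‖)
  lipschitz_y : ∀ x₁ y₁ x₂ y₂,
    ‖gradY f x₁ y₁ - gradY f x₂ y₂‖ ≤ l * (‖x₁ - x₂‖ + ‖y₁ - y₂‖)

/-- For every `x` the maximum of `f x` is attained, and the Polyak-Lojasiewicz inequality holds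
in `y` with constant `μ`. -/
structure PLInY (f : Euc m → Euc n → ℝ) (μ : ℝ) : Prop where
  exists_max : ∀ x, ∃ y', ∀ y, f x y ≤ f x y'
  pl : ∀ x y, 2 * μ * (primal f x - f x y) ≤ ‖gradY f x y‖ ^ 2

/-- `(x, y)` is an `(ε₁, ε₂)`-stationary point of `f`. -/
def IsStationary (f : Euc m → Euc n → ℝ) (ε₁ ε₂ : ℝ) (x : Euc m) (y : Euc n) : Prop :=
  ‖gradX f x y‖ ≤ ε₁ ∧ ‖gradY f x y‖ ≤ ε₂

/-- `Gx`, `Gy` are unbiased estimators, driven by a sample of law `ν`, of the partial gradients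
of `f`, with variances at most `σ²`. -/
structure StochasticGradients {Ξ : Type*} [MeasurableSpace Ξ] (ν : Measure Ξ)
    (f : Euc m → Euc n → ℝ) (Gx : Euc m → Euc n → Ξ → Euc m) (Gy : Euc m → Euc n → Ξ → Euc n)
    (σ : ℝ) : Prop where
  measurable_x : Measurable (fun q : (Euc m × Euc n) × Ξ => Gx q.1.1 q.1.2 q.2)
  measurable_y : Measurable (fun q : (Euc m × Euc n) × Ξ => Gy q.1.1 q.1.2 q.2)
  integrable_x : ∀ x y, Integrable (Gx x y) ν
  integrable_y : ∀ x y, Integrable (Gy x y) ν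
  unbiased_x : ∀ x y, ∫ s, Gx x y s ∂ν = gradX f x y
  unbiased_y : ∀ x y, ∫ s, Gy x y s ∂ν = gradY f x y
  variance_x : ∀ x y, ∫⁻ s, ‖Gx x y s - gradX f x y‖ₑ ^ 2 ∂ν ≤ ENNReal.ofReal (σ ^ 2)
  variance_y : ∀ x y, ∫⁻ s, ‖Gy x y s - gradY f x y‖ₑ ^ 2 ∂ν ≤ ENNReal.ofReal (σ ^ 2)

end Objective

/-! The algorithms access the objective only through a gradient oracle `Gx`, `Gy`. Query number
`q` is answered with the sample `s q` of a stream `s`, and the state of an algorithm carries the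
number of queries made so far, so that every query uses a fresh sample and is counted. With the
one-point sample space and `Gx x y _ = gradX f x y`, `Gy x y _ = gradY f x y` these are the
deterministic algorithms, and the counter is the number of gradients evaluated. -/

section Algorithms

variable {X Y Ξ : Type*} [AddCommGroup X] [Module ℝ X] [AddCommGroup Y] [Module ℝ Y]

/-- State of Smoothed-AGDA. -/
structure SmoothedState (X Y : Type*) where
  x : X
  y : Y
  z : X
  queries : ℕ

/-- One iteration of (stochastic) Smoothed-AGDA. -/
def smoothedStep (Gx : X → Y → Ξ → X) (Gy : X → Y → Ξ → Y) (s : ℕ → Ξ) (τ₁ τ₂ p β : ℝ)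
    (S : SmoothedState X Y) : SmoothedState X Y :=
  let x' := S.x - τ₁ • (Gx S.x S.y (s S.queries) + p • (S.x - S.z))
  let y' := S.y + τ₂ • Gy x' S.y (s (S.queries + 1))
  let z' := S.z + β • (x' - S.z)
  ⟨x', y', z', S.queries + 2⟩

/-- `t` iterations of (stochastic) Smoothed-AGDA. -/
def smoothedRun (Gx : X → Y → Ξ → X) (Gy : X → Y → Ξ → Y) (s : ℕ → Ξ) (τ₁ τ₂ p β : ℝ)
    (x₀ : X) (y₀ : Y) (z₀ : X) (t : ℕ) : SmoothedState X Y :=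
  (smoothedStep Gx Gy s τ₁ τ₂ p β)^[t] ⟨x₀, y₀, z₀, 0⟩

/-- State of AGDA. -/
structure AGDAState (X Y : Type*) where
  x : X
  y : Y
  queries : ℕ

/-- One iteration of (stochastic) alternating gradient descent ascent, dual variable first. -/
def agdaStep (Gx : X → Y → Ξ → X) (Gy : X → Y → Ξ → Y) (s : ℕ → Ξ) (η₁ η₂ : ℝ)
    (S : AGDAState X Y) : AGDAState X Y :=
  let y' := S.y + η₂ • Gy S.x S.y (s S.queries)
  let x' := S.x - η₁ • Gx S.x y' (s (S.queries + 1))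
  ⟨x', y', S.queries + 2⟩

/-- The `x`-oracle of the auxiliary objective `f x y + l ‖x - c‖²`. -/
def auxOracle (Gx : X → Y → Ξ → X) (l : ℝ) (c : X) (x : X) (y : Y) (s : Ξ) : X :=
  Gx x y s + (2 * l) • (x - c)

/-- The two-stage method. Run `T` iterations of Smoothed-AGDA with `p = 2 l` and select the
iterate `(x_t, y_t)`; starting there, and continuing the query count, run `K` iterations of AGDA
on `min_x max_y f x y + l ‖x - x_t‖²`. The final state is returned. -/
def twoStage (Gx : X → Y → Ξ → X) (Gy : X → Y → Ξ → Y) (s : ℕ → Ξ) (l τ₁ τ₂ β : ℝ)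
    (x₀ : X) (y₀ : Y) (z₀ : X) (T : ℕ) (η₁ η₂ : ℝ) (K : ℕ) (t : ℕ) : AGDAState X Y :=
  let run := smoothedRun Gx Gy s τ₁ τ₂ (2 * l) β x₀ y₀ z₀
  (agdaStep (auxOracle Gx l (run t).x) Gy s η₁ η₂)^[K] ⟨(run t).x, (run t).y, (run T).queries⟩

end Algorithms

/-! Step sizes of Smoothed-AGDA. -/

/-- Step size `τ₁` in the stochastic setting. -/
def tauX (l σ Δ : ℝ) (T : ℕ) : ℝ := min (√Δ / (2 * σ * √(T * l))) (1 / (3 * l))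

/-- Step size `τ₂` in the stochastic setting. -/
def tauY (l σ Δ : ℝ) (T : ℕ) : ℝ := min (√Δ / (96 * σ * √(T * l))) (1 / (144 * l))

/-- The deterministic Smoothed-AGDA (exact gradients), `τ₁ = 1/(3l)`, `τ₂ = 1/(144l)`,
`p = 2l`, `β = τ₂ μ / 1600`: state after `t` iterations. -/
def exactSmoothed {m n : ℕ} (f : Euc m → Euc n → ℝ) (l μ : ℝ) (x₀ : Euc m) (y₀ : Euc n)
    (z₀ : Euc m) (t : ℕ) : SmoothedState (Euc m) (Euc n) :=
  smoothedRun (fun x y (_ : Unit) => gradX f x y) (fun x y _ => gradY f x y) (fun _ => ())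
    (1 / (3 * l)) (1 / (144 * l)) (2 * l) (1 / (144 * l) * μ / 1600) x₀ y₀ z₀ t

/-- The deterministic two-stage method (exact gradients), with the same parameters. -/
def exactTwoStage {m n : ℕ} (f : Euc m → Euc n → ℝ) (l μ : ℝ) (x₀ : Euc m) (y₀ : Euc n)
    (z₀ : Euc m) (T : ℕ) (η₁ η₂ : ℝ) (K : ℕ) (t : ℕ) : AGDAState (Euc m) (Euc n) :=
  twoStage (fun x y (_ : Unit) => gradX f x y) (fun x y _ => gradY f x y) (fun _ => ())
    l (1 / (3 * l)) (1 / (144 * l)) (1 / (144 * l) * μ / 1600) x₀ y₀ z₀ T η₁ η₂ K t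

/-- The stochastic two-stage method, with `β = τ₂ μ / 1600`. -/
def stochTwoStage {m n : ℕ} {Ξ : Type*} (Gx : Euc m → Euc n → Ξ → Euc m)
    (Gy : Euc m → Euc n → Ξ → Euc n) (s : ℕ → Ξ) (l μ σ Δ : ℝ) (x₀ : Euc m) (y₀ : Euc n)
    (z₀ : Euc m) (T : ℕ) (η₁ η₂ : ℝ) (K : ℕ) (t : ℕ) : AGDAState (Euc m) (Euc n) :=
  twoStage Gx Gy s l (tauX l σ Δ T) (tauY l σ Δ T) (tauY l σ Δ T * μ / 1600) x₀ y₀ z₀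
    T η₁ η₂ K t

/-- The standing assumptions on the objective and the initial point: `l`-smoothness, the `μ`-PL
condition in `y`, a finite lower bound `Φlow` of the primal function with `Φ z₀ - Φlow = Δ`, and
`b₀ ≤ B Δ`, where `b₀` is twice the primal-dual gap of the first auxiliary objective at the
initial point. -/
structure Setting {m n : ℕ} (f : Euc m → Euc n → ℝ) (l μ Δ B : ℝ) (x₀ : Euc m) (y₀ : Euc n)
    (z₀ : Euc m) (Φlow : ℝ) : Prop where
  smooth : LipschitzSmooth f l
  pl : PLInY f μ
  lower : ∀ x, Φlow ≤ primal f x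
  delta : primal f z₀ - Φlow = Δ
  init : 2 * gap (aux f l z₀) x₀ y₀ ≤ B * Δ

/-- `s` is an i.i.d. stream of samples of law `ν`, and the index `I` is uniformly distributed on
`{0, …, T-1}` and independent of the stream. -/
structure SamplingModel {Ω Ξ : Type*} [MeasurableSpace Ω] [MeasurableSpace Ξ] (P : Measure Ω)
    (ν : Measure Ξ) (s : ℕ → Ω → Ξ) {T : ℕ} (I : Ω → Fin T) : Prop where
  measurable_sample : ∀ k, Measurable (s k)
  measurable_index : Measurable I
  law : ∀ k, P.map (s k) = ν
  indep : iIndepFun s P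
  uniform : ∀ t, P (I ⁻¹' {t}) = (T : ℝ≥0∞)⁻¹
  indep_index : IndepFun I (fun ω k => s k ω) P

end NCPL

end

/-! Stage 1 is driven by the potential `lyapunov` V = `aux` - 2 `dual` + 2 `moreau`. It exceeds
`moreau` by the sum of two nonnegative gaps, so it is bounded below by any lower bound of Φ, and V
at the start is at most (1 + B)Δ above that bound. The auxiliary objective is l-strongly convex in
x. The weight 2 on `dual` lets dual ascent pay for the increase of `aux` in the y-step: with g = ∇_y
f(x, y) and g* = ∇_y f(x*, y), x* the minimizer of the auxiliary objective, ‖g‖² - 2⟨g*, g⟩ = ‖g -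
g*‖² - ‖g*‖², and ‖g - g*‖ is controlled by the primal gradient. The PL inequality at x* bounds the
distance from x* to the proximal point, so the movement of the centre z is absorbed as well. Each
step thus lowers V by a multiple of τ₂(‖∇_x f‖²/κ + ‖∇_y f‖²), up to noise of order lτ₁²σ²; summing
bounds the average of `stationarity` (`primal_step_le`, `lyapunov_dual_smoothing_step`).

Stage 2 uses `auxGap` = (`aux` - `dual`) + 2(`moreau` - `dual`) with the centre fixed. Strong
convexity in x and PL in y make AGDA contract it by 1 - μτ per step (`agda_dual_step_le`,
`agda_primal_step_le`). At the selected point it is at most a multiple of `stationarity`/μ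
(`auxGap_self_le`). Conversely ∇Φ at the proximal point p of x̂ equals 2l(x̂ - p), and ∇Φ is
Lipschitz with constant of order lκ, so ‖∇Φ(x^K)‖² is at most a multiple of l · (initial `auxGap`) +
lκ² · (final `auxGap`) (`norm_gradient_primal_sq_le`). The factor κ² is removed by about 2 log
κ/(μτ) iterations: this is why translation to Φ costs only a logarithm.

In the stochastic setting every one-step bound is affine in the gradient error plus a quadratic
term, so a fresh unbiased sample contributes only its variance. Expectations are Lebesgue integrals
in `ℝ≥0∞`, so integrability along the trajectory never has to be established. -/

namespace NCPL

/-! ### Quadratic bounds for functions with Lipschitz gradient. -/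

section Gradient

variable {E : Type*} [NormedAddCommGroup E] [InnerProductSpace ℝ E] [CompleteSpace E]

theorem le_of_lipschitz_gradient {h : E → ℝ} {L : ℝ} (hd : Differentiable ℝ h)
    (hL : ∀ a b, ‖gradient h a - gradient h b‖ ≤ L * ‖a - b‖) (a b : E) :
    h b ≤ h a + inner ℝ (gradient h a) (b - a) + L / 2 * ‖b - a‖ ^ 2 := by
  set v := b - a with hv
  -- φ is h along the segment minus its claimed quadratic majorant. Monotonicity of φ replaces
  -- integration of the gradient.
  let φ : ℝ → ℝ := fun t =>
    h (a + t • v) - t * inner ℝ (gradient h a) v - L / 2 * t ^ 2 * ‖v‖ ^ 2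
  have hφ : ∀ t, HasDerivAt φ
      (inner ℝ (gradient h (a + t • v)) v - inner ℝ (gradient h a) v - L * t * ‖v‖ ^ 2) t := by
    intro t
    have h1 : HasDerivAt (fun t : ℝ => a + t • v) v t := by
      simpa using ((hasDerivAt_id t).smul_const v).const_add a
    have h2 : HasDerivAt (fun t : ℝ => h (a + t • v)) (inner ℝ (gradient h (a + t • v)) v) t := by
      have := (hd (a + t • v)).hasFDerivAt.comp_hasDerivAt t h1
      rwa [← inner_gradient_left] at this
    have h3 := ((h2.sub ((hasDerivAt_id t).mul_const (inner ℝ (gradient h a) v))).sub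
      (((hasDerivAt_pow 2 t).const_mul (L / 2)).mul_const (‖v‖ ^ 2)))
    refine h3.congr_deriv ?_
    push_cast
    ring
  have hanti : AntitoneOn φ (Set.Icc 0 1) := by
    refine antitoneOn_of_deriv_nonpos (convex_Icc 0 1)
      (fun t _ => (hφ t).continuousAt.continuousWithinAt)
      (fun t _ => (hφ t).differentiableAt.differentiableWithinAt) (fun t ht => ?_)
    rw [interior_Icc] at ht
    rw [(hφ t).deriv, ← inner_sub_left]
    have h1 := real_inner_le_norm (gradient h (a + t • v) - gradient h a) v
    have h2 := hL (a + t • v) a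
    rw [add_sub_cancel_left, norm_smul, Real.norm_of_nonneg ht.1.le] at h2
    nlinarith [mul_le_mul_of_nonneg_right h2 (norm_nonneg v)]
  have := hanti (Set.left_mem_Icc.2 zero_le_one) (Set.right_mem_Icc.2 zero_le_one) zero_le_one
  have h1 : a + v = b := by rw [hv]; abel
  simp only [φ, one_smul, zero_smul, h1, add_zero] at this
  linarith

theorem ge_of_lipschitz_gradient {h : E → ℝ} {L : ℝ} (hd : Differentiable ℝ h)
    (hL : ∀ a b, ‖gradient h a - gradient h b‖ ≤ L * ‖a - b‖) (a b : E) :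
    h a + inner ℝ (gradient h a) (b - a) - L / 2 * ‖b - a‖ ^ 2 ≤ h b := by
  have hg : ∀ x, gradient (fun x => - h x) x = - gradient h x := by
    intro x
    simp [gradient, fderiv_fun_neg]
  have := le_of_lipschitz_gradient (h := fun x => - h x) (L := L) hd.neg
    (fun a b => by rw [hg, hg, neg_sub_neg, norm_sub_rev]; exact hL a b) a b
  rw [hg, inner_neg_left] at this
  linarith

/-- A quadratic remainder is o(‖x' - x‖). This form is what two-sided bounds on a supremum can
supply, as in Danskin's theorem. -/
theorem hasGradientAt_of_abs_le {h : E → ℝ} {v x : E} {c : ℝ}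
    (hc : ∀ x', |h x' - h x - inner ℝ v (x' - x)| ≤ c * ‖x' - x‖ ^ 2) : HasGradientAt h v x := by
  rw [hasGradientAt_iff_isLittleO]
  refine Asymptotics.IsBigO.trans_isLittleO (g := fun x' => ‖x' - x‖ ^ 2) ?_ ?_
  · refine Asymptotics.IsBigO.of_bound c (Filter.Eventually.of_forall fun x' => ?_)
    simpa using hc x'
  · have : Filter.Tendsto (fun x' => x' - x) (nhds x) (nhds 0) := by
      rw [← sub_self x]
      exact (continuous_id.sub continuous_const).tendsto x
    exact (Asymptotics.isLittleO_norm_pow_id (one_lt_two)).comp_tendsto this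

end Gradient

variable {m n : ℕ} {f : Euc m → Euc n → ℝ} {l μ : ℝ}

/-! ### Smoothness of the objective in each variable. -/

section Smooth

theorem LipschitzSmooth.continuous (hs : LipschitzSmooth f l) :
    Continuous fun q : Euc m × Euc n => f q.1 q.2 := hs.differentiable.continuous

theorem LipschitzSmooth.differentiable_x (hs : LipschitzSmooth f l) (y : Euc n) :
    Differentiable ℝ fun x => f x y :=
  hs.differentiable.comp (differentiable_id.prodMk (differentiable_const y))

theorem LipschitzSmooth.differentiable_y (hs : LipschitzSmooth f l) (x : Euc m) :
    Differentiable ℝ fun y => f x y :=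
  hs.differentiable.comp ((differentiable_const x).prodMk differentiable_id)

theorem LipschitzSmooth.le_x (hs : LipschitzSmooth f l) (x x' : Euc m) (y : Euc n) :
    f x' y ≤ f x y + inner ℝ (gradX f x y) (x' - x) + l / 2 * ‖x' - x‖ ^ 2 :=
  le_of_lipschitz_gradient (hs.differentiable_x y)
    (fun a b => by simpa [gradX] using hs.lipschitz_x a y b y) x x'

theorem LipschitzSmooth.ge_x (hs : LipschitzSmooth f l) (x x' : Euc m) (y : Euc n) :
    f x y + inner ℝ (gradX f x y) (x' - x) - l / 2 * ‖x' - x‖ ^ 2 ≤ f x' y :=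
  ge_of_lipschitz_gradient (hs.differentiable_x y)
    (fun a b => by simpa [gradX] using hs.lipschitz_x a y b y) x x'

theorem LipschitzSmooth.le_y (hs : LipschitzSmooth f l) (x : Euc m) (y y' : Euc n) :
    f x y' ≤ f x y + inner ℝ (gradY f x y) (y' - y) + l / 2 * ‖y' - y‖ ^ 2 :=
  le_of_lipschitz_gradient (hs.differentiable_y x)
    (fun a b => by simpa [gradY] using hs.lipschitz_y x a x b) y y'

theorem LipschitzSmooth.ge_y (hs : LipschitzSmooth f l) (x : Euc m) (y y' : Euc n) :
    f x y + inner ℝ (gradY f x y) (y' - y) - l / 2 * ‖y' - y‖ ^ 2 ≤ f x y' :=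
  ge_of_lipschitz_gradient (hs.differentiable_y x)
    (fun a b => by simpa [gradY] using hs.lipschitz_y x a x b) y y'

theorem continuous_of_norm_sub_le {E : Type*} [NormedAddCommGroup E] {g : Euc m → Euc n → E}
    (hg : ∀ x₁ y₁ x₂ y₂, ‖g x₁ y₁ - g x₂ y₂‖ ≤ l * (‖x₁ - x₂‖ + ‖y₁ - y₂‖)) :
    Continuous fun q : Euc m × Euc n => g q.1 q.2 := by
  rw [continuous_iff_continuousAt]
  intro q
  refine tendsto_iff_norm_sub_tendsto_zero.2
    (squeeze_zero (fun _ => norm_nonneg _) (fun p => hg p.1 p.2 q.1 q.2) ?_)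
  have : Continuous fun p : Euc m × Euc n => l * (‖p.1 - q.1‖ + ‖p.2 - q.2‖) := by fun_prop
  simpa using this.tendsto q

theorem LipschitzSmooth.continuous_gradX (hs : LipschitzSmooth f l) :
    Continuous fun q : Euc m × Euc n => gradX f q.1 q.2 :=
  continuous_of_norm_sub_le hs.lipschitz_x

theorem LipschitzSmooth.continuous_gradY (hs : LipschitzSmooth f l) :
    Continuous fun q : Euc m × Euc n => gradY f q.1 q.2 :=
  continuous_of_norm_sub_le hs.lipschitz_y

end Smooth

/-! ### The strongly convex auxiliary problem and its dual function. -/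

section Auxiliary

/-- The gradient in `x` of the auxiliary objective `aux f l z`. -/
noncomputable def gradAux (f : Euc m → Euc n → ℝ) (l : ℝ) (z x : Euc m) (y : Euc n) : Euc m :=
  gradX f x y + (2 * l) • (x - z)

/-- The dual function `min_x aux f l z x y` of the auxiliary problem. -/
noncomputable def dual (f : Euc m → Euc n → ℝ) (l : ℝ) (z : Euc m) (y : Euc n) : ℝ := ⨅ x, aux f l z x y

/-- The Moreau envelope `min_x Φ x + l ‖x - z‖²` of the primal function. -/
noncomputable def moreau (f : Euc m → Euc n → ℝ) (l : ℝ) (z : Euc m) : ℝ := ⨅ x, primal f x + l * ‖x - z‖ ^ 2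

theorem norm_sub_sq_eq {E : Type*} [NormedAddCommGroup E] [InnerProductSpace ℝ E] (x x' z : E) :
    ‖x' - z‖ ^ 2 = ‖x - z‖ ^ 2 + 2 * inner ℝ (x - z) (x' - x) + ‖x' - x‖ ^ 2 := by
  rw [← norm_add_sq_real]; congr 2; abel

theorem aux_le (hs : LipschitzSmooth f l) (z x x' : Euc m) (y : Euc n) :
    aux f l z x' y ≤
      aux f l z x y + inner ℝ (gradAux f l z x y) (x' - x) + 3 * l / 2 * ‖x' - x‖ ^ 2 := by
  have h1 := hs.le_x x x' y
  have h2 := norm_sub_sq_eq x x' z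
  simp only [aux, gradAux, inner_add_left, real_inner_smul_left]
  rw [h2]; linarith

/-- The regularizer contributes curvature 2l, smoothness of f costs at most l; strong convexity with
modulus l remains. -/
theorem le_aux (hs : LipschitzSmooth f l) (z x x' : Euc m) (y : Euc n) :
    aux f l z x y + inner ℝ (gradAux f l z x y) (x' - x) + l / 2 * ‖x' - x‖ ^ 2 ≤
      aux f l z x' y := by
  have h1 := hs.ge_x x x' y
  have h2 := norm_sub_sq_eq x x' z
  simp only [aux, gradAux, inner_add_left, real_inner_smul_left]
  rw [h2]; linarith

theorem inner_add_mul_sq_ge {E : Type*} [NormedAddCommGroup E] [InnerProductSpace ℝ E] (hl : 0 < l)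
    (g v : E) : - (‖g‖ ^ 2 / (2 * l)) ≤ inner ℝ g v + l / 2 * ‖v‖ ^ 2 := by
  have h1 := neg_le_of_abs_le (abs_real_inner_le_norm g v)
  have h2 : 0 ≤ (‖g‖ - l * ‖v‖) ^ 2 / (2 * l) := by positivity
  have h3 : (‖g‖ - l * ‖v‖) ^ 2 / (2 * l) =
    ‖g‖ ^ 2 / (2 * l) - ‖g‖ * ‖v‖ + l / 2 * ‖v‖ ^ 2 := by field_simp; ring
  linarith

theorem aux_ge (hs : LipschitzSmooth f l) (hl : 0 < l) (z x x' : Euc m) (y : Euc n) :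
    aux f l z x y - ‖gradAux f l z x y‖ ^ 2 / (2 * l) ≤ aux f l z x' y := by
  have h1 := le_aux hs z x x' y
  have h2 := inner_add_mul_sq_ge hl (gradAux f l z x y) (x' - x)
  linarith

theorem bddBelow_aux (hs : LipschitzSmooth f l) (hl : 0 < l) (z : Euc m) (y : Euc n) :
    BddBelow (Set.range fun x => aux f l z x y) :=
  ⟨_, by rintro _ ⟨x, rfl⟩; exact aux_ge hs hl z 0 x y⟩

theorem dual_le (hs : LipschitzSmooth f l) (hl : 0 < l) (z x : Euc m) (y : Euc n) :
    dual f l z y ≤ aux f l z x y := ciInf_le (bddBelow_aux hs hl z y) x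

/-- The PL inequality in x: minimize the quadratic minorant of `le_aux` over x'. -/
theorem aux_sub_dual_le (hs : LipschitzSmooth f l) (hl : 0 < l) (z x : Euc m) (y : Euc n) :
    aux f l z x y - dual f l z y ≤ ‖gradAux f l z x y‖ ^ 2 / (2 * l) := by
  have : aux f l z x y - ‖gradAux f l z x y‖ ^ 2 / (2 * l) ≤ dual f l z y :=
    le_ciInf fun x' => aux_ge hs hl z x x' y
  linarith

/-- The quadratic term dominates the linear one, so h is coercive, and closed balls are compact. -/
theorem exists_isMin_of_quadratic_growth {E : Type*} [NormedAddCommGroup E] [InnerProductSpace ℝ E]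
    [ProperSpace E] {h : E → ℝ} (hc : Continuous h) {c : ℝ} (hpos : 0 < c) {a : ℝ} {v x₀ : E}
    (hq : ∀ x, a + inner ℝ v (x - x₀) + c * ‖x - x₀‖ ^ 2 ≤ h x) : ∃ p, ∀ x, h p ≤ h x := by
  refine hc.exists_forall_le ?_
  have h1 : Filter.Tendsto (fun x : E => ‖x - x₀‖) (Filter.cocompact E) Filter.atTop := by
    have := tendsto_norm_cocompact_atTop (E := E)
    refine Filter.tendsto_atTop_mono (f := fun x => ‖x‖ + (-‖x₀‖)) (fun x => ?_)
      (Filter.tendsto_atTop_add_const_right _ _ this)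
    have := norm_sub_norm_le x x₀
    linarith
  have h2 : Filter.Tendsto (fun t : ℝ => a + t * (c * t + (-‖v‖))) Filter.atTop Filter.atTop :=
    Filter.tendsto_atTop_add_const_left _ _ (Filter.tendsto_id.atTop_mul_atTop₀
      (Filter.tendsto_atTop_add_const_right _ _ (Filter.tendsto_id.const_mul_atTop hpos)))
  refine Filter.tendsto_atTop_mono (fun x => ?_) (h2.comp h1)
  have h3 := neg_le_of_abs_le (abs_real_inner_le_norm v (x - x₀))
  have := hq x
  simp only [Function.comp]
  nlinarith

theorem exists_gradAux_eq_zero (hs : LipschitzSmooth f l) (hl : 0 < l) (z : Euc m) (y : Euc n) :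
    ∃ x, gradAux f l z x y = 0 := by
  have hc : Continuous fun x => aux f l z x y := by
    have := (hs.differentiable_x y).continuous
    unfold aux
    fun_prop
  obtain ⟨p, hp⟩ := exists_isMin_of_quadratic_growth hc (half_pos hl)
    (fun x => le_aux hs z 0 x y)
  refine ⟨p, ?_⟩
  -- A gradient step of length 1/(3l) from the minimizer would lower the value by ‖gradient‖²/(6l),
  -- so the gradient vanishes.
  have h1 := aux_le hs z p (p - (1 / (3 * l)) • gradAux f l z p y) y
  have h2 := hp (p - (1 / (3 * l)) • gradAux f l z p y)
  rw [sub_sub_cancel_left, inner_neg_right, real_inner_smul_right, norm_neg, norm_smul,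
    real_inner_self_eq_norm_sq, Real.norm_of_nonneg (by positivity)] at h1
  have h3 : 3 * l / 2 * (1 / (3 * l) * ‖gradAux f l z p y‖) ^ 2
      = 1 / (3 * l) * ‖gradAux f l z p y‖ ^ 2 / 2 := by field_simp
  have h4 : 1 / (3 * l) * ‖gradAux f l z p y‖ ^ 2 ≤ 0 := by linarith
  have h5 : ‖gradAux f l z p y‖ ^ 2 ≤ 0 := nonpos_of_mul_nonpos_right h4 (by positivity)
  simpa using h5.antisymm (sq_nonneg _)

variable {z z' x xb xb' : Euc m} {y y' : Euc n}

theorem dual_add_le_aux (hs : LipschitzSmooth f l) (hl : 0 < l) (hb : gradAux f l z xb y = 0)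
    (x : Euc m) : dual f l z y + l / 2 * ‖x - xb‖ ^ 2 ≤ aux f l z x y := by
  have h1 := le_aux hs z xb x y
  have h2 := dual_le hs hl z xb y
  rw [hb, inner_zero_left] at h1
  linarith

theorem dual_eq (hs : LipschitzSmooth f l) (hl : 0 < l) (hb : gradAux f l z xb y = 0) :
    dual f l z y = aux f l z xb y := by
  have h2 := dual_le hs hl z xb y
  have h3 := aux_sub_dual_le hs hl z xb y
  rw [hb] at h3
  simp at h3
  linarith

theorem gradAux_strongly_monotone (hs : LipschitzSmooth f l) (z x x' : Euc m) (y : Euc n) :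
    l * ‖x - x'‖ ^ 2 ≤ inner ℝ (gradAux f l z x y - gradAux f l z x' y) (x - x') := by
  have h1 := le_aux hs z x x' y
  have h2 := le_aux hs z x' x y
  rw [← neg_sub x x', inner_neg_right, norm_neg] at h1
  rw [inner_sub_left]
  linarith

theorem mul_le_of_sq_le {a b c : ℝ} (ha : 0 ≤ a) (h : l * a ^ 2 ≤ b * a) (hb : 0 ≤ b)
    (hc : b ≤ c) : l * a ≤ c := by
  rcases ha.eq_or_lt with rfl | ha
  · simpa using hb.trans hc
  · have : l * a ≤ b := le_of_mul_le_mul_right (by linarith) ha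
    linarith

theorem mul_norm_sub_argmin_le (hs : LipschitzSmooth f l) (hb : gradAux f l z xb y = 0)
    (x : Euc m) : l * ‖x - xb‖ ≤ ‖gradAux f l z x y‖ := by
  have h1 := gradAux_strongly_monotone hs z x xb y
  rw [hb, sub_zero] at h1
  exact mul_le_of_sq_le (norm_nonneg _) (h1.trans (real_inner_le_norm _ _)) (norm_nonneg _) le_rfl

/-- Replacing (z', y') by (z, y) changes the vanishing gradient at `xb'` by at most l‖y' - y‖ +
2l‖z' - z‖; strong monotonicity divides this by l. -/
theorem norm_argmin_sub_argmin_le (hs : LipschitzSmooth f l) (hl : 0 < l)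
    (hb : gradAux f l z xb y = 0) (hb' : gradAux f l z' xb' y' = 0) :
    ‖xb' - xb‖ ≤ ‖y' - y‖ + 2 * ‖z' - z‖ := by
  have h1 := gradAux_strongly_monotone hs z xb' xb y
  have h2 : gradAux f l z xb' y - gradAux f l z xb y =
      (gradX f xb' y - gradX f xb' y') + (2 * l) • (z' - z) := by
    rw [hb, ← hb']
    simp only [gradAux, smul_sub]; abel
  rw [h2] at h1
  have h3 := hs.lipschitz_x xb' y xb' y'
  rw [sub_self, norm_zero, zero_add, norm_sub_rev y] at h3
  have h4 := norm_add_le (gradX f xb' y - gradX f xb' y') ((2 * l) • (z' - z))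
  rw [norm_smul, Real.norm_of_nonneg (by positivity)] at h4
  have h5 := mul_le_of_sq_le (norm_nonneg _) (h1.trans (real_inner_le_norm _ _)) (norm_nonneg _)
    (h4.trans (add_le_add_left h3 _))
  refine le_of_mul_le_mul_left ?_ hl
  linarith

/-- The dual function is `2 l`-smooth from below. -/
theorem dual_ge (hs : LipschitzSmooth f l) (hl : 0 < l) (hb : gradAux f l z xb y = 0)
    (y' : Euc n) :
    dual f l z y + inner ℝ (gradY f xb y) (y' - y) - l * ‖y' - y‖ ^ 2 ≤ dual f l z y' := by
  refine le_ciInf fun x => ?_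
  -- `xb` is nearly optimal for `y'` too: its gradient there is at most l‖y' - y‖, which costs l/2
  -- ‖y' - y‖². Smoothness of f in y costs the other l/2.
  have h1 := aux_ge hs hl z xb x y'
  have h2 : ‖gradAux f l z xb y'‖ ≤ l * ‖y' - y‖ := by
    have : gradAux f l z xb y' = gradX f xb y' - gradX f xb y := by
      rw [← sub_zero (gradAux f l z xb y'), ← hb, gradAux, gradAux]; abel
    rw [this]
    simpa using hs.lipschitz_x xb y' xb y
  have h3 : ‖gradAux f l z xb y'‖ ^ 2 / (2 * l) ≤ l / 2 * ‖y' - y‖ ^ 2 := by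
    rw [div_le_iff₀ (by positivity)]
    have := pow_le_pow_left₀ (norm_nonneg _) h2 2
    linarith
  have h4 := hs.ge_y xb y y'
  have h5 := dual_eq hs hl hb
  simp only [aux] at h1 h5 ⊢
  linarith

end Auxiliary

/-! ### Consequences of the PL inequality: error bound, Danskin's theorem, smoothness of Φ. -/

section PL

theorem PLInY.le_primal (hp : PLInY f μ) (x : Euc m) (y : Euc n) : f x y ≤ primal f x := by
  obtain ⟨y', hy'⟩ := hp.exists_max x
  exact le_ciSup (f := fun y => f x y) ⟨f x y', by rintro _ ⟨y, rfl⟩; exact hy' y⟩ y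

theorem PLInY.exists_eq (hp : PLInY f μ) (x : Euc m) : ∃ y, f x y = primal f x := by
  obtain ⟨y', hy'⟩ := hp.exists_max x
  exact ⟨y', (hp.le_primal x y').antisymm (ciSup_le hy')⟩

/-- The error bound implied by the PL inequality: the limit of gradient ascent is a maximizer. -/
theorem PLInY.exists_maximizer_near (hs : LipschitzSmooth f l) (hp : PLInY f μ) (hl : 0 < l)
    (hμ : 0 < μ) (x : Euc m) (y : Euc n) :
    ∃ y', f x y' = primal f x ∧ ‖y' - y‖ ≤ 2 / μ * ‖gradY f x y‖ := by
  let u : ℕ → Euc n := fun k => (fun v => v + (1 / l) • gradY f x v)^[k] y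
  have hu : ∀ k, u (k + 1) = u k + (1 / l) • gradY f x (u k) := fun k =>
    Function.iterate_succ_apply' _ _ _
  let g : ℕ → ℝ := fun k => primal f x - f x (u k)
  have hg0 : ∀ k, 0 ≤ g k := fun k => sub_nonneg.2 (hp.le_primal x _)
  have hstep : ∀ k, g (k + 1) + ‖gradY f x (u k)‖ ^ 2 / (2 * l) ≤ g k := by
    intro k
    have h1 := hs.ge_y x (u k) (u (k + 1))
    rw [hu k, add_sub_cancel_left, real_inner_smul_right, norm_smul, real_inner_self_eq_norm_sq,
      Real.norm_of_nonneg (by positivity), ← hu k] at h1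
    have h2 : 1 / l * ‖gradY f x (u k)‖ ^ 2 - l / 2 * (1 / l * ‖gradY f x (u k)‖) ^ 2
      = ‖gradY f x (u k)‖ ^ 2 / (2 * l) := by field_simp; ring
    simp only [g]
    linarith
  have hsq : ∀ k, √(2 * μ) * √(g k) ≤ ‖gradY f x (u k)‖ := by
    intro k
    rw [← Real.sqrt_mul (by positivity)]
    exact Real.sqrt_le_iff.2 ⟨norm_nonneg _, hp.pl x (u k)⟩
  have hr : 0 < √(2 * μ) := by positivity
  have hr2 : √(2 * μ) ^ 2 = 2 * μ := Real.sq_sqrt (by positivity)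
  set r := √(2 * μ) with hrdef
  -- With a, b the square roots of successive gaps and N the gradient norm, N²/(2l) ≤ a² - b² ≤ 2a(a
  -- - b), and PL gives ra ≤ N. Hence the step length N/l is at most 4(a - b)/r, which telescopes;
  -- the total is at most 4N₀/r² = (2/μ)N₀, with N₀ the gradient norm at the starting point.
  have hdist : ∀ k, dist (u k) (u k.succ) ≤ 4 / r * (√(g k) - √(g (k + 1))) := by
    intro k
    have hN : dist (u k) (u k.succ) = ‖gradY f x (u k)‖ / l := by
      rw [dist_comm, dist_eq_norm, Nat.succ_eq_add_one, hu k, add_sub_cancel_left, norm_smul,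
        Real.norm_of_nonneg (by positivity)]
      ring
    rw [hN]
    have h1 := hstep k
    have h2 := hsq k
    have h3 : √(g (k + 1)) ≤ √(g k) :=
      Real.sqrt_le_sqrt (by have : 0 ≤ ‖gradY f x (u k)‖ ^ 2 / (2 * l) := by positivity
                            linarith)
    have h4 := Real.sq_sqrt (hg0 k)
    have h5 := Real.sq_sqrt (hg0 (k + 1))
    have ha := Real.sqrt_nonneg (g k)
    have hb := Real.sqrt_nonneg (g (k + 1))
    set a := √(g k)
    set b := √(g (k + 1))
    set N := ‖gradY f x (u k)‖
    have hN0 : 0 ≤ N := norm_nonneg _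
    have h6 : N ^ 2 / (2 * l) ≤ (a - b) * (2 * a) := by nlinarith
    have h7 : N ^ 2 ≤ (4 * l / r * (a - b)) * N := by
      rw [div_le_iff₀ (by positivity)] at h6
      have h8 : (a - b) * (2 * a) * (2 * l) = (4 * l / r * (a - b)) * (r * a) := by
        field_simp; ring
      rw [h8] at h6
      refine h6.trans (mul_le_mul_of_nonneg_left h2 ?_)
      have := sub_nonneg.2 h3
      positivity
    have h9 : N ≤ 4 * l / r * (a - b) := by
      rcases hN0.eq_or_lt with h | h
      · rw [← h]
        have := sub_nonneg.2 h3
        positivity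
      · exact le_of_mul_le_mul_right (by linarith) h
    rw [div_le_iff₀ hl]
    calc N ≤ _ := h9
      _ = _ := by ring
  have hsum : ∀ K, ∑ k ∈ Finset.range K, 4 / r * (√(g k) - √(g (k + 1))) ≤
      2 / μ * ‖gradY f x y‖ := by
    intro K
    rw [← Finset.mul_sum, Finset.sum_range_sub']
    have h1 := hsq 0
    have h2 := Real.sqrt_nonneg (g K)
    have h3 : 4 / r * (√(g 0) - √(g K)) ≤ 4 / r * (‖gradY f x y‖ / r) := by
      refine mul_le_mul_of_nonneg_left ?_ (by positivity)
      have : √(g 0) ≤ ‖gradY f x y‖ / r := by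
        rw [le_div_iff₀ hr]; linarith [show u 0 = y from rfl, show
          ‖gradY f x (u 0)‖ = ‖gradY f x y‖ from rfl]
      linarith
    refine h3.trans (le_of_eq ?_)
    rw [div_mul_div_comm, ← pow_two, hr2]
    field_simp; ring
  have hnn : ∀ k, 0 ≤ 4 / r * (√(g k) - √(g (k + 1))) := fun k => dist_nonneg.trans (hdist k)
  have hS : Summable fun k => 4 / r * (√(g k) - √(g (k + 1))) :=
    summable_of_sum_range_le hnn hsum
  have hcau : CauchySeq u :=
    cauchySeq_of_summable_dist (Summable.of_nonneg_of_le (fun _ => dist_nonneg) hdist hS)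
  obtain ⟨y', hy'⟩ := cauchySeq_tendsto_of_complete hcau
  refine ⟨y', ?_, ?_⟩
  -- Successive differences tend to 0, so the limit is stationary, and PL makes every stationary
  -- point a global maximizer.
  · have hc : Continuous fun v => gradY f x v :=
      hs.continuous_gradY.comp (Continuous.prodMk_right x)
    have h1 : Filter.Tendsto (fun k => u (k + 1) - u k) Filter.atTop (nhds 0) := by
      simpa using (hy'.comp (Filter.tendsto_add_atTop_nat 1)).sub hy'
    have h2 : Filter.Tendsto (fun k => u (k + 1) - u k) Filter.atTop
        (nhds ((1 / l) • gradY f x y')) := by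
      have := ((hc.tendsto y').comp hy').const_smul (1 / l)
      refine this.congr fun k => ?_
      rw [hu k, add_sub_cancel_left, Function.comp]
    have h3 := tendsto_nhds_unique h2 h1
    rw [smul_eq_zero] at h3
    have h4 : gradY f x y' = 0 := h3.resolve_left (by positivity)
    have h5 := hp.pl x y'
    rw [h4, norm_zero] at h5
    have h6 := hp.le_primal x y'
    nlinarith
  · have h1 := dist_le_tsum_of_dist_le_of_tendsto₀ _ hdist hS hy'
    rw [dist_comm, dist_eq_norm] at h1
    exact h1.trans (hS.tsum_le_of_sum_range_le hsum)

theorem gradY_eq_zero (hs : LipschitzSmooth f l) (hp : PLInY f μ) (hl : 0 < l)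
    {x : Euc m} {y : Euc n} (hy : f x y = primal f x) : gradY f x y = 0 := by
  have h1 := hs.ge_y x y (y + (1 / l) • gradY f x y)
  have h2 := hp.le_primal x (y + (1 / l) • gradY f x y)
  rw [add_sub_cancel_left, real_inner_smul_right, norm_smul, real_inner_self_eq_norm_sq,
    Real.norm_of_nonneg (by positivity)] at h1
  have h3 : 1 / l * ‖gradY f x y‖ ^ 2 - l / 2 * (1 / l * ‖gradY f x y‖) ^ 2
    = 1 / (2 * l) * ‖gradY f x y‖ ^ 2 := by field_simp; ring
  have h4 : 1 / (2 * l) * ‖gradY f x y‖ ^ 2 ≤ 0 := by linarith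
  have h5 : ‖gradY f x y‖ ^ 2 ≤ 0 := nonpos_of_mul_nonpos_right h4 (by positivity)
  simpa using h5.antisymm (sq_nonneg _)

/-- Danskin's theorem for the primal function. -/
theorem hasGradientAt_primal (hs : LipschitzSmooth f l) (hp : PLInY f μ) (hl : 0 < l)
    (hμ : 0 < μ) {x : Euc m} {y : Euc n} (hy : f x y = primal f x) :
    HasGradientAt (primal f) (gradX f x y) x := by
  refine hasGradientAt_of_abs_le (c := l * (2 / μ * l) + l / 2) fun x' => ?_
  have hzero := gradY_eq_zero hs hp hl hy
  -- Freezing y bounds Φ(x') from below. The bound from above uses a maximizer for x' within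
  -- (2l/μ)‖x' - x‖ of y, which exists because ∇_y f(x, y) = 0.
  obtain ⟨y', hy', hd⟩ := hp.exists_maximizer_near hs hl hμ x' y
  have h1 := hs.lipschitz_y x' y x y
  rw [hzero, sub_zero, sub_self, norm_zero, add_zero] at h1
  have h2 : ‖y' - y‖ ≤ 2 / μ * l * ‖x' - x‖ := by
    rw [mul_assoc]
    exact hd.trans (mul_le_mul_of_nonneg_left h1 (by positivity))
  have h3 := hs.lipschitz_x x y' x y
  rw [sub_self, norm_zero, zero_add] at h3
  have h4 := hs.le_x x x' y'
  have h5 := hs.ge_x x x' y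
  have h6 := hp.le_primal x y'
  have h7 := hp.le_primal x' y
  have h8 : inner ℝ (gradX f x y' - gradX f x y) (x' - x) ≤ l * (2 / μ * l) * ‖x' - x‖ ^ 2 := by
    refine (real_inner_le_norm _ _).trans ?_
    have := h3.trans (mul_le_mul_of_nonneg_left h2 hl.le)
    calc _ ≤ _ := mul_le_mul_of_nonneg_right this (norm_nonneg _)
      _ = _ := by ring
  rw [inner_sub_left] at h8
  have h9 : 0 ≤ l * (2 / μ * l) * ‖x' - x‖ ^ 2 := by positivity
  rw [abs_le]
  constructor <;> linarith

theorem gradient_primal (hs : LipschitzSmooth f l) (hp : PLInY f μ) (hl : 0 < l)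
    (hμ : 0 < μ) {x : Euc m} {y : Euc n} (hy : f x y = primal f x) :
    gradient (primal f) x = gradX f x y := (hasGradientAt_primal hs hp hl hμ hy).gradient

theorem differentiable_primal (hs : LipschitzSmooth f l) (hp : PLInY f μ) (hl : 0 < l)
    (hμ : 0 < μ) : Differentiable ℝ (primal f) := fun x => by
  obtain ⟨y, hy⟩ := hp.exists_eq x
  exact (hasGradientAt_primal hs hp hl hμ hy).differentiableAt

/-- By the error bound, a maximizer can be followed at speed at most 2κ relative to x; Danskin then
turns this into a Lipschitz bound for ∇Φ. -/
theorem norm_gradient_primal_sub_le (hs : LipschitzSmooth f l) (hp : PLInY f μ) (hl : 0 < l)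
    (hμ : 0 < μ) (x x' : Euc m) :
    ‖gradient (primal f) x' - gradient (primal f) x‖ ≤ l * (1 + 2 * (l / μ)) * ‖x' - x‖ := by
  obtain ⟨y, hy⟩ := hp.exists_eq x
  obtain ⟨y', hy', hd⟩ := hp.exists_maximizer_near hs hl hμ x' y
  have h1 := hs.lipschitz_y x' y x y
  rw [gradY_eq_zero hs hp hl hy, sub_zero, sub_self, norm_zero, add_zero] at h1
  have h2 : ‖y' - y‖ ≤ 2 / μ * (l * ‖x' - x‖) :=
    hd.trans (mul_le_mul_of_nonneg_left h1 (by positivity))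
  rw [gradient_primal hs hp hl hμ hy, gradient_primal hs hp hl hμ hy']
  refine (hs.lipschitz_x x' y' x y).trans ?_
  calc _ ≤ l * (‖x' - x‖ + 2 / μ * (l * ‖x' - x‖)) := by gcongr
    _ = _ := by ring

end PL

/-! ### Moreau envelope, proximal points and the duality gap. -/

section Envelope

variable {z x xb : Euc m} {y : Euc n}

theorem hasGradientAt_mul_norm_sub_sq {E : Type*} [NormedAddCommGroup E] [InnerProductSpace ℝ E]
    [CompleteSpace E] (l : ℝ) (z p : E) :
    HasGradientAt (fun x => l * ‖x - z‖ ^ 2) ((2 * l) • (p - z)) p := by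
  refine hasGradientAt_of_abs_le (c := |l|) fun x => le_of_eq ?_
  rw [norm_sub_sq_eq p x z, real_inner_smul_left, ← abs_of_nonneg (sq_nonneg ‖x - p‖), ← abs_mul,
    abs_of_nonneg (sq_nonneg ‖x - p‖)]
  congr 1
  ring

/-- The proximal point of the primal function. -/
theorem exists_prox (hs : LipschitzSmooth f l) (hp : PLInY f μ) (hl : 0 < l) (hμ : 0 < μ)
    (z : Euc m) : ∃ p, moreau f l z = primal f p + l * ‖p - z‖ ^ 2 ∧
      gradient (primal f) p = (2 * l) • (z - p) ∧
      ∀ x, moreau f l z + l / 2 * ‖x - p‖ ^ 2 ≤ primal f x + l * ‖x - z‖ ^ 2 := by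
  -- f(·, y) minorizes Φ and touches it at p, so the strong convexity inequality of `aux` passes to
  -- Φ + l‖· - z‖².
  have hlow : ∀ (p : Euc m) (y : Euc n), f p y = primal f p → ∀ x,
      primal f p + l * ‖p - z‖ ^ 2 + inner ℝ (gradAux f l z p y) (x - p) + l / 2 * ‖x - p‖ ^ 2 ≤
        primal f x + l * ‖x - z‖ ^ 2 := by
    intro p y hy x
    have h1 := le_aux hs z p x y
    have h2 := hp.le_primal x y
    simp only [aux] at h1
    linarith
  have hd := differentiable_primal hs hp hl hμ
  have hc : Continuous fun x => primal f x + l * ‖x - z‖ ^ 2 := by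
    have := hd.continuous
    fun_prop
  obtain ⟨y₀, hy₀⟩ := hp.exists_eq z
  obtain ⟨p, hpmin⟩ := exists_isMin_of_quadratic_growth hc (half_pos hl) (hlow z y₀ hy₀)
  obtain ⟨y, hy⟩ := hp.exists_eq p
  have hgrad : gradAux f l z p y = 0 := by
    have h1 := (hasGradientAt_primal hs hp hl hμ hy).hasFDerivAt.add
      (hasGradientAt_mul_norm_sub_sq l z p).hasFDerivAt
    have h2 := IsLocalMin.hasFDerivAt_eq_zero
      (Filter.Eventually.of_forall hpmin : IsLocalMin _ p) h1
    rw [← map_add] at h2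
    exact (LinearIsometryEquiv.map_eq_zero_iff _).1 h2
  have hmor : moreau f l z = primal f p + l * ‖p - z‖ ^ 2 :=
    (ciInf_le ⟨_, by rintro _ ⟨x, rfl⟩; exact hpmin x⟩ p).antisymm (le_ciInf hpmin)
  refine ⟨p, hmor, ?_, fun x => ?_⟩
  · rw [gradient_primal hs hp hl hμ hy, ← sub_eq_zero, ← hgrad, gradAux, ← neg_sub z p, smul_neg]
    abel
  · have := hlow p y hy x
    rw [hgrad, inner_zero_left] at this
    rw [hmor]
    linarith

theorem moreau_le (hs : LipschitzSmooth f l) (hp : PLInY f μ) (hl : 0 < l) (hμ : 0 < μ)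
    (z x : Euc m) : moreau f l z ≤ primal f x + l * ‖x - z‖ ^ 2 := by
  obtain ⟨p, -, -, h⟩ := exists_prox hs hp hl hμ z
  have : 0 ≤ l / 2 * ‖x - p‖ ^ 2 := by positivity
  linarith [h x]

theorem dual_le_moreau (hs : LipschitzSmooth f l) (hp : PLInY f μ) (hl : 0 < l)
    (z : Euc m) (y : Euc n) : dual f l z y ≤ moreau f l z :=
  le_ciInf fun x => (dual_le hs hl z x y).trans (by
    simp only [aux]
    linarith [hp.le_primal x y])

/-- PL for the auxiliary dual problem. Testing the envelope at `xb` cancels the regularizer, leaving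
the gap of f(xb, ·) at y. -/
theorem moreau_sub_dual_le (hs : LipschitzSmooth f l) (hp : PLInY f μ) (hl : 0 < l) (hμ : 0 < μ)
    (hb : gradAux f l z xb y = 0) :
    2 * μ * (moreau f l z - dual f l z y) ≤ ‖gradY f xb y‖ ^ 2 := by
  refine le_trans (mul_le_mul_of_nonneg_left ?_ (by positivity)) (hp.pl xb y)
  have h1 := moreau_le hs hp hl hμ z xb
  rw [dual_eq hs hl hb, aux]
  linarith

/-- Strong convexity of the auxiliary objective around its minimizer `xb`, tested at p, where its
value is at most the envelope. -/
theorem norm_argmin_sub_prox_sq_le (hs : LipschitzSmooth f l) (hp : PLInY f μ) (hl : 0 < l)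
    (hb : gradAux f l z xb y = 0) {p : Euc m}
    (hprox : moreau f l z = primal f p + l * ‖p - z‖ ^ 2) :
    l / 2 * ‖xb - p‖ ^ 2 ≤ moreau f l z - dual f l z y := by
  have h1 := dual_add_le_aux hs hl hb p
  have h2 := hp.le_primal p y
  rw [norm_sub_rev]
  simp only [aux] at h1
  linarith

end Envelope

/-! ### One-step inequalities for the two potentials. -/

section Potential

variable {m n : ℕ} {f : Euc m → Euc n → ℝ} {l μ : ℝ}

/-- The Lyapunov function of Smoothed-AGDA. -/
noncomputable def lyapunov (f : Euc m → Euc n → ℝ) (l : ℝ) (x : Euc m) (y : Euc n) (z : Euc m) :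
    ℝ := aux f l z x y - 2 * dual f l z y + 2 * moreau f l z

/-- The stationarity measure decreased by Smoothed-AGDA. -/
noncomputable def stationarity (f : Euc m → Euc n → ℝ) (l μ : ℝ) (x : Euc m) (y : Euc n) : ℝ :=
  μ / l * ‖gradX f x y‖ ^ 2 + ‖gradY f x y‖ ^ 2

/-- The gradient error `e` is kept as a linear plus a quadratic term so that its linear part can
average out later. -/
theorem aux_descent (hs : LipschitzSmooth f l) (z x : Euc m) (y : Euc n) (τ : ℝ) (e : Euc m) :
    aux f l z (x - τ • (gradAux f l z x y + e)) y ≤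
      aux f l z x y - τ * (1 - 3 * l * τ / 2) * ‖gradAux f l z x y‖ ^ 2
        - τ * (1 - 3 * l * τ) * inner ℝ (gradAux f l z x y) e + 3 * l / 2 * τ ^ 2 * ‖e‖ ^ 2 := by
  have h := aux_le hs z x (x - τ • (gradAux f l z x y + e)) y
  rw [sub_sub_cancel_left, inner_neg_right, real_inner_smul_right, norm_neg, norm_smul, mul_pow,
    norm_add_sq_real, inner_add_right, real_inner_self_eq_norm_sq, Real.norm_eq_abs, sq_abs] at h
  linarith

theorem aux_ascent (hs : LipschitzSmooth f l) (z x : Euc m) (y : Euc n) (τ : ℝ) (v : Euc n) :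
    aux f l z x (y + τ • v) ≤
      aux f l z x y + τ * inner ℝ (gradY f x y) v + l / 2 * τ ^ 2 * ‖v‖ ^ 2 := by
  have h := hs.le_y x y (y + τ • v)
  rw [add_sub_cancel_left, real_inner_smul_right, norm_smul, mul_pow, Real.norm_eq_abs,
    sq_abs] at h
  simp only [aux]
  linarith

theorem dual_ascent (hs : LipschitzSmooth f l) (hl : 0 < l) {z xb : Euc m} {y : Euc n}
    (hb : gradAux f l z xb y = 0) (τ : ℝ) (v : Euc n) :
    dual f l z y + τ * inner ℝ (gradY f xb y) v - l * τ ^ 2 * ‖v‖ ^ 2 ≤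
      dual f l z (y + τ • v) := by
  have h := dual_ge hs hl hb (y + τ • v)
  rw [add_sub_cancel_left, real_inner_smul_right, norm_smul, mul_pow, Real.norm_eq_abs,
    sq_abs] at h
  linarith

/-- Young's inequality for the cross term created by moving the centre: W = ‖x - z‖, N is the length
of the ascent direction, r the distance from `xb` to the proximal point. The products cost 13lβ²W² +
(l/2)βW² and 8lβr². The 1600 in β makes the last at most (τ/200)H². -/
theorem drift_le {β τ W N r H : ℝ} (hl : 0 < l) (hβ : β = τ * μ / 1600) (hβ0 : 0 ≤ β)
    (hβ1 : 13 * β ≤ 1 / 2) (hτ : 0 ≤ τ) (hr : l * μ * r ^ 2 ≤ H ^ 2) :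
    4 * l * β * W * (τ * N + 2 * β * W + r) - l * (2 * β - β ^ 2) * W ^ 2 ≤
      l * τ ^ 2 * N ^ 2 + τ / 200 * H ^ 2 - l * β * W ^ 2 := by
  have h1 : 0 ≤ l * (2 * β * W - τ * N) ^ 2 := by positivity
  have h2 : 0 ≤ l * β / 2 * (W - 4 * r) ^ 2 := by positivity
  have h3 : 8 * l * β * r ^ 2 ≤ τ / 200 * H ^ 2 := by
    rw [hβ]
    nlinarith
  have h4 : 0 ≤ l * β * W ^ 2 * (1 / 2 - 13 * β) :=
    mul_nonneg (by positivity) (by linarith)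
  nlinarith

/-- The effect of the dual and of the smoothing step on the Lyapunov function. -/
theorem lyapunov_dual_smoothing_step (hs : LipschitzSmooth f l) (hp : PLInY f μ) (hμ : 0 < μ)
    (hμl : μ ≤ l) {z xb : Euc m} {y : Euc n} (hb : gradAux f l z xb y = 0) {τ β : ℝ}
    (hτ : 0 ≤ τ) (hτl : l * τ ≤ 1 / 144) (hβ : β = τ * μ / 1600) (x : Euc m) (v : Euc n) :
    lyapunov f l x (y + τ • v) (z + β • (x - z)) ≤
      aux f l z x y - 2 * dual f l z y + 2 * moreau f l z
        + τ * (inner ℝ (gradY f x y) v - 2 * inner ℝ (gradY f xb y) v)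
        + 7 / 2 * l * τ ^ 2 * ‖v‖ ^ 2 + τ / 200 * ‖gradY f xb y‖ ^ 2 - l * β * ‖x - z‖ ^ 2 := by
  have hl : 0 < l := hμ.trans_le hμl
  have hβ0 : 0 ≤ β := by rw [hβ]; positivity
  have hβ1 : 13 * β ≤ 1 / 2 := by
    have : τ * μ ≤ l * τ := by nlinarith
    rw [hβ]; linarith
  -- `xc` is the minimizer after both updates, `p` the proximal point of the old centre. Evaluating
  -- the new dual at `xc` and testing the new envelope at `p` cancels their β² terms and leaves
  -- 4lβ⟨xc - p, x - z⟩.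
  obtain ⟨xc, hc⟩ := exists_gradAux_eq_zero hs hl (z + β • (x - z)) (y + τ • v)
  obtain ⟨p, hp1, -, -⟩ := exists_prox hs hp hl hμ z
  have h1 := aux_ascent hs z x y τ v
  have h2 := dual_ascent hs hl hb τ v
  have h3 := moreau_le hs hp hl hμ (z + β • (x - z)) p
  have h4 := dual_eq hs hl hc
  have h5 := dual_le hs hl z xc (y + τ • v)
  have h6 := norm_argmin_sub_argmin_le hs hl hb hc
  have h7 := norm_argmin_sub_prox_sq_le hs hp hl hb hp1
  have h8 := moreau_sub_dual_le hs hp hl hμ hb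
  have hr : l * μ * ‖xb - p‖ ^ 2 ≤ ‖gradY f xb y‖ ^ 2 := by nlinarith
  rw [add_sub_cancel_left, add_sub_cancel_left, norm_smul, norm_smul, Real.norm_of_nonneg hτ,
    Real.norm_of_nonneg hβ0] at h6
  have hd := drift_le (N := ‖v‖) (W := ‖x - z‖) hl hβ hβ0 hβ1 hτ hr
  have h9 : ‖xc - p‖ ≤ τ * ‖v‖ + 2 * β * ‖x - z‖ + ‖xb - p‖ := by
    have := norm_sub_le_norm_sub_add_norm_sub xc xb p
    linarith
  have hz : ∀ q : Euc m, ‖q - (z + β • (x - z))‖ ^ 2 =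
      ‖q - z‖ ^ 2 - 2 * β * inner ℝ (q - z) (x - z) + β ^ 2 * ‖x - z‖ ^ 2 := by
    intro q
    rw [← sub_sub, norm_sub_sq_real, real_inner_smul_right, norm_smul, mul_pow, Real.norm_eq_abs,
      sq_abs]
    ring
  have h10 : inner ℝ (xc - z) (x - z) - inner ℝ (p - z) (x - z) ≤ ‖xc - p‖ * ‖x - z‖ := by
    rw [← inner_sub_left, sub_sub_sub_cancel_right]
    exact real_inner_le_norm _ _
  have h11 : 4 * l * β * (inner ℝ (xc - z) (x - z) - inner ℝ (p - z) (x - z)) ≤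
      4 * l * β * ‖x - z‖ * (τ * ‖v‖ + 2 * β * ‖x - z‖ + ‖xb - p‖) := by
    rw [mul_assoc (4 * l * β)]
    refine mul_le_mul_of_nonneg_left (h10.trans ?_) (by positivity)
    rw [mul_comm]
    exact mul_le_mul_of_nonneg_left h9 (norm_nonneg _)
  have h12 := hz p
  have h13 := hz xc
  have h14 := hz x
  rw [real_inner_self_eq_norm_sq] at h14
  rw [h12] at h3
  simp only [lyapunov, aux] at *
  rw [h4, h14]
  rw [h13]
  linarith

theorem norm_gradY_sub_le (hs : LipschitzSmooth f l) (x xb : Euc m) (y : Euc n) :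
    ‖gradY f x y - gradY f xb y‖ ≤ l * ‖x - xb‖ := by
  simpa using hs.lipschitz_y x y xb y

theorem norm_gradY_sub_sq_le (hs : LipschitzSmooth f l) (x xb : Euc m) (y : Euc n) :
    ‖gradY f x y‖ ^ 2 - 2 * inner ℝ (gradY f x y) (gradY f xb y) + ‖gradY f xb y‖ ^ 2 ≤
      l ^ 2 * ‖x - xb‖ ^ 2 := by
  rw [← norm_sub_sq_real, ← mul_pow]
  exact pow_le_pow_left₀ (norm_nonneg _) (norm_gradY_sub_le hs x xb y) 2

/-- The conditional expectation, given the primal step, of the bound in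
`lyapunov_dual_smoothing_step`. -/
theorem dual_step_scalar_le (hs : LipschitzSmooth f l) (xb : Euc m) {y : Euc n} {τ : ℝ}
    (hτ : 0 ≤ τ) (hτl : l * τ ≤ 1 / 144) (x : Euc m) :
    τ * (‖gradY f x y‖ ^ 2 - 2 * inner ℝ (gradY f xb y) (gradY f x y))
      + 7 / 2 * l * τ ^ 2 * ‖gradY f x y‖ ^ 2 + τ / 200 * ‖gradY f xb y‖ ^ 2 ≤
      2 * τ * l ^ 2 * ‖x - xb‖ ^ 2 - τ / 2 * ‖gradY f xb y‖ ^ 2 := by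
  have h1 := norm_gradY_sub_sq_le hs x xb y
  -- Combined with twice `h1`, this square gives G ≤ 2D + 2H (`h3`).
  have h2 : 0 ≤ ‖gradY f x y - (2 : ℝ) • gradY f xb y‖ ^ 2 := sq_nonneg _
  rw [norm_sub_sq_real, norm_smul, real_inner_smul_right, mul_pow] at h2
  norm_num at h2
  rw [real_inner_comm]
  set G := ‖gradY f x y‖ ^ 2
  set H := ‖gradY f xb y‖ ^ 2
  set I := inner ℝ (gradY f x y) (gradY f xb y)
  set D := l ^ 2 * ‖x - xb‖ ^ 2
  have hG : 0 ≤ G := sq_nonneg _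
  have hH : 0 ≤ H := sq_nonneg _
  have hD : 0 ≤ D := by positivity
  have h3 : G ≤ 2 * D + 2 * H := by linarith
  have h4 : 7 / 2 * (l * τ) * G ≤ 7 / 2 * (1 / 144) * G := by gcongr
  have h5 : G - 2 * I + 7 / 2 * (l * τ) * G + 1 / 200 * H ≤ 2 * D - 1 / 2 * H := by linarith
  have := mul_le_mul_of_nonneg_left h5 hτ
  nlinarith

/-- Expresses `stationarity` through the three quantities that a step of Smoothed-AGDA decreases.
Here μ ≤ l absorbs the weight μ/l on the primal gradient. -/
theorem mul_stationarity_le (hs : LipschitzSmooth f l) (hμ : 0 < μ) (hμl : μ ≤ l)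
    {z xb : Euc m} {y : Euc n} (hb : gradAux f l z xb y = 0) (x : Euc m) :
    stationarity f l μ x y ≤ 4 * ‖gradAux f l z x y‖ ^ 2 + 2 * ‖gradY f xb y‖ ^ 2
      + 8 * (l * μ) * ‖x - z‖ ^ 2 := by
  have hl : 0 < l := hμ.trans_le hμl
  have h1 : ‖gradX f x y‖ ^ 2 ≤ 2 * ‖gradAux f l z x y‖ ^ 2 + 8 * l ^ 2 * ‖x - z‖ ^ 2 := by
    have : gradX f x y = gradAux f l z x y - (2 * l) • (x - z) := by simp [gradAux]
    have h := norm_sub_le (gradAux f l z x y) ((2 * l) • (x - z))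
    rw [← this, norm_smul, Real.norm_of_nonneg (by positivity)] at h
    have := pow_le_pow_left₀ (norm_nonneg _) h 2
    nlinarith [sq_nonneg (‖gradAux f l z x y‖ - 2 * l * ‖x - z‖)]
  have h2 : ‖gradY f x y‖ ^ 2 ≤ 2 * ‖gradY f xb y‖ ^ 2 + 2 * ‖gradAux f l z x y‖ ^ 2 := by
    have h3 := (norm_gradY_sub_le hs x xb y).trans (mul_norm_sub_argmin_le hs hb x)
    have h4 := norm_le_norm_add_norm_sub' (gradY f x y) (gradY f xb y)
    have := pow_le_pow_left₀ (norm_nonneg _) (h4.trans (add_le_add_right h3 _)) 2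
    nlinarith [sq_nonneg (‖gradY f xb y‖ - ‖gradAux f l z x y‖)]
  have h5 : μ / l * ‖gradX f x y‖ ^ 2 ≤ 2 * ‖gradAux f l z x y‖ ^ 2
      + 8 * (l * μ) * ‖x - z‖ ^ 2 := by
    have hk : μ / l ≤ 1 := (div_le_one hl).2 hμl
    calc μ / l * ‖gradX f x y‖ ^ 2
        ≤ μ / l * (2 * ‖gradAux f l z x y‖ ^ 2 + 8 * l ^ 2 * ‖x - z‖ ^ 2) := by gcongr
      _ = μ / l * (2 * ‖gradAux f l z x y‖ ^ 2) + 8 * (l * μ) * ‖x - z‖ ^ 2 := by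
        field_simp
      _ ≤ 1 * (2 * ‖gradAux f l z x y‖ ^ 2) + 8 * (l * μ) * ‖x - z‖ ^ 2 := by gcongr
      _ = _ := by ring
  unfold stationarity
  linarith

/-- The total coefficient of ‖`gradAux`‖² in a step. The ratio 48 = 144/3 leaves a descent of at
least 24τ, whereas the remaining terms cost less than 5τ. -/
theorem primal_step_coefficient_nonpos {τ₁ τ β : ℝ} (hμ : 0 < μ) (hμl : μ ≤ l) (hτ : 0 ≤ τ)
    (hτ1 : τ₁ = 48 * τ) (hτl : l * τ ≤ 1 / 144) (hβ : β = τ * μ / 1600) :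
    - (τ₁ * (1 - 3 * l * τ₁ / 2)) + 4 * τ + (4 * τ * l ^ 2 + l * β) * τ₁ ^ 2
      + τ / 25600 * 4 ≤ 0 := by
  have hl : 0 < l := hμ.trans_le hμl
  have hx : 0 ≤ l * τ := by positivity
  have h1 : l * τ * μ ≤ l * τ * l := mul_le_mul_of_nonneg_left hμl hx
  have h2 : l * β ≤ τ * l ^ 2 := by
    have : 0 ≤ l * τ * l := by positivity
    calc l * β = l * τ * μ / 1600 := by rw [hβ]; ring
      _ ≤ l * τ * l := by linarith
      _ = τ * l ^ 2 := by ring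
  have h3 : (4 * τ * l ^ 2 + l * β) * τ₁ ^ 2 ≤ (5 * (τ * l ^ 2)) * τ₁ ^ 2 :=
    mul_le_mul_of_nonneg_right (by linarith) (sq_nonneg _)
  have h4 : (5 * (τ * l ^ 2)) * τ₁ ^ 2 = τ * (11520 * (l * τ) ^ 2) := by rw [hτ1]; ring
  have h5 : τ * (11520 * (l * τ) ^ 2) ≤ τ * (11520 * (1 / 144) ^ 2) := by gcongr
  have h6 : τ * (l * τ) ≤ τ * (1 / 144) := mul_le_mul_of_nonneg_left hτl hτ
  have h7 : τ₁ * (1 - 3 * l * τ₁ / 2) = 48 * τ - 3456 * (τ * (l * τ)) := by rw [hτ1]; ring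
  linarith

/-- One step of Smoothed-AGDA in the primal variable. -/
theorem primal_step_le (hs : LipschitzSmooth f l) (hμ : 0 < μ)
    (hμl : μ ≤ l) {z xb : Euc m} {y : Euc n} (hb : gradAux f l z xb y = 0) {τ₁ τ β : ℝ}
    (hτ : 0 ≤ τ) (hτ1 : τ₁ = 48 * τ) (hτl : l * τ ≤ 1 / 144) (hβ : β = τ * μ / 1600)
    (x e : Euc m) :
    aux f l z (x - τ₁ • (gradAux f l z x y + e)) y - 2 * dual f l z y + 2 * moreau f l z
      + 2 * τ * l ^ 2 * ‖x - τ₁ • (gradAux f l z x y + e) - xb‖ ^ 2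
      - τ / 2 * ‖gradY f xb y‖ ^ 2
      - l * β * ‖x - τ₁ • (gradAux f l z x y + e) - z‖ ^ 2 ≤
    lyapunov f l x y z - τ / 25600 * stationarity f l μ x y
      + (- τ₁ * (1 - 3 * l * τ₁) + 2 * (4 * τ * l ^ 2 + l * β) * τ₁ ^ 2)
          * inner ℝ (gradAux f l z x y) e
      + (3 / 2 * l + (4 * τ * l ^ 2 + l * β)) * τ₁ ^ 2 * ‖e‖ ^ 2 := by
  have hl : 0 < l := hμ.trans_le hμl
  have hβ0 : 0 ≤ β := by rw [hβ]; positivity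
  have h1 := aux_descent hs z x y τ₁ e
  have h2 := mul_le_mul_of_nonneg_left (mul_stationarity_le hs hμ hμl hb x)
    (show 0 ≤ τ / 25600 by positivity)
  have h3 : l ^ 2 * ‖x - xb‖ ^ 2 ≤ ‖gradAux f l z x y‖ ^ 2 := by
    rw [← mul_pow]
    exact pow_le_pow_left₀ (by positivity) (mul_norm_sub_argmin_le hs hb x) 2
  have hU : ‖τ₁ • (gradAux f l z x y + e)‖ ^ 2 = τ₁ ^ 2 * (‖gradAux f l z x y‖ ^ 2
      + 2 * inner ℝ (gradAux f l z x y) e + ‖e‖ ^ 2) := by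
    rw [norm_smul, mul_pow, Real.norm_eq_abs, sq_abs, norm_add_sq_real]
  set u := τ₁ • (gradAux f l z x y + e)
  have h4 : ‖x - u - xb‖ ^ 2 ≤ 2 * ‖x - xb‖ ^ 2 + 2 * ‖u‖ ^ 2 := by
    have h := norm_sub_le (x - xb) u
    rw [sub_right_comm] at h
    have := pow_le_pow_left₀ (norm_nonneg _) h 2
    nlinarith [sq_nonneg (‖x - xb‖ - ‖u‖)]
  have h5 : ‖x - z‖ ^ 2 ≤ 2 * ‖x - u - z‖ ^ 2 + 2 * ‖u‖ ^ 2 := by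
    have h := norm_add_le (x - u - z) u
    rw [show x - u - z + u = x - z by abel] at h
    have := pow_le_pow_left₀ (norm_nonneg _) h 2
    nlinarith [sq_nonneg (‖x - u - z‖ - ‖u‖)]
  have h6 : 2 * τ * l ^ 2 * ‖x - u - xb‖ ^ 2 ≤
      4 * τ * ‖gradAux f l z x y‖ ^ 2 + 4 * τ * l ^ 2 * ‖u‖ ^ 2 := by
    have := mul_le_mul_of_nonneg_left h4 (show 0 ≤ 2 * τ * l ^ 2 by positivity)
    have := mul_le_mul_of_nonneg_left h3 (show 0 ≤ 4 * τ by positivity)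
    linarith
  have h7 : - (l * β * ‖x - u - z‖ ^ 2) ≤ - (l * β / 2 * ‖x - z‖ ^ 2) + l * β * ‖u‖ ^ 2 := by
    have := mul_le_mul_of_nonneg_left h5 (show 0 ≤ l * β / 2 by positivity)
    linarith
  -- This identity fixes 25600 = 16 · 1600: the centre term of `stationarity` uses up exactly the
  -- remaining (lβ/2)‖x - z‖².
  have hw : τ / 25600 * (8 * (l * μ) * ‖x - z‖ ^ 2) = l * β / 2 * ‖x - z‖ ^ 2 := by
    rw [hβ]; ring
  have ha : 0 ≤ ‖gradAux f l z x y‖ ^ 2 := sq_nonneg _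
  have hH : 0 ≤ τ * ‖gradY f xb y‖ ^ 2 := by positivity
  have hcoef := primal_step_coefficient_nonpos hμ hμl hτ hτ1 hτl hβ
  have h11 := mul_le_mul_of_nonneg_right hcoef ha
  rw [hU] at h6 h7
  simp only [lyapunov]
  linarith

theorem moreau_le_lyapunov (hs : LipschitzSmooth f l) (hp : PLInY f μ) (hl : 0 < l)
    (x : Euc m) (y : Euc n) (z : Euc m) : moreau f l z ≤ lyapunov f l x y z := by
  have h1 := dual_le_moreau hs hp hl z y
  have h2 := dual_le hs hl z x y
  unfold lyapunov
  linarith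

/-- The Lyapunov function of AGDA on the auxiliary problem centred at `z`. -/
noncomputable def auxGap (f : Euc m → Euc n → ℝ) (l : ℝ) (x : Euc m) (y : Euc n) (z : Euc m) :
    ℝ := aux f l z x y - 3 * dual f l z y + 2 * moreau f l z

/-- The expected effect, after a contracting primal step, of the dual step of AGDA. -/
theorem agda_dual_step_le (hs : LipschitzSmooth f l) (hp : PLInY f μ) (hμ : 0 < μ)
    (hμl : μ ≤ l) (z : Euc m) {τ : ℝ}
    (hτ : 0 ≤ τ) (hτl : l * τ ≤ 1 / 12) (x : Euc m) (y : Euc n) :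
    ∃ a : Euc n, ∀ e : Euc n,
      (1 - 4 * l * τ) * (aux f l z x (y + τ • (gradY f x y + e))
          - dual f l z (y + τ • (gradY f x y + e)))
        + 2 * (moreau f l z - dual f l z (y + τ • (gradY f x y + e))) ≤
      (1 - μ * τ) * auxGap f l x y z + inner ℝ a e + 7 / 2 * l * τ ^ 2 * ‖e‖ ^ 2 := by
  have hl : 0 < l := hμ.trans_le hμl
  obtain ⟨xb, hb⟩ := exists_gradAux_eq_zero hs hl z y
  -- θ is the factor by which the following primal step, of size 4τ, shrinks `aux` - `dual`.
  set θ := 1 - 4 * l * τ with hθ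
  have hθ0 : 0 ≤ θ := by linarith
  have hlτ : 0 ≤ l * τ := by positivity
  have hθ1 : θ ≤ 1 := by linarith
  -- The witness collects all terms linear in `e`. Only its independence of `e` matters, since the
  -- error has mean zero.
  refine ⟨(τ * θ + 7 * l * τ ^ 2) • gradY f x y - (τ * (θ + 2)) • gradY f xb y, fun e => ?_⟩
  have h1 := aux_ascent hs z x y τ (gradY f x y + e)
  have h2 := dual_ascent hs hl hb τ (gradY f x y + e)
  set y' := y + τ • (gradY f x y + e)
  have h3 := norm_gradY_sub_sq_le hs x xb y
  have h4 := moreau_sub_dual_le hs hp hl hμ hb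
  have h5 := dual_le_moreau hs hp hl z y
  have h6 := dual_add_le_aux hs hl hb x
  rw [norm_add_sq_real, inner_add_right] at h1 h2
  rw [real_inner_self_eq_norm_sq] at h1
  rw [real_inner_comm] at h3
  rw [inner_sub_left, real_inner_smul_left, real_inner_smul_left]
  have h7 := mul_le_mul_of_nonneg_left h1 hθ0
  have h8 := mul_le_mul_of_nonneg_left h2 (show 0 ≤ θ + 2 by linarith)
  have hG : 0 ≤ ‖gradY f x y‖ ^ 2 := sq_nonneg _
  have hv : 0 ≤ l * τ ^ 2 * (‖gradY f x y‖ ^ 2 + 2 * inner ℝ (gradY f x y) e + ‖e‖ ^ 2) := by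
    rw [← norm_add_sq_real]; positivity
  have h9 := mul_le_mul_of_nonneg_left hθ1 hv
  have h10 : l ^ 2 * ‖x - xb‖ ^ 2 ≤ 2 * l * (aux f l z x y - dual f l z y) := by
    have := mul_le_mul_of_nonneg_left h6 (show 0 ≤ 2 * l by positivity)
    linarith
  have hB : 0 ≤ aux f l z x y - dual f l z y := by
    have : 0 ≤ l / 2 * ‖x - xb‖ ^ 2 := by positivity
    linarith
  unfold auxGap
  set G := ‖gradY f x y‖ ^ 2
  set H := ‖gradY f xb y‖ ^ 2
  set J := inner ℝ (gradY f xb y) (gradY f x y)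
  set A := moreau f l z - dual f l z y with hA
  set B := aux f l z x y - dual f l z y with hBdef
  -- The growth 3lτB is outweighed by the 4lτB that θ removes, leaving (1 - lτ)B ≤ (1 - μτ)B.
  have hscalar : θ * G - (θ + 2) * J + 7 / 2 * (l * τ) * G ≤ 3 * l * B - 2 * μ * A := by
    have h11 : (θ / 2 + 1) * (G - 2 * J + H) ≤ (θ / 2 + 1) * (2 * l * B) :=
      mul_le_mul_of_nonneg_left (h3.trans h10) (by linarith)
    have h12 : (θ / 2 + 1) * (2 * l * B) ≤ (3 / 2) * (2 * l * B) :=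
      mul_le_mul_of_nonneg_right (by linarith) (by positivity)
    have h13 : 1 * H ≤ (θ / 2 + 1) * H := mul_le_mul_of_nonneg_right (by linarith) (sq_nonneg _)
    have h14 : (7 / 2 * (l * τ) + θ / 2 - 1) * G ≤ 0 :=
      mul_nonpos_of_nonpos_of_nonneg (by linarith) hG
    linarith
  have h15 := mul_le_mul_of_nonneg_left hscalar hτ
  have h16 : 0 ≤ τ * (l - μ) * B := mul_nonneg (mul_nonneg hτ (by linarith)) hB
  have h17 : θ * B = B - 4 * (τ * l * B) := by rw [hθ]; ring
  have e1 : aux f l z x y - 3 * dual f l z y + 2 * moreau f l z = B + 2 * A := by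
    rw [hA, hBdef]; ring
  have e2 : θ * (aux f l z x y' - dual f l z y') + 2 * (moreau f l z - dual f l z y') =
    θ * aux f l z x y' - (θ + 2) * dual f l z y' + 2 * moreau f l z := by ring
  have e3 : θ * aux f l z x y - (θ + 2) * dual f l z y + 2 * moreau f l z = θ * B + 2 * A := by
    rw [hA, hBdef]; ring
  rw [e1, e2]
  linarith

/-- One step of AGDA in the primal variable. -/
theorem agda_primal_step_le (hs : LipschitzSmooth f l) (hl : 0 < l) (z : Euc m) {τ : ℝ}
    (hτ : 0 ≤ τ) (hτl : l * τ ≤ 1 / 12) (x : Euc m) (y : Euc n) (e : Euc m) :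
    auxGap f l (x - (4 * τ) • (gradAux f l z x y + e)) y z ≤
      (1 - 4 * l * τ) * (aux f l z x y - dual f l z y) + 2 * (moreau f l z - dual f l z y)
        - 4 * τ * (1 - 12 * l * τ) * inner ℝ (gradAux f l z x y) e
        + 24 * l * τ ^ 2 * ‖e‖ ^ 2 := by
  have h1 := aux_descent hs z x y (4 * τ) e
  have h2 := aux_sub_dual_le hs hl z x y
  rw [le_div_iff₀ (by positivity)] at h2
  -- 12lτ ≤ 1 preserves half of the step 4τ; the PL inequality in x then yields the factor 1 - 4lτ.
  have h3 : 2 * τ * ‖gradAux f l z x y‖ ^ 2 ≤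
      4 * τ * (1 - 3 * l * (4 * τ) / 2) * ‖gradAux f l z x y‖ ^ 2 := by
    have : 0 ≤ τ * (1 - 12 * (l * τ)) * ‖gradAux f l z x y‖ ^ 2 :=
      mul_nonneg (mul_nonneg hτ (by linarith)) (sq_nonneg _)
    linarith
  have h4 := mul_le_mul_of_nonneg_left h2 (show 0 ≤ 2 * τ by positivity)
  unfold auxGap
  linarith

theorem auxGap_nonneg (hs : LipschitzSmooth f l) (hp : PLInY f μ) (hl : 0 < l)
    (x : Euc m) (y : Euc n) (z : Euc m) : 0 ≤ auxGap f l x y z := by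
  have h1 := dual_le_moreau hs hp hl z y
  have h2 := dual_le hs hl z x y
  unfold auxGap
  linarith

/-- With the centre at the point itself the regularizer vanishes in value and gradient. Then
`auxGap` is at most 3(`aux` - `dual`) + 2(Φ - f), controlled by strong convexity in x and PL in y.
-/
theorem auxGap_self_le (hs : LipschitzSmooth f l) (hp : PLInY f μ) (hμ : 0 < μ) (hμl : μ ≤ l)
    (x : Euc m) (y : Euc n) : auxGap f l x y x ≤ 3 / (2 * μ) * stationarity f l μ x y := by
  have hl : 0 < l := hμ.trans_le hμl
  have h1 := moreau_le hs hp hl hμ x x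
  have h2 := aux_sub_dual_le hs hl x x y
  have h3 := hp.pl x y
  have h4 : primal f x - f x y ≤ ‖gradY f x y‖ ^ 2 / (2 * μ) := by
    rw [le_div_iff₀ (by positivity)]; linarith
  simp only [auxGap, stationarity, aux, gradAux, sub_self, norm_zero, smul_zero, add_zero] at *
  have e1 : 3 / (2 * μ) * (μ / l * ‖gradX f x y‖ ^ 2 + ‖gradY f x y‖ ^ 2) =
      3 * (‖gradX f x y‖ ^ 2 / (2 * l)) + 3 * (‖gradY f x y‖ ^ 2 / (2 * μ)) := by
    field_simp
  have h5 : 0 ≤ ‖gradY f x y‖ ^ 2 / (2 * μ) := by positivity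
  rw [e1]
  linarith

theorem norm_sub_prox_sq_le (hs : LipschitzSmooth f l) (hp : PLInY f μ) (hl : 0 < l)
    {z p : Euc m} (hprox : moreau f l z = primal f p + l * ‖p - z‖ ^ 2) (x : Euc m) (y : Euc n) :
    l * ‖x - p‖ ^ 2 ≤ 4 * auxGap f l x y z := by
  obtain ⟨xb, hb⟩ := exists_gradAux_eq_zero hs hl z y
  have h1 := norm_argmin_sub_prox_sq_le hs hp hl hb hprox
  have h2 := dual_add_le_aux hs hl hb x
  have h3 := dual_le_moreau hs hp hl z y
  have h4 : ‖x - p‖ ^ 2 ≤ 2 * ‖x - xb‖ ^ 2 + 2 * ‖xb - p‖ ^ 2 := by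
    have := pow_le_pow_left₀ (norm_nonneg _) (norm_sub_le_norm_sub_add_norm_sub x xb p) 2
    nlinarith [sq_nonneg (‖x - xb‖ - ‖xb - p‖)]
  have h5 := mul_le_mul_of_nonneg_left h4 hl.le
  unfold auxGap
  linarith

/-- Stationarity of a point for the primal function in terms of the potential of the
auxiliary problem centred at `z`. -/
theorem norm_gradient_primal_sq_le (hs : LipschitzSmooth f l) (hp : PLInY f μ) (hμ : 0 < μ)
    (hμl : μ ≤ l) (z x : Euc m) (y y₀ : Euc n) :
    ‖gradient (primal f) x‖ ^ 2 ≤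
      32 * l * auxGap f l z y₀ z + 72 * l * (l / μ) ^ 2 * auxGap f l x y z := by
  have hl : 0 < l := hμ.trans_le hμl
  have hκ : 1 ≤ l / μ := (one_le_div hμ).2 hμl
  -- At p the gradient is exactly 2l(z - p); passing to x costs l(1 + 2κ) ≤ 3lκ per unit length.
  -- Squaring with both distances bounded by 4 `auxGap`/l gives 32 = 2·4·4 and 72 = 2·9·4.
  obtain ⟨p, hp1, hp2, -⟩ := exists_prox hs hp hl hμ z
  have h1 := norm_sub_prox_sq_le hs hp hl hp1 z y₀
  have h2 := norm_sub_prox_sq_le hs hp hl hp1 x y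
  have h3 := norm_gradient_primal_sub_le hs hp hl hμ p x
  have h4 : ‖gradient (primal f) p‖ = 2 * l * ‖z - p‖ := by
    rw [hp2, norm_smul, Real.norm_of_nonneg (by positivity)]
  have h5 := norm_le_norm_add_norm_sub' (gradient (primal f) x) (gradient (primal f) p)
  have h6 : ‖gradient (primal f) x‖ ≤ 2 * l * ‖z - p‖ + 3 * l * (l / μ) * ‖x - p‖ := by
    have : l * (1 + 2 * (l / μ)) * ‖x - p‖ ≤ l * (3 * (l / μ)) * ‖x - p‖ := by
      gcongr; linarith
    linarith
  have h7 := pow_le_pow_left₀ (norm_nonneg _) h6 2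
  have h8 := mul_le_mul_of_nonneg_left h1 (show 0 ≤ 8 * l by positivity)
  have h9 := mul_le_mul_of_nonneg_left h2 (show 0 ≤ 18 * l * (l / μ) ^ 2 by positivity)
  nlinarith [sq_nonneg (2 * l * ‖z - p‖ - 3 * l * (l / μ) * ‖x - p‖)]

end Potential

/-! ### Integrating out one unbiased error. -/

section Noise

variable {Ξ : Type*} [MeasurableSpace Ξ] {ν : Measure Ξ} [IsProbabilityMeasure ν]

/-- The linear term integrates to zero. The nonnegativity in the conclusion lets the bound from an
inner integration serve as F in an outer one; F itself need not be measurable. -/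
theorem lintegral_ofReal_le_of_le_quadratic {E : Type*} [NormedAddCommGroup E]
    [InnerProductSpace ℝ E] [CompleteSpace E] {N : Ξ → E} {σ A b : ℝ} {a : E} {F : Ξ → ℝ}
    (hN : Integrable N ν) (hmean : ∫ s, N s ∂ν = 0)
    (hvar : ∫⁻ s, ‖N s‖ₑ ^ 2 ∂ν ≤ ENNReal.ofReal (σ ^ 2)) (hb : 0 ≤ b) (hF0 : ∀ s, 0 ≤ F s)
    (hF : ∀ s, F s ≤ A + inner ℝ a (N s) + b * ‖N s‖ ^ 2) :
    0 ≤ A + b * σ ^ 2 ∧ ∫⁻ s, ENNReal.ofReal (F s) ∂ν ≤ ENNReal.ofReal (A + b * σ ^ 2) := by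
  have he : ∀ s, ENNReal.ofReal (‖N s‖ ^ 2) = ‖N s‖ₑ ^ 2 := fun s => by
    rw [ENNReal.ofReal_pow (norm_nonneg _), ofReal_norm]
  have hsq : Integrable (fun s => ‖N s‖ ^ 2) ν := by
    refine ⟨hN.aestronglyMeasurable.norm.pow 2, ?_⟩
    rw [hasFiniteIntegral_iff_ofReal (Filter.Eventually.of_forall fun s => sq_nonneg _)]
    simp only [he]
    exact hvar.trans_lt ENNReal.ofReal_lt_top
  have hvar' : ∫ s, ‖N s‖ ^ 2 ∂ν ≤ σ ^ 2 := by
    rw [← ENNReal.ofReal_le_ofReal_iff (sq_nonneg _), ofReal_integral_eq_lintegral_ofReal hsq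
      (Filter.Eventually.of_forall fun s => sq_nonneg _)]
    simpa only [he] using hvar
  have hin : Integrable (fun s => inner ℝ a (N s)) ν := hN.const_inner a
  have hint : Integrable (fun s => A + inner ℝ a (N s) + b * ‖N s‖ ^ 2) ν :=
    ((integrable_const A).add hin).add (hsq.const_mul b)
  have hval : ∫ s, (A + inner ℝ a (N s) + b * ‖N s‖ ^ 2) ∂ν = A + b * ∫ s, ‖N s‖ ^ 2 ∂ν := by
    have h1 : ∫ s, (A + inner ℝ a (N s) + b * ‖N s‖ ^ 2) ∂ν =
        ∫ s, (A + inner ℝ a (N s)) ∂ν + ∫ s, b * ‖N s‖ ^ 2 ∂ν :=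
      integral_add ((integrable_const A).add hin) (hsq.const_mul b)
    have h2 : ∫ s, (A + inner ℝ a (N s)) ∂ν = ∫ _, A ∂ν + ∫ s, inner ℝ a (N s) ∂ν :=
      integral_add (integrable_const A) hin
    rw [h1, h2, integral_const_mul, integral_inner hN, hmean]
    simp
  have hle : A + b * ∫ s, ‖N s‖ ^ 2 ∂ν ≤ A + b * σ ^ 2 := by gcongr
  have h0 : ∀ s, 0 ≤ A + inner ℝ a (N s) + b * ‖N s‖ ^ 2 := fun s => (hF0 s).trans (hF s)
  refine ⟨le_trans ?_ hle, ?_⟩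
  · rw [← hval]
    exact integral_nonneg h0
  · refine (lintegral_mono fun s => ENNReal.ofReal_le_ofReal (hF s)).trans ?_
    rw [← ofReal_integral_eq_lintegral_ofReal hint (Filter.Eventually.of_forall h0), hval]
    exact ENNReal.ofReal_le_ofReal hle

end Noise

/-! ### Fresh samples and the independent random index. -/

section Fresh

theorem dependsOn_prodMk_eval {Ξ E : Type*} {q : ℕ} {φ : (ℕ → Ξ) → E} (hd : DependsOn φ (Set.Iio q)) :
    DependsOn (fun r => (φ r, r q)) (Set.Iio (q + 1)) := fun r r' h => by
  have h1 : φ r = φ r' := hd fun k hk => h k (Nat.lt_succ_of_lt hk)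
  have h2 : r q = r' q := h q (Nat.lt_succ_self q)
  simp only [h1, h2]

variable {Ω Ξ : Type*} [MeasurableSpace Ω] [MeasurableSpace Ξ] {P : Measure Ω}
  {ν : Measure Ξ} {s : ℕ → Ω → Ξ}
  {E : Type*} [MeasurableSpace E]

/-- A function of the first q samples factors through the finite product over `range q`, by padding
with an arbitrary point. Independence of disjoint finite blocks then applies. -/
theorem indepFun_of_dependsOn (hs : ∀ k, Measurable (s k)) (hind : iIndepFun s P)
    [Nonempty Ξ] {q : ℕ} {φ : (ℕ → Ξ) → E} (hφ : Measurable φ) (hd : DependsOn φ (Set.Iio q)) :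
    IndepFun (fun ω => φ fun k => s k ω) (s q) P := by
  classical
  let ξ₀ : Ξ := Classical.arbitrary Ξ
  have h1 := hind.indepFun_finset (Finset.range q) {q} (by simp) hs
  let ext : (Finset.range q → Ξ) → ℕ → Ξ := fun v k =>
    if h : k ∈ Finset.range q then v ⟨k, h⟩ else ξ₀
  have hext : Measurable ext := by
    refine measurable_pi_lambda _ fun k => ?_
    by_cases h : k ∈ Finset.range q
    · simp only [ext, h, dite_true]
      exact measurable_pi_apply _
    · simp only [ext, h, dite_false]
      exact measurable_const
  have hproj : Measurable fun v : ({q} : Finset ℕ) → Ξ => v ⟨q, Finset.mem_singleton_self q⟩ :=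
    measurable_pi_apply _
  have h2 := h1.comp (hφ.comp hext) hproj
  suffices h3 : (fun ω => φ fun k => s k ω) =
      (φ ∘ ext) ∘ fun a (i : Finset.range q) => s i a by
    rw [h3]; exact h2
  funext ω
  refine hd fun k hk => ?_
  have : k ∈ Finset.range q := Finset.mem_range.2 hk
  simp only [ext, this, dite_true]

/-- The substitute for conditional expectation: the joint law of the past and a fresh sample is a
product, so Tonelli applies. -/
theorem lintegral_fresh [IsProbabilityMeasure P] [IsProbabilityMeasure ν]
    (hs : ∀ k, Measurable (s k)) (hlaw : ∀ k, P.map (s k) = ν)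
    (hind : iIndepFun s P) {q : ℕ} {φ : (ℕ → Ξ) → E} (hφ : Measurable φ)
    (hd : DependsOn φ (Set.Iio q)) {h : E × Ξ → ℝ≥0∞} (hh : Measurable h) :
    ∫⁻ ω, h (φ (fun k => s k ω), s q ω) ∂P =
      ∫⁻ ω, ∫⁻ ξ, h (φ (fun k => s k ω), ξ) ∂ν ∂P := by
  have : Nonempty Ξ := nonempty_of_isProbabilityMeasure ν
  have hm : Measurable fun ω => φ fun k => s k ω := hφ.comp (measurable_pi_lambda _ hs)
  have h1 := (indepFun_iff_map_prod_eq_prod_map_map hm.aemeasurable (hs q).aemeasurable).1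
    (indepFun_of_dependsOn hs hind hφ hd)
  calc ∫⁻ ω, h (φ (fun k => s k ω), s q ω) ∂P
      = ∫⁻ p, h p ∂(P.map fun ω => (φ (fun k => s k ω), s q ω)) :=
        (lintegral_map hh (hm.prodMk (hs q))).symm
    _ = ∫⁻ e, ∫⁻ ξ, h (e, ξ) ∂ν ∂(P.map fun ω => φ fun k => s k ω) := by
        rw [h1, hlaw q, lintegral_prod _ hh.aemeasurable]
    _ = _ := lintegral_map hh.lintegral_prod_right' hm

theorem lintegral_fresh_pair [IsProbabilityMeasure P] [IsProbabilityMeasure ν]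
    (hs : ∀ k, Measurable (s k)) (hlaw : ∀ k, P.map (s k) = ν)
    (hind : iIndepFun s P) {q : ℕ} {φ : (ℕ → Ξ) → E} (hφ : Measurable φ)
    (hd : DependsOn φ (Set.Iio q)) {h : (E × Ξ) × Ξ → ℝ≥0∞} (hh : Measurable h) :
    ∫⁻ ω, h ((φ (fun k => s k ω), s q ω), s (q + 1) ω) ∂P =
      ∫⁻ ω, ∫⁻ ξ, ∫⁻ ξ', h ((φ (fun k => s k ω), ξ), ξ') ∂ν ∂ν ∂P := by
  have h1 := lintegral_fresh (q := q + 1) hs hlaw hind (hφ.prodMk (measurable_pi_apply q))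
    (dependsOn_prodMk_eval hd) hh
  rw [h1]
  exact lintegral_fresh hs hlaw hind hφ hd hh.lintegral_prod_right'

theorem lintegral_uniform_index {T : ℕ} {I : Ω → Fin T} (hs : ∀ k, Measurable (s k))
    (hI : Measurable I) (hu : ∀ t, P (I ⁻¹' {t}) = (T : ℝ≥0∞)⁻¹)
    (hind : IndepFun I (fun ω k => s k ω) P) {h : Fin T → (ℕ → Ξ) → ℝ≥0∞}
    (hh : ∀ t, Measurable (h t)) :
    ∫⁻ ω, h (I ω) (fun k => s k ω) ∂P =
      (T : ℝ≥0∞)⁻¹ * ∑ t, ∫⁻ ω, h t (fun k => s k ω) ∂P := by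
  have hS : Measurable fun ω k => s k ω := measurable_pi_lambda _ hs
  have h1 : ∀ ω, h (I ω) (fun k => s k ω) =
      ∑ t, Set.indicator {t} (fun _ => (1 : ℝ≥0∞)) (I ω) * h t (fun k => s k ω) := by
    intro ω
    rw [Finset.sum_eq_single (I ω)]
    · simp
    · intro t _ ht
      simp [Set.indicator, ht.symm]
    · simp
  simp only [h1]
  have hmeas : ∀ t : Fin T, Measurable (Set.indicator {t} (fun _ => (1 : ℝ≥0∞))) :=
    fun t => measurable_of_finite _
  have hprod : ∀ t : Fin T, Measurable fun ω =>
      Set.indicator {t} (fun _ => (1 : ℝ≥0∞)) (I ω) * h t (fun k => s k ω) :=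
    fun t => ((hmeas t).comp hI).mul ((hh t).comp hS)
  rw [lintegral_finsetSum _ fun t _ => hprod t, Finset.mul_sum]
  refine Finset.sum_congr rfl fun t _ => ?_
  have h2 := lintegral_mul_eq_lintegral_mul_lintegral_of_indepFun ((hmeas t).comp hI)
    ((hh t).comp hS) (hind.comp (hmeas t) (hh t))
  simp only [Pi.mul_apply, Function.comp] at h2
  rw [h2]
  congr 1
  have h3 : (fun ω => Set.indicator {t} (fun _ => (1 : ℝ≥0∞)) (I ω)) =
      Set.indicator (I ⁻¹' {t}) 1 := by
    funext ω
    simp [Set.indicator]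
  rw [h3, lintegral_indicator_one (hI (measurableSet_singleton t)), hu]

theorem measurable_fresh_step {q : ℕ} {φ : (ℕ → Ξ) → E} (hφ : Measurable φ)
    {U : (E × Ξ) × Ξ → E} (hU : Measurable U) :
    Measurable fun r : ℕ → Ξ => U ((φ r, r q), r (q + 1)) :=
  hU.comp ((hφ.prodMk (measurable_pi_apply q)).prodMk (measurable_pi_apply (q + 1)))

theorem dependsOn_fresh_step {Ξ E : Type*} {q : ℕ} {φ : (ℕ → Ξ) → E}
    (hd : DependsOn φ (Set.Iio q)) (U : (E × Ξ) × Ξ → E) :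
    DependsOn (fun r : ℕ → Ξ => U ((φ r, r q), r (q + 1))) (Set.Iio (q + 2)) := fun r r' h => by
  have := dependsOn_prodMk_eval (dependsOn_prodMk_eval hd) h
  simp only at this ⊢
  rw [this]

end Fresh

/-! ### Telescoping and contracting recursions. -/

section Recursion

theorem sum_add_le_of_step_le {u d : ℕ → ℝ≥0∞} {N : ℝ≥0∞} (h : ∀ t, u (t + 1) + d t ≤ u t + N)
    (T : ℕ) : u T + ∑ t ∈ Finset.range T, d t ≤ u 0 + T * N := by
  induction T with
  | zero => simp
  | succ T ih =>
    rw [Finset.sum_range_succ]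
    calc u (T + 1) + (∑ t ∈ Finset.range T, d t + d T)
        = (u (T + 1) + d T) + ∑ t ∈ Finset.range T, d t := by ring
      _ ≤ (u T + N) + ∑ t ∈ Finset.range T, d t := by grw [h T]
      _ = (u T + ∑ t ∈ Finset.range T, d t) + N := by ring
      _ ≤ u 0 + T * N + N := by gcongr
      _ = _ := by push_cast; ring

theorem le_pow_mul_add_of_contraction {u : ℕ → ℝ≥0∞} {r N : ℝ} (hr0 : 0 ≤ r) (hr1 : r < 1)
    (hN : 0 ≤ N) (h : ∀ k, u (k + 1) ≤ ENNReal.ofReal r * u k + ENNReal.ofReal N) (K : ℕ) :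
    u K ≤ ENNReal.ofReal (r ^ K) * u 0 + ENNReal.ofReal (N / (1 - r)) := by
  have h1 : 0 < 1 - r := sub_pos.2 hr1
  induction K with
  | zero => simp
  | succ K ih =>
    calc u (K + 1) ≤ ENNReal.ofReal r * u K + ENNReal.ofReal N := h K
      _ ≤ ENNReal.ofReal r * (ENNReal.ofReal (r ^ K) * u 0 + ENNReal.ofReal (N / (1 - r)))
          + ENNReal.ofReal N := by gcongr
      _ = ENNReal.ofReal (r ^ (K + 1)) * u 0
          + (ENNReal.ofReal r * ENNReal.ofReal (N / (1 - r)) + ENNReal.ofReal N) := by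
        rw [pow_succ, ENNReal.ofReal_mul (by positivity)]; ring
      _ = _ := by
        rw [← ENNReal.ofReal_mul hr0, ← ENNReal.ofReal_add (by positivity) hN]
        congr 2
        field_simp; ring

end Recursion

/-! ### The algorithms as update maps on triples, and the query count. -/

section Updates

variable {X Y Ξ : Type*} [AddCommGroup X] [Module ℝ X] [AddCommGroup Y] [Module ℝ Y]

/-- One iteration of Smoothed-AGDA on triples `(x, y, z)`, given the two samples. -/
def smoothedUpdate (Gx : X → Y → Ξ → X) (Gy : X → Y → Ξ → Y) (τ₁ τ₂ p β : ℝ)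
    (q : ((X × Y × X) × Ξ) × Ξ) : X × Y × X :=
  let e := q.1.1
  let x' := e.1 - τ₁ • (Gx e.1 e.2.1 q.1.2 + p • (e.1 - e.2.2))
  (x', e.2.1 + τ₂ • Gy x' e.2.1 q.2, e.2.2 + β • (x' - e.2.2))

/-- One iteration of AGDA on triples `(x, y, c)` with fixed centre `c`, given the two samples. -/
def agdaUpdate (Gx : X → Y → Ξ → X) (Gy : X → Y → Ξ → Y) (l η₁ η₂ : ℝ)
    (q : ((X × Y × X) × Ξ) × Ξ) : X × Y × X :=
  let e := q.1.1
  let y' := e.2.1 + η₂ • Gy e.1 e.2.1 q.1.2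
  (e.1 - η₁ • (Gx e.1 y' q.2 + (2 * l) • (e.1 - e.2.2)), y', e.2.2)

/-- The variables of Smoothed-AGDA after `t` iterations. -/
def smoothedIterate (Gx : X → Y → Ξ → X) (Gy : X → Y → Ξ → Y) (τ₁ τ₂ p β : ℝ)
    (x₀ : X) (y₀ : Y) (z₀ : X) (t : ℕ) (s : ℕ → Ξ) : X × Y × X :=
  let S := smoothedRun Gx Gy s τ₁ τ₂ p β x₀ y₀ z₀ t
  (S.x, S.y, S.z)

/-- The variables of AGDA in the second stage after `k` iterations, together with the centre. -/
def agdaIterate (Gx : X → Y → Ξ → X) (Gy : X → Y → Ξ → Y) (l τ₁ τ₂ β : ℝ)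
    (x₀ : X) (y₀ : Y) (z₀ : X) (T : ℕ) (η₁ η₂ : ℝ) (t k : ℕ) (s : ℕ → Ξ) : X × Y × X :=
  let A := twoStage Gx Gy s l τ₁ τ₂ β x₀ y₀ z₀ T η₁ η₂ k t
  (A.x, A.y, (smoothedRun Gx Gy s τ₁ τ₂ (2 * l) β x₀ y₀ z₀ t).x)

variable (Gx : X → Y → Ξ → X) (Gy : X → Y → Ξ → Y) (l τ₁ τ₂ p β : ℝ) (x₀ : X) (y₀ : Y) (z₀ : X)
  (T : ℕ) (η₁ η₂ : ℝ) (t k : ℕ) (s : ℕ → Ξ)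

theorem smoothedRun_succ : smoothedRun Gx Gy s τ₁ τ₂ p β x₀ y₀ z₀ (t + 1) =
    smoothedStep Gx Gy s τ₁ τ₂ p β (smoothedRun Gx Gy s τ₁ τ₂ p β x₀ y₀ z₀ t) :=
  Function.iterate_succ_apply' _ _ _

theorem smoothedRun_queries : (smoothedRun Gx Gy s τ₁ τ₂ p β x₀ y₀ z₀ t).queries = 2 * t := by
  induction t with
  | zero => rfl
  | succ t ih =>
    rw [smoothedRun_succ]
    simp only [smoothedStep, ih]
    ring

theorem twoStage_succ : twoStage Gx Gy s l τ₁ τ₂ β x₀ y₀ z₀ T η₁ η₂ (k + 1) t =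
    agdaStep (auxOracle Gx l (smoothedRun Gx Gy s τ₁ τ₂ (2 * l) β x₀ y₀ z₀ t).x) Gy s η₁ η₂
      (twoStage Gx Gy s l τ₁ τ₂ β x₀ y₀ z₀ T η₁ η₂ k t) :=
  Function.iterate_succ_apply' _ _ _

theorem twoStage_queries :
    (twoStage Gx Gy s l τ₁ τ₂ β x₀ y₀ z₀ T η₁ η₂ k t).queries = 2 * T + 2 * k := by
  induction k with
  -- The second stage starts from the counter after all T iterations, whichever t was selected: its
  -- samples are fresh and the whole first stage is charged.
  | zero => exact smoothedRun_queries ..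
  | succ k ih =>
    rw [twoStage_succ]
    simp only [agdaStep, ih]
    ring

theorem smoothedIterate_succ : smoothedIterate Gx Gy τ₁ τ₂ p β x₀ y₀ z₀ (t + 1) s =
    smoothedUpdate Gx Gy τ₁ τ₂ p β
      ((smoothedIterate Gx Gy τ₁ τ₂ p β x₀ y₀ z₀ t s, s (2 * t)), s (2 * t + 1)) := by
  simp only [smoothedIterate, smoothedRun_succ, smoothedStep, smoothedUpdate, smoothedRun_queries]

theorem agdaIterate_zero : agdaIterate Gx Gy l τ₁ τ₂ β x₀ y₀ z₀ T η₁ η₂ t 0 s =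
    ((smoothedIterate Gx Gy τ₁ τ₂ (2 * l) β x₀ y₀ z₀ t s).1,
      (smoothedIterate Gx Gy τ₁ τ₂ (2 * l) β x₀ y₀ z₀ t s).2.1,
      (smoothedIterate Gx Gy τ₁ τ₂ (2 * l) β x₀ y₀ z₀ t s).1) := rfl

theorem agdaIterate_succ : agdaIterate Gx Gy l τ₁ τ₂ β x₀ y₀ z₀ T η₁ η₂ t (k + 1) s =
    agdaUpdate Gx Gy l η₁ η₂ ((agdaIterate Gx Gy l τ₁ τ₂ β x₀ y₀ z₀ T η₁ η₂ t k s,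
      s (2 * T + 2 * k)), s (2 * T + 2 * k + 1)) := by
  simp only [agdaIterate, twoStage_succ, agdaStep, agdaUpdate, twoStage_queries, auxOracle]

end Updates

/-! ### Complete steps with exact gradients, and the noise constant. -/

section Descent

variable {m n : ℕ} {f : Euc m → Euc n → ℝ} {l μ : ℝ}

/-- The dual half of a step of Smoothed-AGDA, with gradient error `e`. -/
theorem smoothed_dual_step_le (hs : LipschitzSmooth f l) (hp : PLInY f μ) (hμ : 0 < μ)
    (hμl : μ ≤ l) {z xb : Euc m} {y : Euc n} (hb : gradAux f l z xb y = 0) {τ β : ℝ}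
    (hτ : 0 ≤ τ) (hτl : l * τ ≤ 1 / 144) (hβ : β = τ * μ / 1600) (x : Euc m) (e : Euc n) :
    lyapunov f l x (y + τ • (gradY f x y + e)) (z + β • (x - z)) ≤
      aux f l z x y - 2 * dual f l z y + 2 * moreau f l z
        + 2 * τ * l ^ 2 * ‖x - xb‖ ^ 2 - τ / 2 * ‖gradY f xb y‖ ^ 2 - l * β * ‖x - z‖ ^ 2
        + inner ℝ ((τ + 7 * l * τ ^ 2) • gradY f x y - (2 * τ) • gradY f xb y) e
        + 7 / 2 * l * τ ^ 2 * ‖e‖ ^ 2 := by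
  have h1 := lyapunov_dual_smoothing_step hs hp hμ hμl hb hτ hτl hβ x (gradY f x y + e)
  have h2 := dual_step_scalar_le hs xb (y := y) hτ hτl x
  rw [norm_add_sq_real, inner_add_right, inner_add_right, real_inner_self_eq_norm_sq] at h1
  rw [inner_sub_left, real_inner_smul_left, real_inner_smul_left]
  linarith

/-- Merges the primal and dual variance contributions into one; in the proof 2304 = 48² converts τ²
into τ₁². -/
theorem noise_coefficient_le {τ₁ τ β : ℝ} (hμ : 0 < μ)
    (hμl : μ ≤ l) (hτ : 0 ≤ τ) (hτ1 : τ₁ = 48 * τ) (hτl : l * τ ≤ 1 / 144)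
    (hβ : β = τ * μ / 1600) :
    (3 / 2 * l + (4 * τ * l ^ 2 + l * β)) * τ₁ ^ 2 + 7 / 2 * l * τ ^ 2 ≤ 2 * l * τ₁ ^ 2 := by
  have hl : 0 < l := hμ.trans_le hμl
  have h1 : l * (l * τ) ≤ l * (1 / 144) := mul_le_mul_of_nonneg_left hτl hl.le
  have h2 : l * τ * μ ≤ l * τ * l := mul_le_mul_of_nonneg_left hμl (by positivity)
  have h3 : 3 / 2 * l + (4 * τ * l ^ 2 + l * β) + 7 / 2 * l / 2304 ≤ 2 * l := by
    rw [hβ]; nlinarith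
  have h4 := mul_le_mul_of_nonneg_right h3 (sq_nonneg τ₁)
  have h5 : 7 / 2 * l / 2304 * τ₁ ^ 2 = 7 / 2 * l * τ ^ 2 := by rw [hτ1]; ring
  linarith

theorem smoothed_descent (hs : LipschitzSmooth f l) (hp : PLInY f μ) (hμ : 0 < μ)
    (hμl : μ ≤ l) {τ₁ τ β : ℝ} (hτ : 0 ≤ τ) (hτ1 : τ₁ = 48 * τ) (hτl : l * τ ≤ 1 / 144)
    (hβ : β = τ * μ / 1600) (e : Euc m × Euc n × Euc m) :
    lyapunov f l
        (smoothedUpdate (fun x y (_ : Unit) => gradX f x y) (fun x y _ => gradY f x y)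
          τ₁ τ (2 * l) β ((e, ()), ())).1
        (smoothedUpdate (fun x y (_ : Unit) => gradX f x y) (fun x y _ => gradY f x y)
          τ₁ τ (2 * l) β ((e, ()), ())).2.1
        (smoothedUpdate (fun x y (_ : Unit) => gradX f x y) (fun x y _ => gradY f x y)
          τ₁ τ (2 * l) β ((e, ()), ())).2.2
      + τ / 25600 * stationarity f l μ e.1 e.2.1 ≤ lyapunov f l e.1 e.2.1 e.2.2 := by
  obtain ⟨x, y, z⟩ := e
  obtain ⟨xb, hb⟩ := exists_gradAux_eq_zero hs (hμ.trans_le hμl) z y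
  have h1 := primal_step_le hs hμ hμl hb hτ hτ1 hτl hβ x 0
  have h2 := smoothed_dual_step_le hs hp hμ hμl hb hτ hτl hβ
    (x - τ₁ • (gradAux f l z x y + 0)) 0
  simp only [smoothedUpdate, gradAux, inner_zero_right, norm_zero, add_zero, mul_zero, ne_eq,
    OfNat.ofNat_ne_zero, not_false_eq_true, zero_pow] at h1 h2 ⊢
  linarith

theorem agda_descent (hs : LipschitzSmooth f l) (hp : PLInY f μ) (hμ : 0 < μ)
    (hμl : μ ≤ l) {τ : ℝ} (hτ : 0 ≤ τ) (hτl : l * τ ≤ 1 / 12) (e : Euc m × Euc n × Euc m) :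
    auxGap f l
        (agdaUpdate (fun x y (_ : Unit) => gradX f x y) (fun x y _ => gradY f x y)
          l (4 * τ) τ ((e, ()), ())).1
        (agdaUpdate (fun x y (_ : Unit) => gradX f x y) (fun x y _ => gradY f x y)
          l (4 * τ) τ ((e, ()), ())).2.1
        (agdaUpdate (fun x y (_ : Unit) => gradX f x y) (fun x y _ => gradY f x y)
          l (4 * τ) τ ((e, ()), ())).2.2 ≤ (1 - μ * τ) * auxGap f l e.1 e.2.1 e.2.2 := by
  obtain ⟨x, y, z⟩ := e
  obtain ⟨a, ha⟩ := agda_dual_step_le hs hp hμ hμl z hτ hτl x y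
  have h1 := agda_primal_step_le hs (hμ.trans_le hμl) z hτ hτl x (y + τ • (gradY f x y + 0)) 0
  have h2 := ha 0
  simp only [agdaUpdate, gradAux, inner_zero_right, norm_zero, add_zero, mul_zero, ne_eq,
    OfNat.ofNat_ne_zero, not_false_eq_true, zero_pow, sub_zero] at h1 h2 ⊢
  linarith

end Descent

/-! ### Expected one-step descent. -/

section Expected

variable {m n : ℕ} {f : Euc m → Euc n → ℝ} {l μ σ : ℝ} {Ξ : Type*} [MeasurableSpace Ξ]
  {ν : Measure Ξ} [IsProbabilityMeasure ν] {Gx : Euc m → Euc n → Ξ → Euc m}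
  {Gy : Euc m → Euc n → Ξ → Euc n}

/-- Unbiased errors with bounded variance contribute, in a bound that is quadratic in the errors,
only through the quadratic terms. -/
theorem StochasticGradients.lintegral_x_le (hG : StochasticGradients ν f Gx Gy σ) (x : Euc m)
    (y : Euc n) {A b : ℝ} {a : Euc m} {F : Ξ → ℝ} (hb : 0 ≤ b) (hF0 : ∀ s, 0 ≤ F s)
    (hF : ∀ s, F s ≤ A + inner ℝ a (Gx x y s - gradX f x y) + b * ‖Gx x y s - gradX f x y‖ ^ 2) :
    0 ≤ A + b * σ ^ 2 ∧ ∫⁻ s, ENNReal.ofReal (F s) ∂ν ≤ ENNReal.ofReal (A + b * σ ^ 2) := by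
  refine lintegral_ofReal_le_of_le_quadratic ((hG.integrable_x x y).sub (integrable_const _)) ?_
    (hG.variance_x x y) hb hF0 hF
  rw [integral_sub' (hG.integrable_x x y) (integrable_const _), hG.unbiased_x]
  simp

theorem StochasticGradients.lintegral_y_le (hG : StochasticGradients ν f Gx Gy σ) (x : Euc m)
    (y : Euc n) {A b : ℝ} {a : Euc n} {F : Ξ → ℝ} (hb : 0 ≤ b) (hF0 : ∀ s, 0 ≤ F s)
    (hF : ∀ s, F s ≤ A + inner ℝ a (Gy x y s - gradY f x y) + b * ‖Gy x y s - gradY f x y‖ ^ 2) :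
    0 ≤ A + b * σ ^ 2 ∧ ∫⁻ s, ENNReal.ofReal (F s) ∂ν ≤ ENNReal.ofReal (A + b * σ ^ 2) := by
  refine lintegral_ofReal_le_of_le_quadratic ((hG.integrable_y x y).sub (integrable_const _)) ?_
    (hG.variance_y x y) hb hF0 hF
  rw [integral_sub' (hG.integrable_y x y) (integrable_const _), hG.unbiased_y]
  simp

/-- The expected decrease of the Lyapunov function in one step of Smoothed-AGDA. -/
theorem smoothed_expected_descent (hs : LipschitzSmooth f l) (hp : PLInY f μ)
    (hG : StochasticGradients ν f Gx Gy σ) (hμ : 0 < μ) (hμl : μ ≤ l) {τ₁ τ β c : ℝ} (hτ : 0 ≤ τ)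
    (hτ1 : τ₁ = 48 * τ) (hτl : l * τ ≤ 1 / 144) (hβ : β = τ * μ / 1600)
    (hc : ∀ z, c ≤ moreau f l z) (e : Euc m × Euc n × Euc m) :
    ∫⁻ ξ, ∫⁻ ξ', ENNReal.ofReal (lyapunov f l
        (smoothedUpdate Gx Gy τ₁ τ (2 * l) β ((e, ξ), ξ')).1
        (smoothedUpdate Gx Gy τ₁ τ (2 * l) β ((e, ξ), ξ')).2.1
        (smoothedUpdate Gx Gy τ₁ τ (2 * l) β ((e, ξ), ξ')).2.2 - c) ∂ν ∂ν
      + ENNReal.ofReal (τ / 25600 * stationarity f l μ e.1 e.2.1) ≤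
    ENNReal.ofReal (lyapunov f l e.1 e.2.1 e.2.2 - c)
      + ENNReal.ofReal (2 * l * τ₁ ^ 2 * σ ^ 2) := by
  obtain ⟨x, y, z⟩ := e
  have hl : 0 < l := hμ.trans_le hμl
  have hβ0 : 0 ≤ β := by rw [hβ]; positivity
  obtain ⟨xb, hb⟩ := exists_gradAux_eq_zero hs hl z y
  simp only [smoothedUpdate]
  have hGx : ∀ ξ, Gx x y ξ + (2 * l) • (x - z) =
      gradAux f l z x y + (Gx x y ξ - gradX f x y) := fun ξ => by
    rw [gradAux]; abel
  simp only [hGx]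
  set N : Ξ → Euc m := fun ξ => Gx x y ξ - gradX f x y with hN
  set x' : Ξ → Euc m := fun ξ => x - τ₁ • (gradAux f l z x y + N ξ) with hx'
  have hGy : ∀ ξ ξ', Gy (x' ξ) y ξ' =
      gradY f (x' ξ) y + (Gy (x' ξ) y ξ' - gradY f (x' ξ) y) := fun ξ ξ' => by abel
  set A : Ξ → ℝ := fun ξ => aux f l z (x' ξ) y - 2 * dual f l z y + 2 * moreau f l z
        + 2 * τ * l ^ 2 * ‖x' ξ - xb‖ ^ 2 - τ / 2 * ‖gradY f xb y‖ ^ 2 - l * β * ‖x' ξ - z‖ ^ 2 - c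
    with hA
  -- The dual sample is integrated first, with the primal step frozen; the result is then averaged
  -- over the primal sample. Subtracting `c` keeps every integrand nonnegative, so `ENNReal.ofReal`
  -- loses nothing.
  have hinner : ∀ ξ, 0 ≤ A ξ + 7 / 2 * l * τ ^ 2 * σ ^ 2 ∧
      ∫⁻ ξ', ENNReal.ofReal (lyapunov f l (x' ξ) (y + τ • Gy (x' ξ) y ξ')
        (z + β • (x' ξ - z)) - c) ∂ν ≤ ENNReal.ofReal (A ξ + 7 / 2 * l * τ ^ 2 * σ ^ 2) := by
    intro ξ
    refine hG.lintegral_y_le (x' ξ) y (by positivity)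
      (a := (τ + 7 * l * τ ^ 2) • gradY f (x' ξ) y - (2 * τ) • gradY f xb y)
      (fun ξ' => ?_) (fun ξ' => ?_)
    · exact sub_nonneg.2 ((hc _).trans (moreau_le_lyapunov hs hp hl _ _ _))
    · have := smoothed_dual_step_le hs hp hμ hμl hb hτ hτl hβ (x' ξ)
        (Gy (x' ξ) y ξ' - gradY f (x' ξ) y)
      rw [← hGy] at this
      simp only [hA]
      linarith
  have houter := hG.lintegral_x_le x y
    (A := lyapunov f l x y z - τ / 25600 * stationarity f l μ x y - c
      + 7 / 2 * l * τ ^ 2 * σ ^ 2)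
    (b := (3 / 2 * l + (4 * τ * l ^ 2 + l * β)) * τ₁ ^ 2)
    (a := (- τ₁ * (1 - 3 * l * τ₁) + 2 * (4 * τ * l ^ 2 + l * β) * τ₁ ^ 2) • gradAux f l z x y)
    (F := fun ξ => A ξ + 7 / 2 * l * τ ^ 2 * σ ^ 2) (by positivity) (fun ξ => (hinner ξ).1)
    (fun ξ => by
      have := primal_step_le hs hμ hμl hb hτ hτ1 hτl hβ x (N ξ)
      rw [real_inner_smul_left]
      simp only [hA, hx', hN] at this ⊢
      linarith)
  have hstat : 0 ≤ τ / 25600 * stationarity f l μ x y := by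
    unfold stationarity; positivity
  have hcoef := mul_le_mul_of_nonneg_right (noise_coefficient_le hμ hμl hτ hτ1 hτl hβ)
    (sq_nonneg σ)
  have hV : 0 ≤ lyapunov f l x y z - c :=
    sub_nonneg.2 ((hc z).trans (moreau_le_lyapunov hs hp hl _ _ _))
  refine (add_le_add_left ((lintegral_mono fun ξ => (hinner ξ).2).trans houter.2) _).trans ?_
  rw [← ENNReal.ofReal_add houter.1 hstat, ← ENNReal.ofReal_add hV (by positivity)]
  refine ENNReal.ofReal_le_ofReal ?_
  linarith

/-- The expected contraction of the potential in one step of AGDA. -/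
theorem agda_expected_descent (hs : LipschitzSmooth f l) (hp : PLInY f μ)
    (hG : StochasticGradients ν f Gx Gy σ) (hμ : 0 < μ) (hμl : μ ≤ l) {τ : ℝ} (hτ : 0 ≤ τ)
    (hτl : l * τ ≤ 1 / 12) (e : Euc m × Euc n × Euc m) :
    ∫⁻ ξ, ∫⁻ ξ', ENNReal.ofReal (auxGap f l
        (agdaUpdate Gx Gy l (4 * τ) τ ((e, ξ), ξ')).1
        (agdaUpdate Gx Gy l (4 * τ) τ ((e, ξ), ξ')).2.1
        (agdaUpdate Gx Gy l (4 * τ) τ ((e, ξ), ξ')).2.2) ∂ν ∂ν ≤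
    ENNReal.ofReal (1 - μ * τ) * ENNReal.ofReal (auxGap f l e.1 e.2.1 e.2.2)
      + ENNReal.ofReal (55 / 2 * l * τ ^ 2 * σ ^ 2) := by
  obtain ⟨x, y, z⟩ := e
  have hl : 0 < l := hμ.trans_le hμl
  obtain ⟨a, ha⟩ := agda_dual_step_le hs hp hμ hμl z hτ hτl x y
  simp only [agdaUpdate]
  set y' : Ξ → Euc n := fun ξ => y + τ • Gy x y ξ with hy'
  have hGx : ∀ v ξ', Gx x v ξ' + (2 * l) • (x - z) =
      gradAux f l z x v + (Gx x v ξ' - gradX f x v) := fun v ξ' => by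
    rw [gradAux]; abel
  have hGy : ∀ ξ, Gy x y ξ = gradY f x y + (Gy x y ξ - gradY f x y) := fun ξ => by abel
  simp only [hGx]
  set A : Ξ → ℝ := fun ξ => (1 - 4 * l * τ) * (aux f l z x (y' ξ) - dual f l z (y' ξ))
    + 2 * (moreau f l z - dual f l z (y' ξ)) with hA
  -- AGDA updates y first, so the inner integration is over the primal sample. The noise constants
  -- add up to 24 + 7/2 = 55/2.
  have hinner : ∀ ξ, 0 ≤ A ξ + 24 * l * τ ^ 2 * σ ^ 2 ∧
      ∫⁻ ξ', ENNReal.ofReal (auxGap f l (x - (4 * τ) • (gradAux f l z x (y' ξ)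
        + (Gx x (y' ξ) ξ' - gradX f x (y' ξ)))) (y' ξ) z) ∂ν ≤
        ENNReal.ofReal (A ξ + 24 * l * τ ^ 2 * σ ^ 2) := by
    intro ξ
    refine hG.lintegral_x_le x (y' ξ) (by positivity)
      (a := (- (4 * τ * (1 - 12 * l * τ))) • gradAux f l z x (y' ξ))
      (fun ξ' => auxGap_nonneg hs hp hl _ _ _) (fun ξ' => ?_)
    have := agda_primal_step_le hs hl z hτ hτl x (y' ξ) (Gx x (y' ξ) ξ' - gradX f x (y' ξ))
    rw [real_inner_smul_left]
    simp only [hA]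
    linarith
  have houter := hG.lintegral_y_le x y
    (A := (1 - μ * τ) * auxGap f l x y z + 24 * l * τ ^ 2 * σ ^ 2)
    (b := 7 / 2 * l * τ ^ 2) (a := a)
    (F := fun ξ => A ξ + 24 * l * τ ^ 2 * σ ^ 2) (by positivity) (fun ξ => (hinner ξ).1)
    (fun ξ => by
      have := ha (Gy x y ξ - gradY f x y)
      rw [← hGy] at this
      simp only [hA, hy']
      linarith)
  have hV : 0 ≤ auxGap f l x y z := auxGap_nonneg hs hp hl _ _ _
  have hr : 0 ≤ 1 - μ * τ := by nlinarith
  refine ((lintegral_mono fun ξ => (hinner ξ).2).trans houter.2).trans ?_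
  rw [← ENNReal.ofReal_mul hr, ← ENNReal.ofReal_add (by positivity) (by positivity)]
  refine ENNReal.ofReal_le_ofReal ?_
  linarith

end Expected

/-! ### Measurability of the potentials and adaptedness of the iterates. -/

section Measurability

variable {m n : ℕ} {f : Euc m → Euc n → ℝ} {l μ σ : ℝ}

/-- An infimum of continuous functions is upper semicontinuous, hence measurable even over an
uncountable index set. -/
theorem measurable_dual (hs : LipschitzSmooth f l) (hl : 0 < l) :
    Measurable fun q : Euc m × Euc n => dual f l q.1 q.2 := by
  refine UpperSemicontinuous.measurable (upperSemicontinuous_ciInf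
    (fun q => bddBelow_aux hs hl q.1 q.2) fun x => Continuous.upperSemicontinuous ?_)
  have : Continuous fun q : Euc m × Euc n => f x q.2 :=
    hs.continuous.comp (continuous_const.prodMk continuous_snd)
  exact this.add (by fun_prop)

theorem measurable_moreau (hs : LipschitzSmooth f l) (hp : PLInY f μ) (hl : 0 < l) (hμ : 0 < μ) :
    Measurable fun z : Euc m => moreau f l z := by
  refine UpperSemicontinuous.measurable (upperSemicontinuous_ciInf
    (fun z => ⟨moreau f l z, ?_⟩) fun x => Continuous.upperSemicontinuous (by fun_prop))
  rintro _ ⟨x, rfl⟩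
  exact moreau_le hs hp hl hμ z x

theorem measurable_aux (hs : LipschitzSmooth f l) :
    Measurable fun e : Euc m × Euc n × Euc m => aux f l e.2.2 e.1 e.2.1 := by
  have : Continuous fun e : Euc m × Euc n × Euc m => f e.1 e.2.1 :=
    hs.continuous.comp (continuous_fst.prodMk (continuous_fst.comp continuous_snd))
  exact (this.add (by fun_prop : Continuous fun e : Euc m × Euc n × Euc m =>
    l * ‖e.1 - e.2.2‖ ^ 2)).measurable

theorem measurable_lyapunov (hs : LipschitzSmooth f l) (hp : PLInY f μ) (hl : 0 < l)
    (hμ : 0 < μ) :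
    Measurable fun e : Euc m × Euc n × Euc m => lyapunov f l e.1 e.2.1 e.2.2 := by
  have h1 : Measurable fun e : Euc m × Euc n × Euc m => dual f l e.2.2 e.2.1 :=
    (measurable_dual hs hl).comp (by fun_prop : Measurable fun e : Euc m × Euc n × Euc m =>
      (e.2.2, e.2.1))
  have h2 : Measurable fun e : Euc m × Euc n × Euc m => moreau f l e.2.2 :=
    (measurable_moreau hs hp hl hμ).comp (by fun_prop)
  exact ((measurable_aux hs).sub (h1.const_mul 2)).add (h2.const_mul 2)

theorem measurable_auxGap (hs : LipschitzSmooth f l) (hp : PLInY f μ) (hl : 0 < l)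
    (hμ : 0 < μ) :
    Measurable fun e : Euc m × Euc n × Euc m => auxGap f l e.1 e.2.1 e.2.2 := by
  have h1 : Measurable fun e : Euc m × Euc n × Euc m => dual f l e.2.2 e.2.1 :=
    (measurable_dual hs hl).comp (by fun_prop : Measurable fun e : Euc m × Euc n × Euc m =>
      (e.2.2, e.2.1))
  have h2 : Measurable fun e : Euc m × Euc n × Euc m => moreau f l e.2.2 :=
    (measurable_moreau hs hp hl hμ).comp (by fun_prop)
  exact ((measurable_aux hs).sub (h1.const_mul 3)).add (h2.const_mul 2)

theorem measurable_stationarity (hs : LipschitzSmooth f l) :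
    Measurable fun e : Euc m × Euc n × Euc m => stationarity f l μ e.1 e.2.1 := by
  have hc : Continuous fun e : Euc m × Euc n × Euc m => (e.1, e.2.1) := by fun_prop
  have h1 := hs.continuous_gradX.comp hc
  have h2 := hs.continuous_gradY.comp hc
  exact ((h1.norm.pow 2).const_smul (μ / l) |>.add (h2.norm.pow 2)).measurable

variable {Ξ : Type*} [MeasurableSpace Ξ] {ν : Measure Ξ} {Gx : Euc m → Euc n → Ξ → Euc m}
  {Gy : Euc m → Euc n → Ξ → Euc n}

theorem StochasticGradients.measurable_smoothedUpdate (hG : StochasticGradients ν f Gx Gy σ)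
    (τ₁ τ₂ p β : ℝ) : Measurable (smoothedUpdate Gx Gy τ₁ τ₂ p β) := by
  have hx : Measurable fun q : ((Euc m × Euc n × Euc m) × Ξ) × Ξ => q.1.1.1 := by fun_prop
  have hy : Measurable fun q : ((Euc m × Euc n × Euc m) × Ξ) × Ξ => q.1.1.2.1 := by fun_prop
  have hz : Measurable fun q : ((Euc m × Euc n × Euc m) × Ξ) × Ξ => q.1.1.2.2 := by fun_prop
  have hξ : Measurable fun q : ((Euc m × Euc n × Euc m) × Ξ) × Ξ => q.1.2 := by fun_prop
  have h1 := hG.measurable_x.comp ((hx.prodMk hy).prodMk hξ)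
  have h2 := hx.sub ((h1.add ((hx.sub hz).const_smul p)).const_smul τ₁)
  have h3 := hG.measurable_y.comp ((h2.prodMk hy).prodMk measurable_snd)
  exact h2.prodMk ((hy.add (h3.const_smul τ₂)).prodMk (hz.add ((h2.sub hz).const_smul β)))

theorem StochasticGradients.measurable_agdaUpdate (hG : StochasticGradients ν f Gx Gy σ)
    (l η₁ η₂ : ℝ) : Measurable (agdaUpdate Gx Gy l η₁ η₂) := by
  have hx : Measurable fun q : ((Euc m × Euc n × Euc m) × Ξ) × Ξ => q.1.1.1 := by fun_prop
  have hy : Measurable fun q : ((Euc m × Euc n × Euc m) × Ξ) × Ξ => q.1.1.2.1 := by fun_prop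
  have hz : Measurable fun q : ((Euc m × Euc n × Euc m) × Ξ) × Ξ => q.1.1.2.2 := by fun_prop
  have hξ : Measurable fun q : ((Euc m × Euc n × Euc m) × Ξ) × Ξ => q.1.2 := by fun_prop
  have h1 := hG.measurable_y.comp ((hx.prodMk hy).prodMk hξ)
  have h2 := hy.add (h1.const_smul η₂)
  have h3 := hG.measurable_x.comp ((hx.prodMk h2).prodMk measurable_snd)
  exact (hx.sub ((h3.add ((hx.sub hz).const_smul (2 * l))).const_smul η₁)).prodMk (h2.prodMk hz)

theorem smoothedIterate_succ_eq {X Y Ξ : Type*} [AddCommGroup X] [Module ℝ X] [AddCommGroup Y]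
    [Module ℝ Y] (Gx : X → Y → Ξ → X) (Gy : X → Y → Ξ → Y) (τ₁ τ₂ p β : ℝ)
    (x₀ : X) (y₀ : Y) (z₀ : X) (t : ℕ) :
    smoothedIterate Gx Gy τ₁ τ₂ p β x₀ y₀ z₀ (t + 1) = fun s =>
      smoothedUpdate Gx Gy τ₁ τ₂ p β
        ((smoothedIterate Gx Gy τ₁ τ₂ p β x₀ y₀ z₀ t s, s (2 * t)), s (2 * t + 1)) :=
  funext fun _ => smoothedIterate_succ ..

theorem agdaIterate_succ_eq {X Y Ξ : Type*} [AddCommGroup X] [Module ℝ X] [AddCommGroup Y]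
    [Module ℝ Y] (Gx : X → Y → Ξ → X) (Gy : X → Y → Ξ → Y) (l τ₁ τ₂ β : ℝ)
    (x₀ : X) (y₀ : Y) (z₀ : X) (T : ℕ) (η₁ η₂ : ℝ) (t k : ℕ) :
    agdaIterate Gx Gy l τ₁ τ₂ β x₀ y₀ z₀ T η₁ η₂ t (k + 1) = fun s =>
      agdaUpdate Gx Gy l η₁ η₂ ((agdaIterate Gx Gy l τ₁ τ₂ β x₀ y₀ z₀ T η₁ η₂ t k s,
        s (2 * T + 2 * k)), s (2 * T + 2 * k + 1)) :=
  funext fun _ => agdaIterate_succ ..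

theorem StochasticGradients.measurable_smoothedIterate (hG : StochasticGradients ν f Gx Gy σ)
    (τ₁ τ₂ p β : ℝ) (x₀ : Euc m) (y₀ : Euc n) (z₀ : Euc m) (t : ℕ) :
    Measurable (smoothedIterate Gx Gy τ₁ τ₂ p β x₀ y₀ z₀ t) := by
  induction t with
  | zero => exact measurable_const (a := (x₀, y₀, z₀))
  | succ t ih =>
    rw [smoothedIterate_succ_eq]
    exact measurable_fresh_step ih (hG.measurable_smoothedUpdate τ₁ τ₂ p β)

theorem StochasticGradients.measurable_agdaIterate (hG : StochasticGradients ν f Gx Gy σ)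
    (l τ₁ τ₂ β : ℝ) (x₀ : Euc m) (y₀ : Euc n) (z₀ : Euc m) (T : ℕ) (η₁ η₂ : ℝ) (t k : ℕ) :
    Measurable (agdaIterate Gx Gy l τ₁ τ₂ β x₀ y₀ z₀ T η₁ η₂ t k) := by
  induction k with
  | zero =>
    have h := hG.measurable_smoothedIterate τ₁ τ₂ (2 * l) β x₀ y₀ z₀ t
    exact h.fst.prodMk (h.snd.fst.prodMk h.fst)
  | succ k ih =>
    rw [agdaIterate_succ_eq]
    exact measurable_fresh_step ih (hG.measurable_agdaUpdate l η₁ η₂)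

theorem dependsOn_smoothedIterate {X Y Ξ : Type*} [AddCommGroup X] [Module ℝ X] [AddCommGroup Y]
    [Module ℝ Y] (Gx : X → Y → Ξ → X) (Gy : X → Y → Ξ → Y) (τ₁ τ₂ p β : ℝ)
    (x₀ : X) (y₀ : Y) (z₀ : X) (t : ℕ) :
    DependsOn (smoothedIterate Gx Gy τ₁ τ₂ p β x₀ y₀ z₀ t) (Set.Iio (2 * t)) := by
  induction t with
  | zero => exact fun _ _ _ => rfl
  | succ t ih =>
    rw [smoothedIterate_succ_eq]
    exact dependsOn_fresh_step ih (smoothedUpdate Gx Gy τ₁ τ₂ p β)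

theorem dependsOn_agdaIterate {X Y Ξ : Type*} [AddCommGroup X] [Module ℝ X] [AddCommGroup Y]
    [Module ℝ Y] (Gx : X → Y → Ξ → X) (Gy : X → Y → Ξ → Y) (l τ₁ τ₂ β : ℝ)
    (x₀ : X) (y₀ : Y) (z₀ : X) {T : ℕ} (η₁ η₂ : ℝ) {t : ℕ} (ht : t ≤ T) (k : ℕ) :
    DependsOn (agdaIterate Gx Gy l τ₁ τ₂ β x₀ y₀ z₀ T η₁ η₂ t k)
      (Set.Iio (2 * T + 2 * k)) := by
  induction k with
  | zero =>
    intro r r' h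
    have := dependsOn_smoothedIterate Gx Gy τ₁ τ₂ (2 * l) β x₀ y₀ z₀ t (x := r) (y := r')
      fun i hi => h i (by simp only [Set.mem_Iio] at hi ⊢; omega)
    rw [agdaIterate_zero, agdaIterate_zero, this]
  | succ k ih =>
    rw [agdaIterate_succ_eq]
    exact dependsOn_fresh_step ih (agdaUpdate Gx Gy l η₁ η₂)

end Measurability

/-! ### Expected bounds along the trajectories. -/

section Expectation

variable {m n : ℕ} {f : Euc m → Euc n → ℝ} {l μ σ : ℝ} {Ξ Ω : Type*} [MeasurableSpace Ξ]
  [MeasurableSpace Ω] {ν : Measure Ξ} [IsProbabilityMeasure ν] {P : Measure Ω}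
  [IsProbabilityMeasure P] {Gx : Euc m → Euc n → Ξ → Euc m} {Gy : Euc m → Euc n → Ξ → Euc n}
  {s : ℕ → Ω → Ξ}

/-- The expected stationarity measure accumulated along Smoothed-AGDA. -/
theorem sum_lintegral_stationarity_le (hs : LipschitzSmooth f l) (hp : PLInY f μ)
    (hG : StochasticGradients ν f Gx Gy σ) (hsm : ∀ k, Measurable (s k))
    (hlaw : ∀ k, P.map (s k) = ν) (hind : iIndepFun s P)
    (hμ : 0 < μ) (hμl : μ ≤ l) {τ₁ τ β c : ℝ} (hτ : 0 ≤ τ)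
    (hτ1 : τ₁ = 48 * τ) (hτl : l * τ ≤ 1 / 144) (hβ : β = τ * μ / 1600)
    (hc : ∀ z, c ≤ moreau f l z) (x₀ : Euc m) (y₀ : Euc n) (z₀ : Euc m) (T : ℕ) :
    ∑ t ∈ Finset.range T, ∫⁻ ω, ENNReal.ofReal (τ / 25600 * stationarity f l μ
        (smoothedIterate Gx Gy τ₁ τ (2 * l) β x₀ y₀ z₀ t fun k => s k ω).1
        (smoothedIterate Gx Gy τ₁ τ (2 * l) β x₀ y₀ z₀ t fun k => s k ω).2.1) ∂P ≤
      ENNReal.ofReal (lyapunov f l x₀ y₀ z₀ - c)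
        + T * ENNReal.ofReal (2 * l * τ₁ ^ 2 * σ ^ 2) := by
  have hl : 0 < l := hμ.trans_le hμl
  have hV : Measurable fun e : Euc m × Euc n × Euc m =>
      ENNReal.ofReal (lyapunov f l e.1 e.2.1 e.2.2 - c) :=
    ((measurable_lyapunov hs hp hl hμ).sub_const c).ennreal_ofReal
  have hD : Measurable fun e : Euc m × Euc n × Euc m =>
      ENNReal.ofReal (τ / 25600 * stationarity f l μ e.1 e.2.1) :=
    ((measurable_stationarity hs).const_mul _).ennreal_ofReal
  have hS : Measurable fun ω k => s k ω := measurable_pi_lambda _ hsm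
  set φ := smoothedIterate Gx Gy τ₁ τ (2 * l) β x₀ y₀ z₀ with hφ
  have hφm : ∀ t, Measurable (φ t) := fun t => hG.measurable_smoothedIterate ..
  have hstep : ∀ t,
      ∫⁻ ω, ENNReal.ofReal (lyapunov f l (φ (t + 1) fun k => s k ω).1
          (φ (t + 1) fun k => s k ω).2.1 (φ (t + 1) fun k => s k ω).2.2 - c) ∂P
        + ∫⁻ ω, ENNReal.ofReal (τ / 25600 * stationarity f l μ (φ t fun k => s k ω).1
          (φ t fun k => s k ω).2.1) ∂P ≤
      ∫⁻ ω, ENNReal.ofReal (lyapunov f l (φ t fun k => s k ω).1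
          (φ t fun k => s k ω).2.1 (φ t fun k => s k ω).2.2 - c) ∂P
        + ENNReal.ofReal (2 * l * τ₁ ^ 2 * σ ^ 2) := by
    intro t
    have h1 := lintegral_fresh_pair hsm hlaw hind (hφm t)
      (dependsOn_smoothedIterate Gx Gy τ₁ τ (2 * l) β x₀ y₀ z₀ t)
      (hV.comp (hG.measurable_smoothedUpdate τ₁ τ (2 * l) β))
    have hsucc : ∀ ω, φ (t + 1) (fun k => s k ω) = smoothedUpdate Gx Gy τ₁ τ (2 * l) β
        ((φ t (fun k => s k ω), s (2 * t) ω), s (2 * t + 1) ω) := fun ω =>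
      smoothedIterate_succ ..
    simp only [Function.comp] at h1
    simp only [hsucc]
    have hDm : Measurable fun ω => ENNReal.ofReal (τ / 25600 * stationarity f l μ
        (φ t fun k => s k ω).1 (φ t fun k => s k ω).2.1) := hD.comp ((hφm t).comp hS)
    rw [h1, ← lintegral_add_right _ hDm]
    calc _ ≤ ∫⁻ ω, (ENNReal.ofReal (lyapunov f l (φ t fun k => s k ω).1
          (φ t fun k => s k ω).2.1 (φ t fun k => s k ω).2.2 - c)
            + ENNReal.ofReal (2 * l * τ₁ ^ 2 * σ ^ 2)) ∂P :=
          lintegral_mono fun ω => smoothed_expected_descent hs hp hG hμ hμl hτ hτ1 hτl hβ hc _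
      _ = _ := by
          rw [lintegral_add_right _ measurable_const, lintegral_const, measure_univ, mul_one]
  have h2 := sum_add_le_of_step_le hstep T
  refine le_trans (le_add_self) (h2.trans (le_of_eq ?_))
  congr 1
  change ∫⁻ _, ENNReal.ofReal (lyapunov f l x₀ y₀ z₀ - c) ∂P = _
  rw [lintegral_const, measure_univ, mul_one]

/-- The expected potential along AGDA in the second stage. -/
theorem lintegral_auxGap_le (hs : LipschitzSmooth f l) (hp : PLInY f μ)
    (hG : StochasticGradients ν f Gx Gy σ) (hsm : ∀ k, Measurable (s k))
    (hlaw : ∀ k, P.map (s k) = ν) (hind : iIndepFun s P)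
    (hμ : 0 < μ) (hμl : μ ≤ l) {τ : ℝ} (hτ : 0 < τ) (hτl : l * τ ≤ 1 / 12) (τ₁ τ₂ β : ℝ)
    (x₀ : Euc m) (y₀ : Euc n) (z₀ : Euc m) {T t : ℕ} (ht : t ≤ T) (K : ℕ) :
    ∫⁻ ω, ENNReal.ofReal (auxGap f l
        (agdaIterate Gx Gy l τ₁ τ₂ β x₀ y₀ z₀ T (4 * τ) τ t K fun k => s k ω).1
        (agdaIterate Gx Gy l τ₁ τ₂ β x₀ y₀ z₀ T (4 * τ) τ t K fun k => s k ω).2.1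
        (agdaIterate Gx Gy l τ₁ τ₂ β x₀ y₀ z₀ T (4 * τ) τ t K fun k => s k ω).2.2) ∂P ≤
      ENNReal.ofReal ((1 - μ * τ) ^ K) * ∫⁻ ω, ENNReal.ofReal (auxGap f l
        (smoothedIterate Gx Gy τ₁ τ₂ (2 * l) β x₀ y₀ z₀ t fun k => s k ω).1
        (smoothedIterate Gx Gy τ₁ τ₂ (2 * l) β x₀ y₀ z₀ t fun k => s k ω).2.1
        (smoothedIterate Gx Gy τ₁ τ₂ (2 * l) β x₀ y₀ z₀ t fun k => s k ω).1) ∂P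
      + ENNReal.ofReal (55 / 2 * (l / μ) * τ * σ ^ 2) := by
  have hl : 0 < l := hμ.trans_le hμl
  have hV : Measurable fun e : Euc m × Euc n × Euc m =>
      ENNReal.ofReal (auxGap f l e.1 e.2.1 e.2.2) :=
    (measurable_auxGap hs hp hl hμ).ennreal_ofReal
  have hS : Measurable fun ω k => s k ω := measurable_pi_lambda _ hsm
  set ψ := agdaIterate Gx Gy l τ₁ τ₂ β x₀ y₀ z₀ T (4 * τ) τ t with hψ
  have hψm : ∀ k, Measurable (ψ k) := fun k => hG.measurable_agdaIterate ..
  have hr0 : 0 ≤ 1 - μ * τ := by nlinarith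
  have hr1 : 1 - μ * τ < 1 := by have := mul_pos hμ hτ; linarith
  have hstep : ∀ k,
      ∫⁻ ω, ENNReal.ofReal (auxGap f l (ψ (k + 1) fun k => s k ω).1
          (ψ (k + 1) fun k => s k ω).2.1 (ψ (k + 1) fun k => s k ω).2.2) ∂P ≤
      ENNReal.ofReal (1 - μ * τ) * ∫⁻ ω, ENNReal.ofReal (auxGap f l (ψ k fun k => s k ω).1
          (ψ k fun k => s k ω).2.1 (ψ k fun k => s k ω).2.2) ∂P
        + ENNReal.ofReal (55 / 2 * l * τ ^ 2 * σ ^ 2) := by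
    intro k
    have h1 := lintegral_fresh_pair hsm hlaw hind (hψm k)
      (dependsOn_agdaIterate Gx Gy l τ₁ τ₂ β x₀ y₀ z₀ (4 * τ) τ ht k)
      (hV.comp (hG.measurable_agdaUpdate l (4 * τ) τ))
    have hsucc : ∀ ω, ψ (k + 1) (fun k => s k ω) = agdaUpdate Gx Gy l (4 * τ) τ
        ((ψ k (fun k => s k ω), s (2 * T + 2 * k) ω), s (2 * T + 2 * k + 1) ω) := fun ω =>
      agdaIterate_succ ..
    simp only [Function.comp] at h1
    simp only [hsucc]
    have hVm : Measurable fun ω => ENNReal.ofReal (auxGap f l (ψ k fun k => s k ω).1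
        (ψ k fun k => s k ω).2.1 (ψ k fun k => s k ω).2.2) := hV.comp ((hψm k).comp hS)
    rw [h1, ← lintegral_const_mul _ hVm]
    calc _ ≤ ∫⁻ ω, (ENNReal.ofReal (1 - μ * τ) * ENNReal.ofReal (auxGap f l
          (ψ k fun k => s k ω).1 (ψ k fun k => s k ω).2.1 (ψ k fun k => s k ω).2.2)
            + ENNReal.ofReal (55 / 2 * l * τ ^ 2 * σ ^ 2)) ∂P :=
          lintegral_mono fun ω => agda_expected_descent hs hp hG hμ hμl hτ.le hτl _
      _ = _ := by
          rw [lintegral_add_right _ measurable_const, lintegral_const, measure_univ, mul_one]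
  have h2 := le_pow_mul_add_of_contraction hr0 hr1 (by positivity) hstep K
  -- The noise floor of the contraction: one-step noise divided by μτ.
  have h3 : 55 / 2 * l * τ ^ 2 * σ ^ 2 / (1 - (1 - μ * τ)) = 55 / 2 * (l / μ) * τ * σ ^ 2 := by
    rw [sub_sub_cancel]
    field_simp
  rw [h3] at h2
  exact h2

end Expectation

/-! ### Choice of iteration counts and step sizes. -/

section Parameters

theorem one_sub_pow_mul_sq_le_one {κ a : ℝ} (hκ : 1 ≤ κ) (ha : 0 < a) (ha1 : a ≤ 1) {K : ℕ}
    (hK : 2 * Real.log κ / a ≤ K) : (1 - a) ^ K * κ ^ 2 ≤ 1 := by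
  have hκ0 : 0 < κ := by linarith
  rw [div_le_iff₀ ha] at hK
  have h1 : (1 - a) ^ K ≤ Real.exp (-a) ^ K :=
    pow_le_pow_left₀ (by linarith) (by linarith [Real.add_one_le_exp (-a)]) K
  have h2 : κ ^ 2 = Real.exp (2 * Real.log κ) := by
    rw [mul_comm, Real.exp_mul, Real.exp_log hκ0]; norm_cast
  calc (1 - a) ^ K * κ ^ 2 ≤ Real.exp (-a) ^ K * Real.exp (2 * Real.log κ) := by
        rw [h2]; gcongr
    _ = Real.exp (-(K * a) + 2 * Real.log κ) := by
        rw [← Real.exp_nat_mul, ← Real.exp_add]; ring_nf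
    _ ≤ 1 := Real.exp_le_one_iff.2 (by linarith)

theorem one_div_min_le {a b : ℝ} (ha : 0 < a) (hb : 0 < b) : 1 / min a b ≤ 1 / a + 1 / b := by
  have h1 : 0 < 1 / a := by positivity
  have h2 : 0 < 1 / b := by positivity
  rcases min_choice a b with h | h <;> rw [h] <;> linarith

theorem tauX_eq (l σ Δ : ℝ) (T : ℕ) : tauX l σ Δ T = 48 * tauY l σ Δ T := by
  rw [tauX, tauY, mul_min_of_nonneg _ _ (by norm_num)]
  congr 1
  · rw [show 96 * σ * √(T * l) = 48 * (2 * σ * √(T * l)) by ring]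
    field_simp
  · rw [show 144 * l = 48 * (3 * l) by ring]
    field_simp

theorem tauY_pos {l σ Δ : ℝ} {T : ℕ} (hl : 0 < l) (hσ : 0 < σ) (hΔ : 0 < Δ) (hT : 0 < T) :
    0 < tauY l σ Δ T := by
  unfold tauY
  positivity

theorem mul_tauY_le {l σ Δ : ℝ} {T : ℕ} (hl : 0 < l) : l * tauY l σ Δ T ≤ 1 / 144 :=
  calc l * tauY l σ Δ T ≤ l * (1 / (144 * l)) :=
        mul_le_mul_of_nonneg_left (min_le_right _ _) hl.le
    _ = 1 / 144 := by field_simp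

/-- The accumulated stationarity bound of stochastic Smoothed-AGDA, with the prescribed
step sizes and sufficiently many iterations, is of order `ε²` on average. -/
theorem stochastic_budget_le {l κ σ Δ B ε : ℝ} (hl : 0 < l) (hκ : 1 ≤ κ) (hσ : 0 < σ)
    (hΔ : 0 < Δ) (hB : 0 ≤ B) (hε : 0 < ε) {T : ℕ} (hT : 0 < T)
    (hT1 : (1 + B) ^ 2 * (l * κ * Δ / ε ^ 2 + l * κ ^ 2 * Δ * σ ^ 2 / ε ^ 4) ≤ T) :
    1 / (T : ℝ) * (κ * (25600 / tauY l σ Δ T *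
      ((1 + B) * Δ + T * (2 * l * tauX l σ Δ T ^ 2 * σ ^ 2)))) ≤ 7372800 * ε ^ 2 := by
  have hT0 : (0 : ℝ) < T := by exact_mod_cast hT
  have hτ := tauY_pos hl hσ hΔ hT
  have hx := tauX_eq l σ Δ T
  have hx0 : 0 < tauX l σ Δ T := by rw [hx]; positivity
  set d := √Δ with hd
  set s := √(T * l) with hs
  have hd0 : 0 < d := Real.sqrt_pos.2 hΔ
  have hs0 : 0 < s := Real.sqrt_pos.2 (by positivity)
  have hd2 : d ^ 2 = Δ := Real.sq_sqrt hΔ.le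
  have hs2 : s ^ 2 = T * l := Real.sq_sqrt (by positivity)
  have hinv : 1 / tauX l σ Δ T ≤ 2 * σ * s / d + 3 * l := by
    have := one_div_min_le (a := d / (2 * σ * s)) (b := 1 / (3 * l)) (by positivity)
      (by positivity)
    rw [one_div_div, one_div_one_div] at this
    exact this
  have hle : tauX l σ Δ T ≤ d / (2 * σ * s) := min_le_left _ _
  -- Since sd/T = √(lΔ/T), the noise-limited branch of the step size balances accumulated noise and
  -- initial gap at the common order σ√(lΔ/T).
  have h1 : 2 * l * tauX l σ Δ T * σ ^ 2 ≤ σ * s * d / T := by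
    calc 2 * l * tauX l σ Δ T * σ ^ 2 ≤ 2 * l * (d / (2 * σ * s)) * σ ^ 2 := by gcongr
      _ = σ * s * d / T := by
        field_simp
        rw [hs2]; ring
  have h2 : Δ / T * (1 / tauX l σ Δ T) ≤ 2 * (σ * s * d / T) + 3 * (l * Δ / T) := by
    calc Δ / T * (1 / tauX l σ Δ T) ≤ Δ / T * (2 * σ * s / d + 3 * l) := by gcongr
      _ = 2 * (σ * s * d / T) + 3 * (l * Δ / T) := by
        rw [← hd2]; field_simp
  have hB2 : (1 + B) ≤ (1 + B) ^ 2 := by nlinarith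
  -- Squaring removes the roots: this is where T needs (1 + B)² and the term with σ²/ε⁴.
  have h3 : κ * (1 + B) * (σ * s * d / T) ≤ ε ^ 2 := by
    refine le_of_sq_le_sq ?_ (by positivity)
    have h4 : (1 + B) ^ 2 * (l * κ ^ 2 * Δ * σ ^ 2 / ε ^ 4) ≤ T :=
      le_trans (by gcongr; exact le_add_of_nonneg_left (by positivity)) hT1
    calc (κ * (1 + B) * (σ * s * d / T)) ^ 2
        = κ ^ 2 * (1 + B) ^ 2 * σ ^ 2 * s ^ 2 * d ^ 2 / T ^ 2 := by ring
      _ = ((1 + B) ^ 2 * (l * κ ^ 2 * Δ * σ ^ 2 / ε ^ 4)) * ε ^ 4 / T := by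
        rw [hs2, hd2]; field_simp
      _ ≤ T * ε ^ 4 / T := by gcongr
      _ = (ε ^ 2) ^ 2 := by field_simp
  have h5 : κ * (1 + B) * (l * Δ / T) ≤ ε ^ 2 := by
    have h4 : (1 + B) * (l * κ * Δ / ε ^ 2) ≤ T := by
      refine le_trans ?_ hT1
      have : 0 ≤ l * κ ^ 2 * Δ * σ ^ 2 / ε ^ 4 := by positivity
      have h6 : 0 ≤ l * κ * Δ / ε ^ 2 := by positivity
      exact mul_le_mul hB2 (by linarith) h6 (by positivity)
    calc κ * (1 + B) * (l * Δ / T) = ((1 + B) * (l * κ * Δ / ε ^ 2)) * ε ^ 2 / T := by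
          field_simp
      _ ≤ T * ε ^ 2 / T := by gcongr
      _ = ε ^ 2 := by field_simp
  have h6 : κ * (σ * s * d / T) ≤ κ * (1 + B) * (σ * s * d / T) := by
    have : 0 ≤ κ * B * (σ * s * d / T) := by positivity
    linarith
  calc _ = 1228800 * (κ * (1 + B) * (Δ / T * (1 / tauX l σ Δ T))
        + κ * (2 * l * tauX l σ Δ T * σ ^ 2)) := by
        have e1 : tauY l σ Δ T = tauX l σ Δ T / 48 := by rw [hx]; ring
        rw [e1]; field_simp; ring
    _ ≤ 1228800 * (κ * (1 + B) * (2 * (σ * s * d / T) + 3 * (l * Δ / T))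
        + κ * (σ * s * d / T)) := by gcongr
    _ ≤ 7372800 * ε ^ 2 := by nlinarith

end Parameters

/-! ### Initial value and lower bound of the potential. -/

section Initial

variable {m n : ℕ} {f : Euc m → Euc n → ℝ} {l μ Δ B : ℝ} {x₀ z₀ : Euc m} {y₀ : Euc n} {Φlow : ℝ}

theorem Setting.le_moreau (h : Setting f l μ Δ B x₀ y₀ z₀ Φlow) (hl : 0 < l) (z : Euc m) :
    Φlow ≤ moreau f l z := by
  refine le_ciInf fun x => ?_
  have h1 := h.lower x
  have h2 : 0 ≤ l * ‖x - z‖ ^ 2 := by positivity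
  linarith

theorem Setting.lyapunov_sub_le (h : Setting f l μ Δ B x₀ y₀ z₀ Φlow) (hl : 0 < l)
    (hμ : 0 < μ) : lyapunov f l x₀ y₀ z₀ - Φlow ≤ (1 + B) * Δ := by
  have hle : ∀ y, aux f l z₀ x₀ y ≤ primal f x₀ + l * ‖x₀ - z₀‖ ^ 2 := fun y =>
    add_le_add_left (h.pl.le_primal x₀ y) _
  have hbdd : BddAbove (Set.range fun y => aux f l z₀ x₀ y) :=
    ⟨_, by rintro _ ⟨y, rfl⟩; exact hle y⟩
  have h1 : ∀ y, aux f l z₀ x₀ y ≤ ⨆ y, aux f l z₀ x₀ y := fun y => le_ciSup hbdd y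
  obtain ⟨ym, hym⟩ := h.pl.exists_eq x₀
  have h2 := h1 ym
  -- Of the two copies of `moreau`, one is bounded through x₀ by the supremum in the gap, the other
  -- through z₀ by Φ(z₀). So V is at most twice the gap plus Φ(z₀).
  have h3 := moreau_le h.smooth h.pl hl hμ z₀ x₀
  have h4 := moreau_le h.smooth h.pl hl hμ z₀ z₀
  have h5 := h1 y₀
  have h6 := h.init
  have h7 := h.delta
  simp only [sub_self, norm_zero] at h4
  have h8 : gap (aux f l z₀) x₀ y₀ = (⨆ y, aux f l z₀ x₀ y) - dual f l z₀ y₀ := rfl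
  rw [h8] at h6
  set S := ⨆ y, aux f l z₀ x₀ y
  simp only [aux, hym] at h2
  unfold lyapunov
  linarith

end Initial

/-! ### `stationarity` versus stationary points. -/

section Output

variable {m n : ℕ} {f : Euc m → Euc n → ℝ} {l μ : ℝ}

theorem div_mul_stationarity (hμ : 0 < μ) (hl : 0 < l) (x : Euc m) (y : Euc n) :
    l / μ * stationarity f l μ x y = ‖gradX f x y‖ ^ 2 + l / μ * ‖gradY f x y‖ ^ 2 := by
  unfold stationarity
  field_simp

theorem isStationary_of_le {ε : ℝ} (hμ : 0 < μ) (hl : 0 < l) (hε : 0 < ε) {x : Euc m}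
    {y : Euc n} (h : l / μ * stationarity f l μ x y ≤ ε ^ 2) :
    IsStationary f ε (ε / √(l / μ)) x y := by
  rw [div_mul_stationarity hμ hl] at h
  have hκ : 0 < l / μ := by positivity
  have h1 : 0 ≤ ‖gradX f x y‖ ^ 2 := sq_nonneg _
  have h2 : 0 ≤ l / μ * ‖gradY f x y‖ ^ 2 := by positivity
  refine ⟨le_of_sq_le_sq (by linarith) hε.le, le_of_sq_le_sq ?_ (by positivity)⟩
  rw [div_pow, Real.sq_sqrt hκ.le, le_div_iff₀ hκ]
  linarith

theorem IsStationary.stationarity_le {ε : ℝ} (hμ : 0 < μ) (hl : 0 < l) {x : Euc m}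
    {y : Euc n} (h : IsStationary f ε (ε / √(l / μ)) x y) :
    l / μ * stationarity f l μ x y ≤ 2 * ε ^ 2 := by
  have hκ : 0 < l / μ := by positivity
  rw [div_mul_stationarity hμ hl]
  have h1 := pow_le_pow_left₀ (norm_nonneg _) h.1 2
  have h2 := pow_le_pow_left₀ (norm_nonneg _) h.2 2
  rw [div_pow, Real.sq_sqrt hκ.le, le_div_iff₀ hκ] at h2
  linarith

end Output

/-! ### Deterministic guarantees for both stages. -/

section Deterministic

variable {m n : ℕ} {f : Euc m → Euc n → ℝ} {l μ Δ B : ℝ} {x₀ z₀ : Euc m} {y₀ : Euc n} {Φlow : ℝ}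

theorem sum_stationarity_exactSmoothed_le (h : Setting f l μ Δ B x₀ y₀ z₀ Φlow) (hμ : 0 < μ)
    (hμl : μ ≤ l) (T : ℕ) :
    ∑ t ∈ Finset.range T, l / μ * stationarity f l μ (exactSmoothed f l μ x₀ y₀ z₀ t).x
      (exactSmoothed f l μ x₀ y₀ z₀ t).y ≤ 3686400 * ((1 + B) * (l * (l / μ) * Δ)) := by
  have hl : 0 < l := hμ.trans_le hμl
  set S := exactSmoothed f l μ x₀ y₀ z₀ with hS
  have hstep : ∀ t, lyapunov f l (S (t + 1)).x (S (t + 1)).y (S (t + 1)).z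
      + 1 / (144 * l) / 25600 * stationarity f l μ (S t).x (S t).y ≤
        lyapunov f l (S t).x (S t).y (S t).z := by
    intro t
    have h1 := smoothed_descent h.smooth h.pl hμ hμl (τ₁ := 1 / (3 * l)) (τ := 1 / (144 * l))
      (β := 1 / (144 * l) * μ / 1600) (by positivity) (by field_simp; norm_num)
      (by apply le_of_eq; field_simp) rfl ((S t).x, (S t).y, (S t).z)
    have h2 : S (t + 1) = _ := smoothedRun_succ _ _ _ _ _ _ x₀ y₀ z₀ t _
    rw [h2]
    exact h1
  have hsum : lyapunov f l (S T).x (S T).y (S T).z + ∑ t ∈ Finset.range T,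
      1 / (144 * l) / 25600 * stationarity f l μ (S t).x (S t).y ≤ lyapunov f l x₀ y₀ z₀ := by
    induction T with
    | zero => simp [hS, exactSmoothed, smoothedRun]
    | succ T ih =>
      rw [Finset.sum_range_succ]
      linarith [hstep T]
  have h3 := h.lyapunov_sub_le hl hμ
  have h4 := (h.le_moreau hl (S T).z).trans
    (moreau_le_lyapunov h.smooth h.pl hl (S T).x (S T).y (S T).z)
  have h5 : ∑ t ∈ Finset.range T, 1 / (144 * l) / 25600 * stationarity f l μ (S t).x (S t).y ≤
      (1 + B) * Δ := by linarith
  rw [← Finset.mul_sum] at h5 ⊢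
  calc l / μ * ∑ t ∈ Finset.range T, stationarity f l μ (S t).x (S t).y
      = 3686400 * (l * (l / μ)) * (1 / (144 * l) / 25600 *
          ∑ t ∈ Finset.range T, stationarity f l μ (S t).x (S t).y) := by field_simp; ring
    _ ≤ 3686400 * (l * (l / μ)) * ((1 + B) * Δ) := by gcongr
    _ = _ := by ring

theorem norm_gradient_exactTwoStage_sq_le (hs : LipschitzSmooth f l) (hp : PLInY f μ)
    (hμ : 0 < μ) (hμl : μ ≤ l) (x₀ : Euc m) (y₀ : Euc n) (z₀ : Euc m) (T : ℕ) {K : ℕ}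
    (hK : 2 * Real.log (l / μ) / (μ * (1 / (12 * l))) ≤ K) (t : ℕ) :
    ‖gradient (primal f)
      (exactTwoStage f l μ x₀ y₀ z₀ T (4 * (1 / (12 * l))) (1 / (12 * l)) K t).x‖ ^ 2 ≤
    156 * (l / μ * stationarity f l μ (exactSmoothed f l μ x₀ y₀ z₀ t).x
      (exactSmoothed f l μ x₀ y₀ z₀ t).y) := by
  have hl : 0 < l := hμ.trans_le hμl
  have hκ : 1 ≤ l / μ := (one_le_div hμ).2 hμl
  set c := exactSmoothed f l μ x₀ y₀ z₀ t with hc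
  set A := fun k => exactTwoStage f l μ x₀ y₀ z₀ T (4 * (1 / (12 * l))) (1 / (12 * l)) k t
    with hA
  set a := μ * (1 / (12 * l)) with ha
  have ha0 : 0 < a := by positivity
  have ha1 : a ≤ 1 := by
    rw [ha, mul_one_div, div_le_one (by positivity)]; linarith
  have hstep : ∀ k, auxGap f l (A (k + 1)).x (A (k + 1)).y c.x ≤
      (1 - a) * auxGap f l (A k).x (A k).y c.x := by
    intro k
    have h1 := agda_descent hs hp hμ hμl (τ := 1 / (12 * l)) (by positivity)
      (by apply le_of_eq; field_simp) ((A k).x, (A k).y, c.x)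
    have h2 : A (k + 1) = _ := twoStage_succ _ _ l _ _ _ x₀ y₀ z₀ T _ _ t k _
    rw [h2]
    exact h1
  have hpow : ∀ k, auxGap f l (A k).x (A k).y c.x ≤ (1 - a) ^ k * auxGap f l c.x c.y c.x := by
    intro k
    induction k with
    | zero => exact le_of_eq (by rw [pow_zero, one_mul]; rfl)
    | succ k ih =>
      refine (hstep k).trans ((mul_le_mul_of_nonneg_left ih (by linarith)).trans (le_of_eq ?_))
      ring
  have h1 := norm_gradient_primal_sq_le hs hp hμ hμl c.x (A K).x (A K).y c.y
  have h2 := one_sub_pow_mul_sq_le_one hκ ha0 ha1 hK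
  have h3 := auxGap_self_le hs hp hμ hμl c.x c.y
  have h4 := auxGap_nonneg hs hp hl c.x c.y c.x
  -- K is large enough for the contraction to absorb κ². What remains is 32 + 72 = 104 times l times
  -- the initial potential, and 104 · 3/2 = 156.
  have h5 : 72 * l * (l / μ) ^ 2 * auxGap f l (A K).x (A K).y c.x ≤
      72 * l * auxGap f l c.x c.y c.x :=
    calc 72 * l * (l / μ) ^ 2 * auxGap f l (A K).x (A K).y c.x
        ≤ 72 * l * (l / μ) ^ 2 * ((1 - a) ^ K * auxGap f l c.x c.y c.x) := by
          gcongr; exact hpow K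
      _ = 72 * l * ((1 - a) ^ K * (l / μ) ^ 2) * auxGap f l c.x c.y c.x := by ring
      _ ≤ 72 * l * 1 * auxGap f l c.x c.y c.x := by gcongr
      _ = _ := by ring
  calc _ ≤ 104 * l * auxGap f l c.x c.y c.x := by linarith
    _ ≤ 104 * l * (3 / (2 * μ) * stationarity f l μ c.x c.y) := by gcongr
    _ = _ := by field_simp; ring

end Deterministic

/-! ### Stochastic guarantees for both stages. -/

section Stochastic

variable {m n : ℕ} {f : Euc m → Euc n → ℝ} {l μ σ Δ B : ℝ} {x₀ z₀ : Euc m} {y₀ : Euc n}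
  {Φlow : ℝ} {Ξ Ω : Type*} [MeasurableSpace Ξ] [MeasurableSpace Ω] {ν : Measure Ξ}
  [IsProbabilityMeasure ν] {P : Measure Ω} [IsProbabilityMeasure P]
  {Gx : Euc m → Euc n → Ξ → Euc m} {Gy : Euc m → Euc n → Ξ → Euc n} {s : ℕ → Ω → Ξ}

/-- Stage 2 for a fixed index t. The iterate with k = 0 is the selected point, centred at itself,
and 1980 = 72 · 55/2. -/
theorem lintegral_gradient_bound_le (hs : LipschitzSmooth f l) (hp : PLInY f μ)
    (hG : StochasticGradients ν f Gx Gy σ) (hsm : ∀ k, Measurable (s k))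
    (hlaw : ∀ k, P.map (s k) = ν) (hind : iIndepFun s P)
    (hμ : 0 < μ) (hμl : μ ≤ l) {τ : ℝ} (hτ : 0 < τ) (hτl : l * τ ≤ 1 / 12) (τ₁ τ₂ β : ℝ)
    (x₀ : Euc m) (y₀ : Euc n) (z₀ : Euc m) {T t : ℕ} (ht : t ≤ T) {K : ℕ}
    (hK : 2 * Real.log (l / μ) / (μ * τ) ≤ K) :
    ∫⁻ ω, ENNReal.ofReal (32 * l * auxGap f l
          (agdaIterate Gx Gy l τ₁ τ₂ β x₀ y₀ z₀ T (4 * τ) τ t 0 fun k => s k ω).1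
          (agdaIterate Gx Gy l τ₁ τ₂ β x₀ y₀ z₀ T (4 * τ) τ t 0 fun k => s k ω).2.1
          (agdaIterate Gx Gy l τ₁ τ₂ β x₀ y₀ z₀ T (4 * τ) τ t 0 fun k => s k ω).2.2
        + 72 * l * (l / μ) ^ 2 * auxGap f l
          (agdaIterate Gx Gy l τ₁ τ₂ β x₀ y₀ z₀ T (4 * τ) τ t K fun k => s k ω).1
          (agdaIterate Gx Gy l τ₁ τ₂ β x₀ y₀ z₀ T (4 * τ) τ t K fun k => s k ω).2.1
          (agdaIterate Gx Gy l τ₁ τ₂ β x₀ y₀ z₀ T (4 * τ) τ t K fun k => s k ω).2.2) ∂P ≤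
      ENNReal.ofReal (156 * (l / μ)) * ∫⁻ ω, ENNReal.ofReal (stationarity f l μ
        (smoothedIterate Gx Gy τ₁ τ₂ (2 * l) β x₀ y₀ z₀ t fun k => s k ω).1
        (smoothedIterate Gx Gy τ₁ τ₂ (2 * l) β x₀ y₀ z₀ t fun k => s k ω).2.1) ∂P
      + ENNReal.ofReal (1980 * l * (l / μ) ^ 3 * τ * σ ^ 2) := by
  have hl : 0 < l := hμ.trans_le hμl
  have hκ : 1 ≤ l / μ := (one_le_div hμ).2 hμl
  have hS : Measurable fun ω k => s k ω := measurable_pi_lambda _ hsm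
  set φ := smoothedIterate Gx Gy τ₁ τ₂ (2 * l) β x₀ y₀ z₀ t
  set ψ := agdaIterate Gx Gy l τ₁ τ₂ β x₀ y₀ z₀ T (4 * τ) τ t with hψ
  have hV : ∀ k, Measurable fun ω => ENNReal.ofReal (auxGap f l (ψ k fun k => s k ω).1
      (ψ k fun k => s k ω).2.1 (ψ k fun k => s k ω).2.2) := fun k =>
    (measurable_auxGap hs hp hl hμ).ennreal_ofReal.comp
      ((hG.measurable_agdaIterate l τ₁ τ₂ β x₀ y₀ z₀ T (4 * τ) τ t k).comp hS)
  have hSt : Measurable fun ω => ENNReal.ofReal (stationarity f l μ (φ fun k => s k ω).1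
      (φ fun k => s k ω).2.1) :=
    (measurable_stationarity hs).ennreal_ofReal.comp
      ((hG.measurable_smoothedIterate τ₁ τ₂ (2 * l) β x₀ y₀ z₀ t).comp hS)
  set U := fun k => ∫⁻ ω, ENNReal.ofReal (auxGap f l (ψ k fun k => s k ω).1
      (ψ k fun k => s k ω).2.1 (ψ k fun k => s k ω).2.2) ∂P with hU
  set S := ∫⁻ ω, ENNReal.ofReal (stationarity f l μ (φ fun k => s k ω).1
      (φ fun k => s k ω).2.1) ∂P with hSdef
  have ha1 : μ * τ ≤ 1 := by nlinarith
  have hpow := one_sub_pow_mul_sq_le_one hκ (mul_pos hμ hτ) ha1 hK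
  have hUK : U K ≤ ENNReal.ofReal ((1 - μ * τ) ^ K) * U 0
      + ENNReal.ofReal (55 / 2 * (l / μ) * τ * σ ^ 2) :=
    lintegral_auxGap_le hs hp hG hsm hlaw hind hμ hμl hτ hτl τ₁ τ₂ β x₀ y₀ z₀ ht K
  have hU0 : U 0 ≤ ENNReal.ofReal (3 / (2 * μ)) * S := by
    rw [hSdef, ← lintegral_const_mul _ hSt]
    refine lintegral_mono fun ω => ?_
    rw [← ENNReal.ofReal_mul (by positivity)]
    exact ENNReal.ofReal_le_ofReal (auxGap_self_le hs hp hμ hμl _ _)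
  have hpow' : ENNReal.ofReal (72 * l * (l / μ) ^ 2) * ENNReal.ofReal ((1 - μ * τ) ^ K) ≤
      ENNReal.ofReal (72 * l) := by
    rw [← ENNReal.ofReal_mul (by positivity)]
    refine ENNReal.ofReal_le_ofReal ?_
    calc 72 * l * (l / μ) ^ 2 * (1 - μ * τ) ^ K = 72 * l * ((1 - μ * τ) ^ K * (l / μ) ^ 2) := by
          ring
      _ ≤ 72 * l * 1 := by gcongr
      _ = 72 * l := mul_one _
  calc _ = ENNReal.ofReal (32 * l) * U 0 + ENNReal.ofReal (72 * l * (l / μ) ^ 2) * U K := by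
        rw [hU, ← lintegral_const_mul _ (hV 0), ← lintegral_const_mul _ (hV K),
          ← lintegral_add_right _ ((hV K).const_mul _)]
        refine lintegral_congr fun ω => ?_
        have h0 := fun k => auxGap_nonneg hs hp hl (ψ k fun k => s k ω).1
          (ψ k fun k => s k ω).2.1 (ψ k fun k => s k ω).2.2
        rw [← ENNReal.ofReal_mul (by positivity), ← ENNReal.ofReal_mul (by positivity),
          ← ENNReal.ofReal_add (mul_nonneg (by positivity) (h0 0))
            (mul_nonneg (by positivity) (h0 K))]
    _ ≤ ENNReal.ofReal (32 * l) * U 0 + ENNReal.ofReal (72 * l * (l / μ) ^ 2) *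
        (ENNReal.ofReal ((1 - μ * τ) ^ K) * U 0
          + ENNReal.ofReal (55 / 2 * (l / μ) * τ * σ ^ 2)) := by gcongr
    _ = (ENNReal.ofReal (32 * l) + ENNReal.ofReal (72 * l * (l / μ) ^ 2) *
        ENNReal.ofReal ((1 - μ * τ) ^ K)) * U 0
          + ENNReal.ofReal (72 * l * (l / μ) ^ 2) *
            ENNReal.ofReal (55 / 2 * (l / μ) * τ * σ ^ 2) := by ring
    _ ≤ (ENNReal.ofReal (32 * l) + ENNReal.ofReal (72 * l)) * (ENNReal.ofReal (3 / (2 * μ)) * S)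
          + ENNReal.ofReal (72 * l * (l / μ) ^ 2) *
            ENNReal.ofReal (55 / 2 * (l / μ) * τ * σ ^ 2) := by gcongr
    _ = _ := by
        rw [← ENNReal.ofReal_add (by positivity) (by positivity), ← mul_assoc,
          ← ENNReal.ofReal_mul (by positivity), ← ENNReal.ofReal_mul (by positivity)]
        congr 2
        · congr 1; field_simp; ring
        · ring

theorem lintegral_gradient_stochTwoStage_le (h : Setting f l μ Δ B x₀ y₀ z₀ Φlow)
    (hG : StochasticGradients ν f Gx Gy σ) (hμ : 0 < μ) (hμl : μ ≤ l) (hσ : 0 < σ) (hΔ : 0 < Δ)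
    (hB : 0 ≤ B) {ε : ℝ} (hε : 0 < ε) {T : ℕ} {I : Ω → Fin T} (hM : SamplingModel P ν s I)
    (hT : 0 < T) (hT1 : (1 + B) ^ 2 * (l * (l / μ) * Δ / ε ^ 2
      + l * (l / μ) ^ 2 * Δ * σ ^ 2 / ε ^ 4) ≤ T)
    {τ : ℝ} (hτ : 0 < τ) (hτl : l * τ ≤ 1 / 12) (hτε : l * (l / μ) ^ 3 * τ * σ ^ 2 ≤ ε ^ 2)
    {K : ℕ} (hK : 2 * Real.log (l / μ) / (μ * τ) ≤ K) :
    ∫⁻ ω, ‖gradient (primal f) (stochTwoStage Gx Gy (fun k => s k ω) l μ σ Δ x₀ y₀ z₀ T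
      (4 * τ) τ K (I ω)).x‖ₑ ^ 2 ∂P ≤ ENNReal.ofReal (1160000000 * ε ^ 2) := by
  have hl : 0 < l := hμ.trans_le hμl
  have hκ : 1 ≤ l / μ := (one_le_div hμ).2 hμl
  have hT0 : (0 : ℝ) < T := by exact_mod_cast hT
  have hs := h.smooth
  have hp := h.pl
  have hτ2 := tauY_pos hl hσ hΔ hT
  have hS : Measurable fun ω k => s k ω := measurable_pi_lambda _ hM.measurable_sample
  set τ₁ := tauX l σ Δ T with hτ₁
  set τ₂ := tauY l σ Δ T with hτ₂
  set β := τ₂ * μ / 1600 with hβ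
  set φ := smoothedIterate Gx Gy τ₁ τ₂ (2 * l) β x₀ y₀ z₀
  set ψ := agdaIterate Gx Gy l τ₁ τ₂ β x₀ y₀ z₀ T (4 * τ) τ with hψ
  -- A measurable majorant of the squared gradient norm, to which the averaging over the independent
  -- index applies.
  set H : Fin T → (ℕ → Ξ) → ℝ≥0∞ := fun t r => ENNReal.ofReal
    (32 * l * auxGap f l (ψ t 0 r).1 (ψ t 0 r).2.1 (ψ t 0 r).2.2
      + 72 * l * (l / μ) ^ 2 * auxGap f l (ψ t K r).1 (ψ t K r).2.1 (ψ t K r).2.2) with hH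
  have hHm : ∀ t, Measurable (H t) := fun t => by
    have hm : ∀ k, Measurable fun r => auxGap f l (ψ t k r).1 (ψ t k r).2.1 (ψ t k r).2.2 :=
      fun k => (measurable_auxGap hs hp hl hμ).comp
        (hG.measurable_agdaIterate l τ₁ τ₂ β x₀ y₀ z₀ T (4 * τ) τ t k)
    exact (((hm 0).const_mul _).add ((hm K).const_mul _)).ennreal_ofReal
  have hpt : ∀ ω, ‖gradient (primal f) (stochTwoStage Gx Gy (fun k => s k ω) l μ σ Δ x₀ y₀ z₀ T
      (4 * τ) τ K (I ω)).x‖ₑ ^ 2 ≤ H (I ω) fun k => s k ω := fun ω => by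
    rw [← ofReal_norm, ← ENNReal.ofReal_pow (norm_nonneg _)]
    exact ENNReal.ofReal_le_ofReal (norm_gradient_primal_sq_le hs hp hμ hμl _ _ _ _)
  have hsum := sum_lintegral_stationarity_le hs hp hG hM.measurable_sample hM.law hM.indep hμ hμl
    hτ2.le (tauX_eq l σ Δ T) (mul_tauY_le hl) hβ (h.le_moreau hl) x₀ y₀ z₀ T
  set S := fun t => ∫⁻ ω, ENNReal.ofReal (stationarity f l μ (φ t fun k => s k ω).1
      (φ t fun k => s k ω).2.1) ∂P with hSdef
  have hSsum : ∑ t ∈ Finset.range T, S t ≤ ENNReal.ofReal (25600 / τ₂ *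
      ((1 + B) * Δ + T * (2 * l * τ₁ ^ 2 * σ ^ 2))) := by
    have h1 : ∀ t, S t = ENNReal.ofReal (25600 / τ₂) * ∫⁻ ω, ENNReal.ofReal (τ₂ / 25600 *
        stationarity f l μ (φ t fun k => s k ω).1 (φ t fun k => s k ω).2.1) ∂P := by
      intro t
      have hm : Measurable fun ω => ENNReal.ofReal (τ₂ / 25600 *
          stationarity f l μ (φ t fun k => s k ω).1 (φ t fun k => s k ω).2.1) :=
        ((measurable_stationarity hs).const_mul _).ennreal_ofReal.comp
          ((hG.measurable_smoothedIterate τ₁ τ₂ (2 * l) β x₀ y₀ z₀ t).comp hS)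
      rw [← lintegral_const_mul _ hm]
      refine lintegral_congr fun ω => ?_
      rw [← ENNReal.ofReal_mul (by positivity)]
      congr 1
      field_simp
    simp only [h1]
    rw [← Finset.mul_sum, ENNReal.ofReal_mul (by positivity)]
    gcongr
    refine hsum.trans ?_
    rw [ENNReal.ofReal_add (by positivity) (by positivity), ENNReal.ofReal_mul hT0.le,
      ENNReal.ofReal_natCast]
    gcongr
    exact h.lyapunov_sub_le hl hμ
  have hbudget := stochastic_budget_le hl hκ hσ hΔ hB hε hT hT1
  have hTinv : (T : ℝ≥0∞)⁻¹ = ENNReal.ofReal (1 / T) := by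
    rw [one_div, ENNReal.ofReal_inv_of_pos hT0, ENNReal.ofReal_natCast]
  have hTT : ENNReal.ofReal (1 / T) * (T : ℝ≥0∞) = 1 := by
    rw [← hTinv]
    exact ENNReal.inv_mul_cancel (by exact_mod_cast hT.ne') (ENNReal.natCast_ne_top T)
  calc _ ≤ ∫⁻ ω, H (I ω) (fun k => s k ω) ∂P := lintegral_mono hpt
    _ = (T : ℝ≥0∞)⁻¹ * ∑ t, ∫⁻ ω, H t (fun k => s k ω) ∂P :=
        lintegral_uniform_index hM.measurable_sample hM.measurable_index hM.uniform
          hM.indep_index hHm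
    _ ≤ (T : ℝ≥0∞)⁻¹ * ∑ t : Fin T, (ENNReal.ofReal (156 * (l / μ)) * S t
          + ENNReal.ofReal (1980 * l * (l / μ) ^ 3 * τ * σ ^ 2)) := by
        gcongr with t
        exact lintegral_gradient_bound_le hs hp hG hM.measurable_sample hM.law hM.indep hμ hμl
          hτ hτl τ₁ τ₂ β x₀ y₀ z₀ t.2.le hK
    _ = ENNReal.ofReal (1 / T) * (ENNReal.ofReal (156 * (l / μ)) * ∑ t ∈ Finset.range T, S t)
          + ENNReal.ofReal (1 / T) * T * ENNReal.ofReal (1980 * l * (l / μ) ^ 3 * τ * σ ^ 2) := by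
        rw [hTinv, Finset.sum_add_distrib, ← Finset.mul_sum, Finset.sum_range, Finset.sum_const,
          Finset.card_univ, Fintype.card_fin, nsmul_eq_mul]
        ring
    _ ≤ ENNReal.ofReal (1 / T) * (ENNReal.ofReal (156 * (l / μ)) * ENNReal.ofReal (25600 / τ₂ *
          ((1 + B) * Δ + T * (2 * l * τ₁ ^ 2 * σ ^ 2))))
          + ENNReal.ofReal (1980 * l * (l / μ) ^ 3 * τ * σ ^ 2) := by
        rw [hTT, one_mul]
        gcongr
    _ = ENNReal.ofReal (156 * (1 / T * (l / μ * (25600 / τ₂ *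
          ((1 + B) * Δ + T * (2 * l * τ₁ ^ 2 * σ ^ 2)))))
          + 1980 * l * (l / μ) ^ 3 * τ * σ ^ 2) := by
        rw [← ENNReal.ofReal_mul (by positivity), ← ENNReal.ofReal_mul (by positivity),
          ← ENNReal.ofReal_add (by positivity) (by positivity)]
        congr 1
        ring
    _ ≤ _ := by
        refine ENNReal.ofReal_le_ofReal ?_
        have : 0 < ε ^ 2 := by positivity
        linarith

end Stochastic

/-! ### Counting gradient evaluations. -/

section Complexity

theorem deterministic_complexity_le {l μ Δ B ε : ℝ} (hμ : 0 < μ) (hμl : μ ≤ l)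
    (hΔ : 0 < Δ) (hB : 0 ≤ B) (hε : 0 < ε) {T K : ℕ}
    (hT : (T : ℝ) ≤ 3686400 * ((1 + B) * (l * (l / μ) * Δ / ε ^ 2)) + 1)
    (hK : (K : ℝ) ≤ 2 * Real.log (l / μ) / (μ * (1 / (12 * l))) + 1) :
    (2 * T + 2 * K : ℝ) ≤ 100000000 * ((1 + B) * (l * (l / μ) * Δ / ε ^ 2)
        + l / μ * (1 + Real.log (l / μ))) ∧
      (ε ^ 2 * (1 + Real.log (l / μ)) ≤ l * Δ →
        (2 * T + 2 * K : ℝ) ≤ 100000000 * (1 + B) * (l * (l / μ) * Δ / ε ^ 2)) := by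
  have hl : 0 < l := hμ.trans_le hμl
  have hκ : 1 ≤ l / μ := (one_le_div hμ).2 hμl
  have hL := Real.log_nonneg hκ
  have h1 : 2 * Real.log (l / μ) / (μ * (1 / (12 * l))) = 24 * (l / μ * Real.log (l / μ)) := by
    field_simp; ring
  rw [h1] at hK
  set κ := l / μ
  set L := Real.log κ
  set X := l * κ * Δ / ε ^ 2 with hX
  have hX0 : 0 < X := by positivity
  have hκL : 0 ≤ κ * L := by positivity
  have hBX : 0 ≤ B * X := by positivity
  refine ⟨by linarith, fun h2 => ?_⟩
  have h3 : κ * (1 + L) ≤ X := by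
    rw [hX, le_div_iff₀ (by positivity)]
    calc κ * (1 + L) * ε ^ 2 = κ * (ε ^ 2 * (1 + L)) := by ring
      _ ≤ κ * (l * Δ) := by gcongr
      _ = _ := by ring
  linarith

theorem stochastic_complexity_le {l μ σ Δ B ε : ℝ} (hμ : 0 < μ) (hμl : μ ≤ l) (hσ : 0 < σ)
    (hΔ : 0 < Δ) (hB : 0 ≤ B) (hε : 0 < ε) {T K : ℕ} {τ : ℝ}
    (hτ : τ = min (1 / (12 * l)) (ε ^ 2 / (l * (l / μ) ^ 3 * σ ^ 2)))
    (hT : (T : ℝ) ≤ (1 + B) ^ 2 * (l * (l / μ) * Δ / ε ^ 2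
      + l * (l / μ) ^ 2 * Δ * σ ^ 2 / ε ^ 4) + 1)
    (hK : (K : ℝ) ≤ 2 * Real.log (l / μ) / (μ * τ) + 1) :
    (2 * T + 2 * K : ℝ) ≤ 100000000 * ((1 + B) ^ 2 * (l * (l / μ) * Δ / ε ^ 2
        + l * (l / μ) ^ 2 * Δ * σ ^ 2 / ε ^ 4)
        + (1 + Real.log (l / μ)) * (l / μ + (l / μ) ^ 5 * σ ^ 2 / ε ^ 2)) ∧
      (ε ^ 2 ≤ l * Δ →
        (2 * T + 2 * K : ℝ) ≤ 100000000 * (1 + B) ^ 2 * (1 + Real.log (l / μ)) *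
          (l * (l / μ) * Δ / ε ^ 2 + l * (l / μ) ^ 2 * Δ * σ ^ 2 / ε ^ 4
            + (l / μ) ^ 5 * σ ^ 2 / ε ^ 2)) := by
  have hl : 0 < l := hμ.trans_le hμl
  have hκ : 1 ≤ l / μ := (one_le_div hμ).2 hμl
  have hL := Real.log_nonneg hκ
  have h1 : 1 / τ ≤ 12 * l + l * (l / μ) ^ 3 * σ ^ 2 / ε ^ 2 := by
    rw [hτ]
    refine (one_div_min_le (by positivity) (by positivity)).trans (le_of_eq ?_)
    rw [one_div_one_div, one_div_div]
  have h2 : 2 * Real.log (l / μ) / (μ * τ) ≤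
      2 * Real.log (l / μ) * (12 * (l / μ) + (l / μ) ^ 5 * σ ^ 2 / ε ^ 2) := by
    calc 2 * Real.log (l / μ) / (μ * τ) = 2 * Real.log (l / μ) * (1 / μ * (1 / τ)) := by
          rw [one_div_mul_one_div]; ring
      _ ≤ 2 * Real.log (l / μ) * (1 / μ * (12 * l + l * (l / μ) ^ 3 * σ ^ 2 / ε ^ 2)) := by
          gcongr
      _ = 2 * Real.log (l / μ) * (12 * (l / μ) + (l / μ) ^ 4 * σ ^ 2 / ε ^ 2) := by
          field_simp
      _ ≤ _ := by
          -- The argument yields κ⁴; it is weakened to the stated κ⁵.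
          have := pow_le_pow_right₀ hκ (show 4 ≤ 5 by norm_num)
          gcongr
  set κ := l / μ
  set L := Real.log κ
  set X := l * κ * Δ / ε ^ 2 with hX
  set Y := l * κ ^ 2 * Δ * σ ^ 2 / ε ^ 4 with hY
  set Z := κ ^ 5 * σ ^ 2 / ε ^ 2 with hZ
  have hX0 : 0 < X := by positivity
  have hY0 : 0 < Y := by positivity
  have hZ0 : 0 < Z := by positivity
  have hκL : 0 ≤ L * κ := by positivity
  have hZL : 0 ≤ L * Z := by positivity
  have hBXY : 0 ≤ (1 + B) ^ 2 * (X + Y) := by positivity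
  have h3 : (2 * T + 2 * K : ℝ) ≤ 52 * ((1 + B) ^ 2 * (X + Y) + (1 + L) * (κ + Z)) := by
    linarith
  have h4 : 0 ≤ (1 + L) * (κ + Z) := by positivity
  refine ⟨by linarith, fun h5 => ?_⟩
  have h6 : κ ≤ X := by
    rw [hX, le_div_iff₀ (by positivity)]
    calc κ * ε ^ 2 ≤ κ * (l * Δ) := by gcongr
      _ = _ := by ring
  have hB1 : 1 ≤ (1 + B) ^ 2 := by nlinarith
  have h7 : (1 + B) ^ 2 * (X + Y) ≤ (1 + B) ^ 2 * (1 + L) * (X + Y) := by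
    have : 0 ≤ L * ((1 + B) ^ 2 * (X + Y)) := by positivity
    linarith
  have h8 : (1 + L) * (κ + Z) ≤ (1 + B) ^ 2 * (1 + L) * (X + Z) := by
    calc (1 + L) * (κ + Z) ≤ 1 * ((1 + L) * (X + Z)) := by rw [one_mul]; gcongr
      _ ≤ (1 + B) ^ 2 * ((1 + L) * (X + Z)) := by gcongr
      _ = _ := by ring
  have h9 : 0 ≤ (1 + B) ^ 2 * (1 + L) * (X + Y + Z) := by positivity
  have h10 : (1 + B) ^ 2 * (1 + L) * (X + Y) + (1 + B) ^ 2 * (1 + L) * (X + Z) ≤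
      2 * ((1 + B) ^ 2 * (1 + L) * (X + Y + Z)) := by
    have : 0 ≤ (1 + B) ^ 2 * (1 + L) * Y := by positivity
    have : 0 ≤ (1 + B) ^ 2 * (1 + L) * Z := by positivity
    linarith
  linarith

end Complexity

end NCPL
-- The main theorem: fixing the parameters.
theorem corollary2 :
    ∃ C : ℝ, 0 < C ∧
      -- deterministic setting
      (∀ l μ κ Δ B ε : ℝ, 0 < μ → μ ≤ l → κ = l / μ → 0 < Δ → 0 ≤ B → 0 < ε →
        ∃ (T K : ℕ) (η₁ η₂ : ℝ), 0 < T ∧ 0 < η₁ ∧ 0 < η₂ ∧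
          ∀ (m n : ℕ) (f : NCPL.Euc m → NCPL.Euc n → ℝ)
            (x₀ : NCPL.Euc m) (y₀ : NCPL.Euc n) (z₀ : NCPL.Euc m) (Φlow : ℝ),
            NCPL.Setting f l μ Δ B x₀ y₀ z₀ Φlow →
            Differentiable ℝ (NCPL.primal f) ∧
            -- output selected uniformly among the iterates: stationarity in mean square
            (1 / (T : ℝ)) * ∑ t ∈ Finset.range T,
              ‖gradient (NCPL.primal f)
                (NCPL.exactTwoStage f l μ x₀ y₀ z₀ T η₁ η₂ K t).x‖ ^ 2 ≤ (C * ε) ^ 2 ∧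
            -- some iterate is stationary for `f`, and every such iterate is translated
            (∃ t < T, NCPL.IsStationary f ε (ε / √κ)
              (NCPL.exactSmoothed f l μ x₀ y₀ z₀ t).x
              (NCPL.exactSmoothed f l μ x₀ y₀ z₀ t).y) ∧
            (∀ t < T, NCPL.IsStationary f ε (ε / √κ)
              (NCPL.exactSmoothed f l μ x₀ y₀ z₀ t).x
              (NCPL.exactSmoothed f l μ x₀ y₀ z₀ t).y →
              ‖gradient (NCPL.primal f)
                (NCPL.exactTwoStage f l μ x₀ y₀ z₀ T η₁ η₂ K t).x‖ ≤ C * ε) ∧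
            -- total number of gradient evaluations
            (∀ t < T,
              ((NCPL.exactTwoStage f l μ x₀ y₀ z₀ T η₁ η₂ K t).queries : ℝ) ≤
                C * ((1 + B) * (l * κ * Δ / ε ^ 2) + κ * (1 + Real.log κ)) ∧
              (ε ^ 2 * (1 + Real.log κ) ≤ l * Δ →
                ((NCPL.exactTwoStage f l μ x₀ y₀ z₀ T η₁ η₂ K t).queries : ℝ) ≤
                  C * (1 + B) * (l * κ * Δ / ε ^ 2)))) ∧
      -- stochastic setting
      (∀ l μ κ σ Δ B ε : ℝ, 0 < μ → μ ≤ l → κ = l / μ → 0 < σ → 0 < Δ → 0 ≤ B → 0 < ε →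
        ∃ (T K : ℕ) (η₁ η₂ : ℝ), 0 < T ∧ 0 < η₁ ∧ 0 < η₂ ∧
          ∀ (m n : ℕ) (f : NCPL.Euc m → NCPL.Euc n → ℝ)
            (x₀ : NCPL.Euc m) (y₀ : NCPL.Euc n) (z₀ : NCPL.Euc m) (Φlow : ℝ)
            (Ξ : Type*) [MeasurableSpace Ξ] (ν : MeasureTheory.Measure Ξ)
            [MeasureTheory.IsProbabilityMeasure ν]
            (Gx : NCPL.Euc m → NCPL.Euc n → Ξ → NCPL.Euc m)
            (Gy : NCPL.Euc m → NCPL.Euc n → Ξ → NCPL.Euc n)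
            (Ω : Type*) [MeasurableSpace Ω] (P : MeasureTheory.Measure Ω)
            [MeasureTheory.IsProbabilityMeasure P]
            (s : ℕ → Ω → Ξ) (I : Ω → Fin T),
            NCPL.Setting f l μ Δ B x₀ y₀ z₀ Φlow →
            NCPL.StochasticGradients ν f Gx Gy σ →
            NCPL.SamplingModel P ν s I →
            Differentiable ℝ (NCPL.primal f) ∧
            -- stationarity in mean square
            ∫⁻ ω, ‖gradient (NCPL.primal f)
              (NCPL.stochTwoStage Gx Gy (fun k => s k ω) l μ σ Δ x₀ y₀ z₀ T η₁ η₂ K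
                (I ω)).x‖ₑ ^ 2 ∂P ≤ ENNReal.ofReal ((C * ε) ^ 2) ∧
            -- total number of stochastic gradients
            (∀ ω,
              ((NCPL.stochTwoStage Gx Gy (fun k => s k ω) l μ σ Δ x₀ y₀ z₀ T η₁ η₂ K
                (I ω)).queries : ℝ) ≤
                C * ((1 + B) ^ 2 *
                    (l * κ * Δ / ε ^ 2 + l * κ ^ 2 * Δ * σ ^ 2 / ε ^ 4)
                  + (1 + Real.log κ) * (κ + κ ^ 5 * σ ^ 2 / ε ^ 2)) ∧
              (ε ^ 2 ≤ l * Δ →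
                ((NCPL.stochTwoStage Gx Gy (fun k => s k ω) l μ σ Δ x₀ y₀ z₀ T η₁ η₂ K
                  (I ω)).queries : ℝ) ≤
                  C * (1 + B) ^ 2 * (1 + Real.log κ) *
                    (l * κ * Δ / ε ^ 2 + l * κ ^ 2 * Δ * σ ^ 2 / ε ^ 4
                      + κ ^ 5 * σ ^ 2 / ε ^ 2)))) := by
  refine ⟨100000000, by norm_num, ?_, ?_⟩
  · intro l μ κ Δ B ε hμ hμl hκ hΔ hB hε
    subst hκ
    have hl : 0 < l := hμ.trans_le hμl
    set X := (1 + B) * (l * (l / μ) * Δ / ε ^ 2) with hX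
    have hX0 : 0 < X := by positivity
    have hLK : 0 ≤ 2 * Real.log (l / μ) / (μ * (1 / (12 * l))) := by
      have := Real.log_nonneg ((one_le_div hμ).2 hμl)
      positivity
    -- 3686400 = 144 · 25600 makes the average of κ · `stationarity` at most ε². Since X > 0 the
    -- ceiling is at least 1, whereas K may be 0, namely when κ = 1.
    have hT : 0 < ⌈3686400 * X⌉₊ := Nat.ceil_pos.2 (by positivity)
    set T := ⌈3686400 * X⌉₊ with hTdef
    set K := ⌈2 * Real.log (l / μ) / (μ * (1 / (12 * l)))⌉₊ with hKdef
    have hT0 : (0 : ℝ) < T := by exact_mod_cast hT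
    refine ⟨T, K, 4 * (1 / (12 * l)), 1 / (12 * l), hT, by positivity, by positivity, ?_⟩
    intro m n f x₀ y₀ z₀ Φlow h
    set S := NCPL.exactSmoothed f l μ x₀ y₀ z₀ with hS
    have hsum : ∑ t ∈ Finset.range T, l / μ * NCPL.stationarity f l μ (S t).x (S t).y ≤
        T * ε ^ 2 := by
      refine (NCPL.sum_stationarity_exactSmoothed_le h hμ hμl T).trans ?_
      calc 3686400 * ((1 + B) * (l * (l / μ) * Δ)) = 3686400 * X * ε ^ 2 := by
            rw [hX]; field_simp
        _ ≤ T * ε ^ 2 := by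
            gcongr
            exact Nat.le_ceil _
    have hpt := fun t => NCPL.norm_gradient_exactTwoStage_sq_le h.smooth h.pl hμ hμl x₀ y₀ z₀ T
      (Nat.le_ceil _ : _ ≤ (K : ℝ)) t
    refine ⟨NCPL.differentiable_primal h.smooth h.pl hl hμ, ?_, ?_, ?_, ?_⟩
    · rw [one_div_mul_eq_div, div_le_iff₀ hT0]
      refine (Finset.sum_le_sum fun t _ => hpt t).trans ?_
      rw [← Finset.mul_sum]
      have h1 : 0 ≤ (T : ℝ) * ε ^ 2 := by positivity
      linarith
    · have h1 : ∑ t ∈ Finset.range T, l / μ * NCPL.stationarity f l μ (S t).x (S t).y ≤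
          ∑ t ∈ Finset.range T, ε ^ 2 := by simpa using hsum
      obtain ⟨t, ht, hle⟩ := Finset.exists_le_of_sum_le (Finset.nonempty_range_iff.2 hT.ne') h1
      exact ⟨t, Finset.mem_range.1 ht, NCPL.isStationary_of_le hμ hl hε hle⟩
    · intro t _ hst
      have h1 := (hpt t).trans (mul_le_mul_of_nonneg_left (hst.stationarity_le hμ hl)
        (by norm_num))
      refine le_of_sq_le_sq (h1.trans ?_) (by positivity)
      have : 0 < ε ^ 2 := by positivity
      linarith
    · intro t _
      have h1 : (NCPL.exactTwoStage f l μ x₀ y₀ z₀ T (4 * (1 / (12 * l))) (1 / (12 * l)) K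
          t).queries = 2 * T + 2 * K := NCPL.twoStage_queries ..
      rw [h1]
      push_cast
      exact NCPL.deterministic_complexity_le hμ hμl hΔ hB hε
        (Nat.ceil_lt_add_one (by positivity)).le (Nat.ceil_lt_add_one hLK).le
  · intro l μ κ σ Δ B ε hμ hμl hκ hσ hΔ hB hε
    subst hκ
    have hl : 0 < l := hμ.trans_le hμl
    -- The first branch is the smoothness limit of AGDA; the second brings its noise floor,
    -- amplified to order lκ³τσ² in the squared gradient, down to order ε².
    obtain ⟨τ, hτdef⟩ : ∃ τ, τ = min (1 / (12 * l)) (ε ^ 2 / (l * (l / μ) ^ 3 * σ ^ 2)) :=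
      ⟨_, rfl⟩
    have hτ : 0 < τ := by rw [hτdef]; positivity
    have hτl : l * τ ≤ 1 / 12 := by
      calc l * τ ≤ l * (1 / (12 * l)) := by
            rw [hτdef]; exact mul_le_mul_of_nonneg_left (min_le_left _ _) hl.le
        _ = 1 / 12 := by field_simp
    have hτε : l * (l / μ) ^ 3 * τ * σ ^ 2 ≤ ε ^ 2 := by
      have : τ ≤ ε ^ 2 / (l * (l / μ) ^ 3 * σ ^ 2) := by rw [hτdef]; exact min_le_right _ _
      rw [le_div_iff₀ (by positivity)] at this
      linarith
    have hLK : 0 ≤ 2 * Real.log (l / μ) / (μ * τ) := by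
      have := Real.log_nonneg ((one_le_div hμ).2 hμl)
      positivity
    set X := (1 + B) ^ 2 * (l * (l / μ) * Δ / ε ^ 2
      + l * (l / μ) ^ 2 * Δ * σ ^ 2 / ε ^ 4) with hX
    have hX0 : 0 < X := by positivity
    have hT : 0 < ⌈X⌉₊ := Nat.ceil_pos.2 hX0
    set T := ⌈X⌉₊ with hTdef
    set K := ⌈2 * Real.log (l / μ) / (μ * τ)⌉₊ with hKdef
    refine ⟨T, K, 4 * τ, τ, hT, by positivity, hτ, ?_⟩
    intro m n f x₀ y₀ z₀ Φlow Ξ _ ν _ Gx Gy Ω _ P _ s I h hG hM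
    refine ⟨NCPL.differentiable_primal h.smooth h.pl hl hμ, ?_, fun ω => ?_⟩
    · refine (NCPL.lintegral_gradient_stochTwoStage_le h hG hμ hμl hσ hΔ hB hε hM hT
        (Nat.le_ceil _) hτ hτl hτε (Nat.le_ceil _)).trans (ENNReal.ofReal_le_ofReal ?_)
      have : 0 < ε ^ 2 := by positivity
      linarith
    · have h1 : (NCPL.stochTwoStage Gx Gy (fun k => s k ω) l μ σ Δ x₀ y₀ z₀ T (4 * τ) τ K
          (I ω)).queries = 2 * T + 2 * K := NCPL.twoStage_queries ..
      rw [h1]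
      push_cast
      exact NCPL.stochastic_complexity_le hμ hμl hσ hΔ hB hε hτdef
        (Nat.ceil_lt_add_one hX0.le).le (Nat.ceil_lt_add_one hLK).le
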